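/- **Setting.** All graphs are finite and simple; $\Delta$ is the maximum degree of $G$ (with $\Delta=0$ if $G$ has no vertex). A *vertex-colouring* of $G=(V,E)$ assigns a positive integer to every vertex so that adjacent vertices receive different integers. A *Brooks-colouring* of $G$ is a vertex-colouring in which the number of colours used is at most $\Delta$, or at most $\Delta+1$ if $G$ is a complete graph or an odd cycle (of length at least $3$). Call a connected component of $G$ *exceptional* if its maximum degree equals $\Delta$ and it is a complete graph or an odd cycle. **Model.** Algorithms are programs (built from elementary instructions by sequential composition, branching and while-loops) for a unit-cost random access machine with registers and arrays that hold natural numbers. An elementary instruction loads a constant, copies a register, takes a successor, a predecessor or a truncated difference, or reads or writes one array entry whose index is in a register; two registers can be compared by $<$, $=$, $\neq$. Every elementary instruction and every comparison counts as one step. (So in linear time only numbers of $O(\log(|V|+|E|))$ bits are computed.) A graph with $V=\{0,\dots,n-1\}$ is given by $n$ and its adjacency lists, each in arbitrary order, stored consecutively in an array, together with the array of the starting positions of the lists; all other memory is initially $0$. The colours are output in an array indexed by the vertices. **Theorem.** There are a program and a constant $C$ such that, for every graph $G=(V,E)$ and every such adjacency-list representation of $G$, the program halts after at most $C\,(|V|+|E|+1)$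 steps and outputs a vertex-colouring of $G$ with at most $\Delta+1$ colours, which is a Brooks-colouring of $G$ whenever $G$ is connected or has no exceptional component. (The additive $1$ matters only for the graph without vertices. A disconnected graph with an exceptional component has no Brooks-colouring.) -/

import Mathlib

/-! ## A random access machine with unit costs

A machine has registers `0, 1, 2, …` and arrays `0, 1, 2, …`, all of whose entries are natural
numbers; a program mentions only finitely many registers and arrays. The only arithmetic is
successor, predecessor and truncated subtraction, so that every step increases the largest number
in the memory by at most one (apart from the literals in the program): in `O(N)` steps on an input
with entries `O(N)`, only numbers with `O(log N)` bits occur. -/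

namespace RAM

/-- The content of the memory: `reg r` is the content of register `r`, and `arr A i` is the entry
with index `i` of array `A`. -/
structure Memory where
  reg : ℕ → ℕ
  arr : ℕ → ℕ → ℕ

/-- Write `x` into register `r`. -/
def Memory.setReg (σ : Memory) (r x : ℕ) : Memory :=
  { σ with reg := Function.update σ.reg r x }

/-- Write `x` into the entry with index `i` of array `A`. -/
def Memory.setArr (σ : Memory) (A i x : ℕ) : Memory :=
  { σ with arr := Function.update σ.arr A (Function.update (σ.arr A) i x) }

/-- Elementary instructions. In each of them `r`, `s`, `t` are (names of) registers. -/
inductive Instr where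
  /-- `r := c`, for a literal `c` -/
  | const (r c : ℕ)
  /-- `r := s` -/
  | copy (r s : ℕ)
  /-- `r := s + 1` -/
  | succ (r s : ℕ)
  /-- `r := s - 1` (and `0` if `s` is `0`) -/
  | pred (r s : ℕ)
  /-- `r := s - t` (and `0` if `s < t`) -/
  | sub (r s t : ℕ)
  /-- `r := A[s]` -/
  | load (r A s : ℕ)
  /-- `A[s] := t` -/
  | store (A s t : ℕ)

/-- The effect of an elementary instruction. -/
def Instr.effect : Instr → Memory → Memory
  | .const r c, σ => σ.setReg r c
  | .copy r s, σ => σ.setReg r (σ.reg s)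
  | .succ r s, σ => σ.setReg r (σ.reg s + 1)
  | .pred r s, σ => σ.setReg r (σ.reg s - 1)
  | .sub r s t, σ => σ.setReg r (σ.reg s - σ.reg t)
  | .load r A s, σ => σ.setReg r (σ.arr A (σ.reg s))
  | .store A s t, σ => σ.setArr A (σ.reg s) (σ.reg t)

/-- Comparisons of two registers. -/
inductive Test where
  | lt (r s : ℕ)
  | eq (r s : ℕ)
  | ne (r s : ℕ)

/-- Truth of a comparison. -/
def Test.Holds : Test → Memory → Prop
  | .lt r s, σ => σ.reg r < σ.reg s
  | .eq r s, σ => σ.reg r = σ.reg s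
  | .ne r s, σ => σ.reg r ≠ σ.reg s

/-- Programs: elementary instructions, sequential composition, branching, and while-loops. -/
inductive Program where
  | instr (i : Instr)
  | seq (P Q : Program)
  | branch (b : Test) (P Q : Program)
  | loop (b : Test) (P : Program)

/-- `Runs P σ k τ`: started with memory `σ`, the program `P` halts with memory `τ` after exactly
`k` steps. Every elementary instruction and every evaluation of a comparison is one step. -/
inductive Runs : Program → Memory → ℕ → Memory → Prop where
  | instr (i : Instr) (σ : Memory) : Runs (.instr i) σ 1 (i.effect σ)
  | seq {P Q : Program} {σ τ υ : Memory} {k l : ℕ} (h : Runs P σ k τ) (h' : Runs Q τ l υ) :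
      Runs (.seq P Q) σ (k + l) υ
  | branchTrue {b : Test} {P Q : Program} {σ τ : Memory} {k : ℕ} (hb : b.Holds σ)
      (h : Runs P σ k τ) : Runs (.branch b P Q) σ (k + 1) τ
  | branchFalse {b : Test} {P Q : Program} {σ τ : Memory} {k : ℕ} (hb : ¬ b.Holds σ)
      (h : Runs Q σ k τ) : Runs (.branch b P Q) σ (k + 1) τ
  | loopTrue {b : Test} {P : Program} {σ τ υ : Memory} {k l : ℕ} (hb : b.Holds σ)
      (h : Runs P σ k τ) (h' : Runs (.loop b P) τ l υ) : Runs (.loop b P) σ (k + l + 1) υ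
  | loopFalse {b : Test} {P : Program} {σ : Memory} (hb : ¬ b.Holds σ) :
      Runs (.loop b P) σ 1 σ

end RAM

/-! ## Input and output -/

/-- The graph `G` on the vertices `0, …, n - 1` is given by its adjacency lists (each in an
arbitrary order), stored one after the other in the array `nbr`: the list of the vertex `v`
occupies the positions `off v, …, off (v + 1) - 1`, and its length is the degree of `v`.
Nothing is said about the entries of `off` and `nbr` at all other positions. -/
structure IsAdjacencyLists {n : ℕ} (G : SimpleGraph (Fin n)) [DecidableRel G.Adj]
    (off nbr : ℕ → ℕ) : Prop where
  off_zero : off 0 = 0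
  off_succ : ∀ v : Fin n, off (v + 1) = off v + G.degree v
  nbr_lt : ∀ i < off n, nbr i < n
  adj_iff : ∀ v w : Fin n, G.Adj v w ↔ ∃ i, off v ≤ i ∧ i < off (v + 1) ∧ nbr i = w

/-- The initial memory: register `0` contains the number of vertices, the arrays `0` and `1`
contain the adjacency lists, and everything else is `0`. -/
def inputMemory (n : ℕ) (off nbr : ℕ → ℕ) : RAM.Memory where
  reg r := if r = 0 then n else 0
  arr A := if A = 0 then off else if A = 1 then nbr else fun _ => 0

/-- The output is read from array `2`: its entry with index `v` is the colour of the vertex `v`. -/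
def outputColour (n : ℕ) (τ : RAM.Memory) (v : Fin n) : ℕ := τ.arr 2 v

/-! ## Brooks-colourings -/

/-- A vertex-colouring: colours are positive integers, and adjacent vertices receive different
colours. -/
def IsVertexColouring {V : Type*} (G : SimpleGraph V) (f : V → ℕ) : Prop :=
  (∀ v, 1 ≤ f v) ∧ ∀ v w, G.Adj v w → f v ≠ f w

/-- The number of colours that `f` uses. -/
def numColours {V : Type*} [Fintype V] (f : V → ℕ) : ℕ := (Finset.univ.image f).card

/-- `G` is a complete graph or an odd cycle (of length at least `3`). -/
def IsCompleteOrOddCycle {V : Type*} (G : SimpleGraph V) : Prop :=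
  G = ⊤ ∨ ∃ k : ℕ, 1 ≤ k ∧ Nonempty (G ≃g SimpleGraph.cycleGraph (2 * k + 1))

/-- A Brooks-colouring: a vertex-colouring in which the number of colours is at most `Δ`, or
`Δ + 1` if `G` is a complete graph or an odd cycle. -/
def IsBrooksColouring {V : Type*} [Fintype V] (G : SimpleGraph V) [DecidableRel G.Adj]
    (f : V → ℕ) : Prop :=
  IsVertexColouring G f ∧
    (numColours f ≤ G.maxDegree ∨ IsCompleteOrOddCycle G ∧ numColours f ≤ G.maxDegree + 1)

open Classical in
/-- Some connected component of `G` has the same maximum degree as `G` and is a complete graph or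
an odd cycle. (Such a component needs `Δ + 1` colours.) -/
def HasExceptionalComponent {V : Type*} [Fintype V] (G : SimpleGraph V) : Prop :=
  ∃ c : G.ConnectedComponent,
    c.toSimpleGraph.maxDegree = G.maxDegree ∧ IsCompleteOrOddCycle c.toSimpleGraph

/-! The colouring is greedy throughout. The first-fit colour of a vertex of degree at most `D = Δ`
is at most `D + 1`. It is at most `D` if the vertex has smaller degree, an uncoloured neighbour, or
two neighbours of equal colour (`Slack`, `FirstFit.le_of_slack`). Apart from one colour that is
copied from a neighbour, everything is first-fit, so the task is to find an order in which each
vertex outside the exceptional components has slack when its turn comes (`GoodColouring.firstFit`).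

Components with a vertex of degree below `D` are searched breadth-first from all such vertices and
coloured in reversed queue order: every vertex is a root of small degree or still has its parent
uncoloured (`WP.irregularComponents`).

Every other component is `D`-regular. From a vertex `v` one first looks for a path `v, x, y` with
`y` not adjacent to `v`. If there is none, the closed neighbourhood of `v` is the whole component,
and by regularity the component is complete. The path, or `v` alone, is prolonged until all
neighbours of the last vertex lie on it. The earliest of these neighbours, `X j`, closes a cycle `X
j, …, X (k - 1)` that contains all neighbours of `X (k - 1)` (`Lasso`; for small `D` it may
degenerate to one or two vertices). The rest of the component is coloured in reversed breadth-first
order towards the cycle (`WP.colourOutside`). There are then three ways to finish (`WP.finish`).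

Some vertex of the cycle has a coloured neighbour: let `X i` be the last such vertex and `y` such a
neighbour. Since `i ≠ k - 1`, the vertex `X (i + 1)` has no coloured neighbour and can copy the
colour of `y`. Going once around the cycle from there, each vertex still sees its uncoloured
successor, and `X i` at the end sees the same colour on `y` and `X (i + 1)` (`WP.finishCycle`).

No such vertex exists, so the cycle is the whole component and `j = 0`, and moreover the path began
with a fork and `X 1` has a neighbour `X b` with `b ≥ 3`. Then `X 0` and `X 2` both receive colour
`1`, the remaining vertices are coloured along the cycle from both sides towards `X b` and `X 1`,
and `X 1` comes last (`WP.finishChord`).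

In the remaining case the component is complete, or `X 1` has degree two, so that `D = 2` and the
component is a cycle (`Lasso.exc_or_even`). It is exceptional, or first-fit alternates two colours
around an even cycle (`WP.finishPlain`).

For the running time, treating a vertex costs `O(deg + 1)`. The search for a fork costs `O((D +
1)²)`, which is affordable because a `D`-regular component has at least `D + 1` vertices, all of
degree `D`. Arrays of marks are never cleared: an increasing stamp invalidates old marks, and the
path positions of one component are irrelevant to the others. Where a register or array entry may
hold "nothing", values are shifted by one and `0` means absent. -/

namespace RAM

/-! ### Program logic for the random access machine -/

instance : Coe Instr Program := ⟨Program.instr⟩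

infixr:60 ";;" => Program.seq

/-- An instruction without effect. -/
def skip : Program := Instr.copy 24 24

@[simp] theorem Memory.setReg_reg (σ : Memory) (r x s : ℕ) :
    (σ.setReg r x).reg s = if s = r then x else σ.reg s := by
  simp [Memory.setReg, Function.update_apply]

@[simp] theorem Memory.setReg_arr (σ : Memory) (r x : ℕ) : (σ.setReg r x).arr = σ.arr := rfl

@[simp] theorem Memory.setArr_reg (σ : Memory) (A i x : ℕ) : (σ.setArr A i x).reg = σ.reg := rfl

@[simp] theorem Memory.setArr_arr (σ : Memory) (A i x B : ℕ) :
    (σ.setArr A i x).arr B = if B = A then Function.update (σ.arr A) i x else σ.arr B := by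
  simp only [Memory.setArr, Function.update_apply]

/-- `WP P σ Q`: started with memory `σ`, the program `P` halts, and the number of steps and the
final memory satisfy `Q`. -/
def WP (P : Program) (σ : Memory) (Q : ℕ → Memory → Prop) : Prop :=
  ∃ k τ, Runs P σ k τ ∧ Q k τ

theorem WP.mono {P : Program} {σ : Memory} {Q Q' : ℕ → Memory → Prop} (h : WP P σ Q)
    (hQ : ∀ k τ, Q k τ → Q' k τ) : WP P σ Q' := by
  obtain ⟨k, τ, h, h'⟩ := h
  exact ⟨k, τ, h, hQ k τ h'⟩

theorem WP.instr {i : Instr} {σ : Memory} {Q : ℕ → Memory → Prop} (h : Q 1 (i.effect σ)) :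
    WP i σ Q := ⟨1, _, .instr i σ, h⟩

theorem WP.seq {P R : Program} {σ : Memory} {Q : ℕ → Memory → Prop}
    (h : WP P σ fun k τ => WP R τ fun l υ => Q (k + l) υ) : WP (P ;; R) σ Q := by
  obtain ⟨k, τ, h, l, υ, h', hQ⟩ := h
  exact ⟨_, _, .seq h h', hQ⟩

theorem WP.instr_seq {i : Instr} {R : Program} {σ : Memory} {Q : ℕ → Memory → Prop}
    (h : WP R (i.effect σ) fun l υ => Q (1 + l) υ) : WP (i ;; R) σ Q :=
  .seq (.instr h)

theorem WP.branch {b : Test} {P R : Program} {σ : Memory} {Q : ℕ → Memory → Prop}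
    (h : b.Holds σ → WP P σ fun k => Q (k + 1))
    (h' : ¬ b.Holds σ → WP R σ fun k => Q (k + 1)) : WP (.branch b P R) σ Q := by
  by_cases hb : b.Holds σ
  · obtain ⟨k, τ, h, hQ⟩ := h hb
    exact ⟨_, _, .branchTrue hb h, hQ⟩
  · obtain ⟨k, τ, h, hQ⟩ := h' hb
    exact ⟨_, _, .branchFalse hb h, hQ⟩

theorem WP.skip {σ : Memory} {Q : ℕ → Memory → Prop} (h : Q 1 σ) : WP skip σ Q := by
  refine WP.instr ?_
  convert h
  simp [Instr.effect, Memory.setReg]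

/-- The rule for while-loops; the invariant may speak about the time that has elapsed. -/
theorem WP.loop {b : Test} {P : Program} {σ : Memory} {Q : ℕ → Memory → Prop}
    (I : ℕ → Memory → Prop) (m : Memory → ℕ) (h0 : I 0 σ)
    (hI : ∀ t τ, I t τ → b.Holds τ → WP P τ fun k υ => I (t + k + 1) υ ∧ m υ < m τ)
    (hQ : ∀ t τ, I t τ → ¬ b.Holds τ → Q (t + 1) τ) : WP (.loop b P) σ Q := by
  -- The induction is on the measure, and it needs an arbitrary elapsed time `t`, since the loop is
  -- re-entered after some steps have passed.
  suffices H : ∀ M t τ, m τ = M → I t τ →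
      WP (.loop b P) τ fun k υ => Q (t + k) υ by
    simpa using H _ 0 σ rfl h0
  intro M
  induction M using Nat.strong_induction_on with
  | _ M ih =>
    intro t τ hm ht
    by_cases hb : b.Holds τ
    · obtain ⟨k, υ, h, h', hlt⟩ := hI t τ ht hb
      obtain ⟨l, ω, h'', hω⟩ := ih _ (hm ▸ hlt) _ υ rfl h'
      refine ⟨_, _, .loopTrue hb h h'', ?_⟩
      convert hω using 1
      ring
    · exact ⟨_, _, .loopFalse hb, hQ t τ ht hb⟩

/-- The memories `σ` and `τ` agree outside the registers in `rs` and the arrays in `as`. -/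
structure Same (rs as : List ℕ) (σ τ : Memory) : Prop where
  reg : ∀ r, r ∉ rs → τ.reg r = σ.reg r
  arr : ∀ A, A ∉ as → τ.arr A = σ.arr A

theorem Same.refl (rs as : List ℕ) (σ : Memory) : Same rs as σ σ := ⟨fun _ _ => rfl, fun _ _ => rfl⟩

theorem Same.trans {rs as rs' as' : List ℕ} {σ τ υ : Memory} (h : Same rs as σ τ)
    (h' : Same rs' as' τ υ) (hr : rs' ⊆ rs) (ha : as' ⊆ as) : Same rs as σ υ :=
  ⟨fun r hr' => (h'.reg r fun h => hr' (hr h)).trans (h.reg r hr'),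
    fun A hA => (h'.arr A fun h => hA (ha h)).trans (h.arr A hA)⟩

theorem Same.mono {rs as rs' as' : List ℕ} {σ τ : Memory} (h : Same rs as σ τ)
    (hr : rs ⊆ rs') (ha : as ⊆ as') : Same rs' as' σ τ :=
  (Same.refl rs' as' σ).trans h hr ha

theorem Same.setReg {rs as : List ℕ} {σ τ : Memory} (h : Same rs as σ τ) {r : ℕ} (hr : r ∈ rs)
    (x : ℕ) : Same rs as σ (τ.setReg r x) := by
  refine ⟨fun s hs => ?_, h.arr⟩
  have : s ≠ r := fun h => hs (h ▸ hr)
  simp [this, h.reg s hs]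

theorem Same.setArr {rs as : List ℕ} {σ τ : Memory} (h : Same rs as σ τ) {A : ℕ} (hA : A ∈ as)
    (i x : ℕ) : Same rs as σ (τ.setArr A i x) := by
  refine ⟨h.reg, fun B hB => ?_⟩
  have : B ≠ A := fun h => hB (h ▸ hA)
  simp [this, h.arr B hB]

/-- Execute `body` for every neighbour of the vertex in register `b`; the neighbour is in register
`b + 3`. -/
def forNbrs (b : ℕ) (body : Program) : Program :=
  Instr.load (b + 1) 0 b ;; Instr.succ (b + 2) b ;; Instr.load (b + 2) 0 (b + 2) ;;
    .loop (.lt (b + 1) (b + 2)) (Instr.load (b + 3) 1 (b + 1) ;; body ;;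
      Instr.succ (b + 1) (b + 1))

/-- The invariant `I i` describes the state after the list entries before position `i` have been
treated. It must survive changes of the loop's own registers `b + 1`, `b + 2`, `b + 3`. Each entry
costs the body plus a test, a load and an increment; the `4` accounts for the three preparatory
instructions and the last test. -/
theorem WP.forNbrs {b v : ℕ} {body : Program} {σ : Memory} {off nbr : ℕ → ℕ}
    {Q : ℕ → Memory → Prop} (c : ℕ) (I : ℕ → Memory → Prop)
    (hv : σ.reg b = v) (h0 : σ.arr 0 = off) (h1 : σ.arr 1 = nbr) (hle : off v ≤ off (v + 1))
    (hI0 : I (off v) σ)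
    (hI : ∀ i τ r x, b < r → r ≤ b + 3 → I i τ → I i (τ.setReg r x))
    (hstep : ∀ i τ, off v ≤ i → i < off (v + 1) → I i τ → τ.arr 0 = off → τ.arr 1 = nbr →
      τ.reg (b + 3) = nbr i → WP body τ fun k υ => k ≤ c ∧ υ.arr 0 = off ∧ υ.arr 1 = nbr ∧
        υ.reg (b + 1) = τ.reg (b + 1) ∧ υ.reg (b + 2) = τ.reg (b + 2) ∧ I (i + 1) υ)
    (hQ : ∀ k τ, k ≤ (c + 3) * (off (v + 1) - off v) + 4 → I (off (v + 1)) τ → Q k τ) :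
    WP (forNbrs b body) σ Q := by
  refine .instr_seq (.instr_seq (.instr_seq (.loop
    (fun t τ => ∃ i, off v ≤ i ∧ i ≤ off (v + 1) ∧ τ.reg (b + 1) = i ∧
      τ.reg (b + 2) = off (v + 1) ∧ τ.arr 0 = off ∧ τ.arr 1 = nbr ∧ I i τ ∧
      t ≤ (c + 3) * (i - off v)) (fun τ => off (v + 1) - τ.reg (b + 1)) ?_ ?_ ?_)))
  · refine ⟨off v, le_rfl, hle, ?_, ?_, ?_, ?_, ?_, ?_⟩ <;>
      simp [Instr.effect, hv, h0, h1]
    have := hI _ _ (b + 2) (off (v + 1)) (by omega) (by omega)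
      (hI _ _ (b + 2) (v + 1) (by omega) (by omega)
        (hI _ _ (b + 1) (off v) (by omega) (by omega) hI0))
    simpa using this
  · rintro t τ ⟨i, h2, h3, h4, h5, h6, h7, h8, h9⟩ hb
    simp only [Test.Holds, h4, h5] at hb
    refine .instr_seq (.seq ?_)
    simp only [Instr.effect, h7, h4]
    refine (hstep i _ h2 hb (hI i τ (b + 3) (nbr i) (by omega) (by omega) h8) (by simpa using h6)
      (by simpa using h7) (by simp)).mono ?_
    rintro k υ ⟨a1, a2, a3, a4, a5, a6⟩
    simp only [Memory.setReg_reg, Nat.add_left_cancel_iff, Nat.reduceEqDiff, if_false, h4, h5]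
      at a4 a5
    refine .instr ?_
    simp only [Instr.effect, a4]
    refine ⟨⟨i + 1, by omega, by omega, by simp, by simp [a5], a2, a3,
      hI _ _ _ _ (by omega) (by omega) a6, ?_⟩, ?_⟩
    · rw [show i + 1 - off v = (i - off v) + 1 by omega, mul_add]
      omega
    · simp; omega
  · rintro t τ ⟨i, h2, h3, h4, h5, h6, h7, h8, h9⟩ hb
    simp only [Test.Holds, h4, h5] at hb
    obtain rfl : i = off (v + 1) := by omega
    exact hQ _ _ (by omega) h8

end RAM

/-! ## Adjacency lists on the natural numbers -/

/-- `w` is one of the entries of the list of `v` before the position `i`. -/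
def NbrBefore (off nbr : ℕ → ℕ) (v i w : ℕ) : Prop := ∃ j, off v ≤ j ∧ j < i ∧ nbr j = w

/-- `w` is an entry of the list of `v`. -/
abbrev Nbr (off nbr : ℕ → ℕ) (v w : ℕ) : Prop := NbrBefore off nbr v (off (v + 1)) w

/-- The length of the list of `v`. -/
def deg (off : ℕ → ℕ) (v : ℕ) : ℕ := off (v + 1) - off v

/-- The entries of the list of `v`. -/
def nbrs (off nbr : ℕ → ℕ) (v : ℕ) : Finset ℕ := (Finset.Ico (off v) (off (v + 1))).image nbr

theorem mem_nbrs {off nbr : ℕ → ℕ} {v w : ℕ} : w ∈ nbrs off nbr v ↔ Nbr off nbr v w := by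
  simp [nbrs, NbrBefore, and_assoc]

theorem not_nbrBefore_self {off nbr : ℕ → ℕ} {v w : ℕ} : ¬ NbrBefore off nbr v (off v) w := by
  rintro ⟨j, h, h', -⟩
  omega

theorem nbrBefore_succ {off nbr : ℕ → ℕ} {v i w : ℕ} (h : off v ≤ i) :
    NbrBefore off nbr v (i + 1) w ↔ NbrBefore off nbr v i w ∨ w = nbr i := by
  constructor
  · rintro ⟨j, h1, h2, rfl⟩
    rcases Nat.lt_succ_iff_lt_or_eq.1 h2 with h3 | rfl
    · exact .inl ⟨j, h1, h3, rfl⟩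
    · exact .inr rfl
  · rintro (⟨j, h1, h2, rfl⟩ | rfl)
    · exact ⟨j, h1, by omega, rfl⟩
    · exact ⟨i, h, by omega, rfl⟩

/-- `off` and `nbr` are adjacency lists of a simple graph on `0, …, n - 1`. -/
structure AdjLists (n : ℕ) (off nbr : ℕ → ℕ) : Prop where
  le : ∀ v < n, off v ≤ off (v + 1)
  lt : ∀ v < n, ∀ w, Nbr off nbr v w → w < n
  symm : ∀ v < n, ∀ w, Nbr off nbr v w → Nbr off nbr w v
  irrefl : ∀ v < n, ¬ Nbr off nbr v v
  card : ∀ v < n, (nbrs off nbr v).card = deg off v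

/-! ### First-fit colours and slack -/

/-- `c` is the smallest colour that no neighbour of `v` has. -/
structure FirstFit (off nbr col : ℕ → ℕ) (v c : ℕ) : Prop where
  pos : 1 ≤ c
  ne : ∀ w, Nbr off nbr v w → col w ≠ c
  min : ∀ d, 1 ≤ d → d < c → ∃ w, Nbr off nbr v w ∧ col w = d

/-- A reason why the first-fit colour of `v` is at most `D`. -/
def Slack (D : ℕ) (off nbr col : ℕ → ℕ) (v : ℕ) : Prop :=
  deg off v < D ∨ (∃ w, Nbr off nbr v w ∧ col w = 0) ∨
    ∃ w x, Nbr off nbr v w ∧ Nbr off nbr v x ∧ w ≠ x ∧ col w = col x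

/-- Pigeonhole: the colours `1, …, c - 1` all occur on the neighbours of `v`, of which there are
only `deg off v`. -/
theorem AdjLists.le_of_seen {n : ℕ} {off nbr col : ℕ → ℕ} (h : AdjLists n off nbr) {v : ℕ} (hv : v < n)
    {c : ℕ} (hc : ∀ d, 1 ≤ d → d < c → ∃ w, Nbr off nbr v w ∧ col w = d) :
    c ≤ deg off v + 1 := by
  have : Finset.Ico 1 c ⊆ (nbrs off nbr v).image col := by
    intro d hd
    obtain ⟨w, hw, rfl⟩ := hc d (Finset.mem_Ico.1 hd).1 (Finset.mem_Ico.1 hd).2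
    exact Finset.mem_image_of_mem _ (mem_nbrs.2 hw)
  have := (Finset.card_le_card this).trans Finset.card_image_le
  rw [Nat.card_Ico, h.card v hv] at this
  omega

/-- This is where the bound `D` of Brooks' theorem comes from. Unless the degree is below `D`, some
neighbour `w` blocks no colour of its own, being uncoloured or agreeing with another neighbour, so
the pigeonhole argument can leave `w` out. -/
theorem FirstFit.le_of_slack {n D : ℕ} {off nbr col : ℕ → ℕ} (h : AdjLists n off nbr) {v : ℕ}
    (hv : v < n) (hD : deg off v ≤ D) {c : ℕ} (hc : FirstFit off nbr col v c)
    (hs : Slack D off nbr col v) : c ≤ D := by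
  rcases hs with hs | hs
  · have := h.le_of_seen hv hc.min
    omega
  obtain ⟨w, hw, hs⟩ : ∃ w, Nbr off nbr v w ∧
      (col w = 0 ∨ ∃ x, Nbr off nbr v x ∧ w ≠ x ∧ col w = col x) := by
    rcases hs with ⟨w, h1, h2⟩ | ⟨w, x, h1, h2, h3, h4⟩
    · exact ⟨w, h1, .inl h2⟩
    · exact ⟨w, h1, .inr ⟨x, h2, h3, h4⟩⟩
  have : Finset.Ico 1 c ⊆ ((nbrs off nbr v).erase w).image col := by
    intro d hd
    obtain ⟨y, hy, rfl⟩ := hc.min d (Finset.mem_Ico.1 hd).1 (Finset.mem_Ico.1 hd).2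
    by_cases hyw : y = w
    · subst hyw
      rcases hs with hs | ⟨x, h1, h2, h3⟩
      · simp [hs] at hd
      · rw [h3]
        exact Finset.mem_image_of_mem _ (Finset.mem_erase.2 ⟨h2.symm, mem_nbrs.2 h1⟩)
    · exact Finset.mem_image_of_mem _ (Finset.mem_erase.2 ⟨hyw, mem_nbrs.2 hy⟩)
  have := (Finset.card_le_card this).trans Finset.card_image_le
  rw [Nat.card_Ico, Finset.card_erase_of_mem (mem_nbrs.2 hw), h.card v hv] at this
  have : 0 < (nbrs off nbr v).card := Finset.card_pos.2 ⟨w, mem_nbrs.2 hw⟩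
  rw [h.card v hv] at this
  omega

/-! ### First-fit colouring of one vertex as a program -/

namespace RAM

/-- First-fit colouring of the vertex in register `20`. -/
def colour : Program :=
  Instr.succ 3 3 ;; forNbrs 20 (Instr.load 24 2 23 ;; Instr.store 3 24 3) ;;
    Instr.const 24 1 ;; Instr.load 25 3 24 ;;
    .loop (.eq 25 3) (Instr.succ 24 24 ;; Instr.load 25 3 24) ;; Instr.store 2 20 24

/-- The constant part of the memory, and the stamps: the entries of array `3` do not exceed
register `3`. -/
structure Base (n D : ℕ) (off nbr : ℕ → ℕ) (σ : Memory) : Prop where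
  off : σ.arr 0 = off
  nbr : σ.arr 1 = nbr
  n : σ.reg 0 = n
  D : σ.reg 1 = D
  zero : σ.reg 2 = 0
  stamp : ∀ c, σ.arr 3 c ≤ σ.reg 3

theorem Base.same {n D : ℕ} {off nbr : ℕ → ℕ} {σ τ : Memory} (h : Base n D off nbr σ)
    {rs as : List ℕ} (hs : Same rs as σ τ) (hr : 0 ∉ rs ∧ 1 ∉ rs ∧ 2 ∉ rs ∧ 3 ∉ rs)
    (ha : 0 ∉ as ∧ 1 ∉ as ∧ 3 ∉ as) : Base n D off nbr τ where
  off := (hs.arr 0 ha.1).trans h.off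
  nbr := (hs.arr 1 ha.2.1).trans h.nbr
  n := (hs.reg 0 hr.1).trans h.n
  D := (hs.reg 1 hr.2.1).trans h.D
  zero := (hs.reg 2 hr.2.2.1).trans h.zero
  stamp := by
    rw [hs.arr 3 ha.2.2, hs.reg 3 hr.2.2.2]
    exact h.stamp

/-- Array `3`, indexed by colours, marks the colours of the neighbours with a stamp larger than all
earlier entries, so that it need not be cleared. The time is linear in the degree because the scan
for the first unmarked colour stops at `deg off v + 1` at the latest. Uncoloured neighbours mark
index `0`, which the scan never visits. -/
theorem WP.colour {n D v : ℕ} {off nbr : ℕ → ℕ} {σ : Memory} {Q : ℕ → Memory → Prop}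
    (hG : AdjLists n off nbr) (hv : v < n) (hσ : Base n D off nbr σ) (h20 : σ.reg 20 = v)
    (hQ : ∀ k τ c, k ≤ 9 * (deg off v + 1) → Same [3, 21, 22, 23, 24, 25] [2, 3] σ τ →
      FirstFit off nbr (σ.arr 2) v c → τ.arr 2 = Function.update (σ.arr 2) v c →
      Base n D off nbr τ → Q k τ) :
    WP colour σ Q := by
  obtain ⟨h0, h1, hn, hD, hz, hst⟩ := hσ
  refine .instr_seq (.seq ?_)
  refine .forNbrs (v := v) (off := off) (nbr := nbr) 2
    (fun i τ => Same [3, 21, 22, 23, 24, 25] [3] σ τ ∧ τ.reg 3 = σ.reg 3 + 1 ∧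
      (∀ c, τ.arr 3 c ≤ σ.reg 3 + 1) ∧
      ∀ c, τ.arr 3 c = σ.reg 3 + 1 ↔ ∃ w, NbrBefore off nbr v i w ∧ σ.arr 2 w = c)
    ?_ ?_ ?_ (hG.le v hv) ?_ ?_ ?_ ?_
  · simpa [Instr.effect] using h20
  · simpa [Instr.effect] using h0
  · simpa [Instr.effect] using h1
  · refine ⟨(Same.refl _ _ _).setReg (by decide) _, by simp [Instr.effect], ?_, ?_⟩
    · intro c
      have := hst c
      simp only [Instr.effect, Memory.setReg_arr]; omega
    · intro c
      have := hst c
      simp only [Instr.effect, Memory.setReg_arr, not_nbrBefore_self, false_and, exists_false,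
        iff_false]
      omega
  · rintro i τ r x hr hr' ⟨a1, a2, a3, a4⟩
    have hr : r = 21 ∨ r = 22 ∨ r = 23 := by omega
    refine ⟨a1.setReg (by simp; omega) _, ?_, by simpa using a3, by simpa using a4⟩
    rcases hr with rfl | rfl | rfl <;> simpa using a2
  · rintro i τ hi hi' ⟨a1, a2, a3, a4⟩ b0 b1 b23
    refine .instr_seq (.instr ?_)
    have e2 : τ.arr 2 = σ.arr 2 := a1.arr 2 (by decide)
    simp only [Nat.reduceAdd] at b23
    simp only [Instr.effect, Memory.setReg_reg, Memory.setReg_arr, Memory.setArr_arr, b0, b1,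
      Memory.setArr_reg, Nat.reduceAdd, a2, e2, b23, Nat.reduceEqDiff, if_true,
      if_false, true_and, OfNat.zero_ne_ofNat, OfNat.one_ne_ofNat, le_refl]
    refine ⟨(a1.setReg (by decide) _).setArr (by decide) _ _, fun c => ?_, fun c => ?_⟩
    · rw [Function.update_apply]
      split_ifs
      · exact le_rfl
      · exact a3 c
    · rw [Function.update_apply]
      simp only [nbrBefore_succ hi, or_and_right, exists_or, exists_eq_left]
      split_ifs with h
      · simp [h]
      · rw [a4]
        simp [eq_comm, h]
  rintro k τ hk ⟨a1, a2, a3, a4⟩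
  have e2 : τ.arr 2 = σ.arr 2 := a1.arr 2 (by decide)
  refine .instr_seq (.instr_seq (.seq ?_))
  refine .loop (fun t υ => Same [3, 21, 22, 23, 24, 25] [3] σ υ ∧ υ.reg 3 = σ.reg 3 + 1 ∧
      υ.arr 3 = τ.arr 3 ∧ υ.reg 25 = τ.arr 3 (υ.reg 24) ∧ 1 ≤ υ.reg 24 ∧
      (∀ d, 1 ≤ d → d < υ.reg 24 → ∃ w, Nbr off nbr v w ∧ σ.arr 2 w = d) ∧
      t ≤ 3 * (υ.reg 24 - 1))
      -- The measure decreases by `AdjLists.le_of_seen`: if colours up to the current one are all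
      -- taken, the current one is at most the degree.
      (fun υ => deg off v + 1 - υ.reg 24) ?_ ?_ ?_
  · refine ⟨(a1.setReg (by decide) _).setReg (by decide) _, ?_⟩
    simp [Instr.effect, a2]
    omega
  · rintro t υ ⟨c1, c2, c3, c4, c5, c6, c7⟩ hb
    simp only [Test.Holds, c4, c2] at hb
    rw [a4] at hb
    have hs : ∀ d, 1 ≤ d → d < υ.reg 24 + 1 → ∃ w, Nbr off nbr v w ∧ σ.arr 2 w = d := by
      intro d hd hd'
      rcases Nat.lt_succ_iff_lt_or_eq.1 hd' with h | rfl
      · exact c6 d hd h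
      · exact hb
    refine .instr_seq (.instr ⟨⟨(c1.setReg (by decide) _).setReg (by decide) _, ?_⟩, ?_⟩)
    · simp [Instr.effect, c2, c3]
      refine ⟨fun d h1 h2 => hs d h1 (by omega), by omega⟩
    · have := hG.le_of_seen hv hs
      simp [Instr.effect]
      omega
  · rintro t υ ⟨c1, c2, c3, c4, c5, c6, c7⟩ hb
    simp only [Test.Holds, c4, c2] at hb
    rw [a4] at hb
    have e2 : υ.arr 2 = σ.arr 2 := c1.arr 2 (by decide)
    refine .instr (hQ _ _ (υ.reg 24) ?_ ((c1.mono (by decide) (by decide)).setArr (by decide) _ _)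
      ⟨c5, fun w hw hw' => hb ⟨w, hw, hw'⟩, c6⟩ ?_ ?_)
    · have := hG.le_of_seen hv c6
      rw [← deg] at hk
      omega
    · have : υ.reg 20 = v := (c1.reg 20 (by decide)).trans h20
      simp [Instr.effect, e2, this]
    · have f := fun r hr => c1.reg r hr
      have g := fun r hr => c1.arr r hr
      constructor <;> simp [Instr.effect, c2, c3, f, g, h0, h1, hn, hD, hz, a3]

end RAM

/-! ### Partial colourings, lists of vertices, and cost accounting -/

/-- No edge is monochromatic, and the colours are at most `D + 1`, and at most `D` outside `Exc`.
The vertices of colour `0` are uncoloured. -/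
structure GoodColouring (n D : ℕ) (off nbr : ℕ → ℕ) (Exc : ℕ → Prop) (col : ℕ → ℕ) : Prop where
  proper : ∀ v < n, ∀ w, Nbr off nbr v w → col v ≠ 0 → col v ≠ col w
  le_succ : ∀ v < n, col v ≤ D + 1
  le : ∀ v < n, ¬ Exc v → col v ≤ D

theorem GoodColouring.update {n D : ℕ} {off nbr col : ℕ → ℕ} {Exc : ℕ → Prop}
    (h : GoodColouring n D off nbr Exc col) (hG : AdjLists n off nbr) {v c : ℕ} (hv : v < n)
    (hne : ∀ w, Nbr off nbr v w → col w ≠ c) (hc : c ≤ D + 1) (hc' : ¬ Exc v → c ≤ D) :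
    GoodColouring n D off nbr Exc (Function.update col v c) where
  proper x hx w hw hx0 := by
    rw [Function.update_apply] at hx0
    rw [Function.update_apply, Function.update_apply]
    split_ifs with h1 h2 h2
    · subst h1 h2
      exact absurd hw (hG.irrefl _ hv)
    · subst h1
      exact (hne w hw).symm
    · subst h2
      exact hne x (hG.symm _ hx _ hw)
    · rw [if_neg h1] at hx0
      exact h.proper x hx w hw hx0
  le_succ x hx := by
    rw [Function.update_apply]
    split_ifs
    · exact hc
    · exact h.le_succ x hx
  le x hx hxE := by
    rw [Function.update_apply]
    split_ifs with h1
    · exact hc' (h1 ▸ hxE)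
    · exact h.le x hx hxE

/-- The greedy step shared by all phases of the algorithm: what remains for each phase is to exhibit
slack, or to know that the vertex is exceptional. -/
theorem GoodColouring.firstFit {n D : ℕ} {off nbr col : ℕ → ℕ} {Exc : ℕ → Prop}
    (h : GoodColouring n D off nbr Exc col) (hG : AdjLists n off nbr) {v c : ℕ} (hv : v < n)
    (hD : deg off v ≤ D) (hc : FirstFit off nbr col v c)
    (hs : Exc v ∨ Slack D off nbr col v) :
    GoodColouring n D off nbr Exc (Function.update col v c) := by
  refine h.update hG hv hc.ne ((hG.le_of_seen hv hc.min).trans (by omega)) fun hE => ?_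
  exact hc.le_of_slack hG hv hD (hs.resolve_left hE)

/-- The entries of `X` with index less than `m` are distinct elements of `dom`, and `p` is the
inverse of `X`, shifted by one; it is `0` on the other elements of `dom`. -/
structure Listing (dom : ℕ → Prop) (m : ℕ) (X p : ℕ → ℕ) : Prop where
  mem : ∀ t < m, dom (X t) ∧ p (X t) = t + 1
  ex : ∀ v, dom v → p v ≠ 0 → p v ≤ m ∧ X (p v - 1) = v

theorem Listing.exists_of_ne {dom : ℕ → Prop} {m : ℕ} {X p : ℕ → ℕ} (h : Listing dom m X p) {v : ℕ}
    (hv : dom v) (hp : p v ≠ 0) : ∃ t < m, X t = v :=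
  ⟨p v - 1, by have := (h.ex v hv hp).1; omega, (h.ex v hv hp).2⟩

theorem Listing.inj {dom : ℕ → Prop} {m : ℕ} {X p : ℕ → ℕ} (h : Listing dom m X p) {s t : ℕ}
    (hs : s < m) (ht : t < m) (hst : X s = X t) : s = t := by
  have h1 := (h.mem s hs).2
  have h2 := (h.mem t ht).2
  rw [hst] at h1
  omega

/-- The list has no repetitions because `p` inverts it. The bound makes both the breadth-first
search and the walk terminate. -/
theorem Listing.le {dom : ℕ → Prop} {m n : ℕ} {X p : ℕ → ℕ} (h : Listing dom m X p)
    (hn : ∀ v, dom v → v < n) : m ≤ n := by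
  have := Finset.card_le_card_of_injOn (s := Finset.range m) (t := Finset.range n) X
    (fun t ht => by simpa using hn _ (h.mem t (by simpa using ht)).1)
    (fun s hs t ht hst => h.inj (by simpa using hs) (by simpa using ht) hst)
  simpa using this

theorem Listing.push {dom : ℕ → Prop} {m : ℕ} {X p : ℕ → ℕ} (h : Listing dom m X p) {w : ℕ}
    (hw : dom w) (hp : p w = 0) :
    Listing dom (m + 1) (Function.update X m w) (Function.update p w (m + 1)) where
  mem t ht := by
    rcases Nat.lt_succ_iff_lt_or_eq.1 ht with h1 | rfl
    · have h2 := h.mem t h1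
      have : X t ≠ w := fun h3 => by rw [h3] at h2; omega
      rw [Function.update_of_ne (by omega), Function.update_of_ne this]
      exact h2
    · simpa using hw
  ex v hv hv' := by
    by_cases hvw : v = w
    · subst hvw
      simp
    · rw [Function.update_of_ne hvw] at hv' ⊢
      have := h.ex v hv hv'
      refine ⟨by omega, ?_⟩
      rw [Function.update_of_ne (by omega)]
      exact this.2

/-- The time for treating the vertices `X a, …, X (b - 1)`, up to a constant factor. -/
def cost (off X : ℕ → ℕ) (a b : ℕ) : ℕ := ∑ t ∈ Finset.Ico a b, (deg off (X t) + 1)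

theorem cost_succ {off X : ℕ → ℕ} {a b : ℕ} (h : a ≤ b) :
    cost off X a (b + 1) = cost off X a b + (deg off (X b) + 1) :=
  Finset.sum_Ico_succ_top h _

theorem cost_pred {off X : ℕ → ℕ} {a b : ℕ} (h : a < b) :
    cost off X a b = cost off X (a + 1) b + (deg off (X a) + 1) := by
  rw [cost, Finset.sum_eq_sum_Ico_succ_bot h, add_comm]
  rfl

theorem cost_congr {off X Y : ℕ → ℕ} {a b : ℕ} (h : ∀ t, a ≤ t → t < b → X t = Y t) :
    cost off X a b = cost off Y a b :=
  Finset.sum_congr rfl fun t ht => by rw [h t (Finset.mem_Ico.1 ht).1 (Finset.mem_Ico.1 ht).2]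

theorem cost_le {off X : ℕ → ℕ} {a b D : ℕ} (h : ∀ t, a ≤ t → t < b → deg off (X t) ≤ D) :
    cost off X a b ≤ (D + 1) * (b - a) := by
  refine (Finset.sum_le_card_nsmul _ _ (D + 1) fun t ht => ?_).trans ?_
  · have := h t (Finset.mem_Ico.1 ht).1 (Finset.mem_Ico.1 ht).2
    omega
  · simp [mul_comm]

theorem AdjLists.sum_deg {n : ℕ} {off nbr : ℕ → ℕ} (h : AdjLists n off nbr) :
    off 0 + ∑ v ∈ Finset.range n, (deg off v + 1) = off n + n := by
  have : ∀ m ≤ n, off 0 + ∑ v ∈ Finset.range m, (deg off v + 1) = off m + m := by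
    intro m
    induction m with
    | zero => simp
    | succ m ih =>
      intro hm
      have h1 := ih (by omega)
      have h2 := h.le m (by omega)
      rw [Finset.sum_range_succ, deg]
      omega
  exact this n le_rfl

/-- The final accounting. The listed vertices pay `deg + 1` each, the unlisted ones `D + 1`, which
is the same because they have degree `D`. Hence nothing exceeds the sum of `deg + 1` over all
vertices. -/
theorem Listing.cost_add_le {n m : ℕ} {off nbr X p : ℕ → ℕ} (hG : AdjLists n off nbr)
    (h : Listing (· < n) m X p) {D : ℕ} (hD : ∀ v < n, p v = 0 → deg off v = D) :
    cost off X 0 m + (D + 1) * (n - m) ≤ off n + n := by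
  rw [← hG.sum_deg]
  have hm : m ≤ n := h.le fun _ => id
  have h1 : (Finset.range m).image X ⊆ Finset.range n := by
    intro v hv
    obtain ⟨t, ht, rfl⟩ := Finset.mem_image.1 hv
    simpa using (h.mem t (by simpa using ht)).1
  have h2 : Set.InjOn X (Finset.range m) :=
    fun s hs t ht hst => h.inj (by simpa using hs) (by simpa using ht) hst
  rw [← Finset.sum_sdiff h1, Finset.sum_image h2, cost, Nat.Ico_zero_eq_range]
  have h3 : ∑ v ∈ Finset.range n \ (Finset.range m).image X, (deg off v + 1) =
      (D + 1) * (n - m) := by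
    rw [Finset.sum_congr rfl (g := fun _ => D + 1), Finset.sum_const, Finset.card_sdiff_of_subset h1,
      Finset.card_image_of_injOn h2, Finset.card_range, Finset.card_range, smul_eq_mul, mul_comm]
    intro v hv
    simp only [Finset.mem_sdiff, Finset.mem_range, Finset.mem_image, not_exists, not_and] at hv
    rw [hD v hv.1]
    by_contra hp
    obtain ⟨t, ht, hv'⟩ := h.exists_of_ne hv.1 hp
    exact hv.2 t ht hv'
  omega

/-! ### Colouring along a list, and breadth-first search -/

namespace RAM

/-- First-fit colouring of the entries of array `A` between register `13` and register `14`. -/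
def colourUp (A : ℕ) : Program :=
  .loop (.lt 13 14) (Instr.load 20 A 13 ;; colour ;; Instr.succ 13 13)

/-- First-fit colouring of the entries of array `A` between register `14` and register `13`,
in reversed order. -/
def colourDown (A : ℕ) : Program :=
  .loop (.lt 14 13) (Instr.pred 13 13 ;; Instr.load 20 A 13 ;; colour)

/-- The invariant on the colouring is left abstract because the reason for slack differs from one
use to the next. The factor `12` is `9` for the first-fit step plus three steps of loop control. -/
theorem WP.colourUp {n D a b A : ℕ} {off nbr X : ℕ → ℕ} {σ : Memory} {Q : ℕ → Memory → Prop}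
    (hG : AdjLists n off nbr) (hσ : Base n D off nbr σ) (h13 : σ.reg 13 = a) (h14 : σ.reg 14 = b)
    (hab : a ≤ b) (hX : σ.arr A = X) (hA : A ∉ [2, 3]) (hlt : ∀ t, a ≤ t → t < b → X t < n)
    (I : ℕ → (ℕ → ℕ) → Prop) (hI : I a (σ.arr 2))
    (hstep : ∀ t col c, a ≤ t → t < b → I t col → FirstFit off nbr col (X t) c →
      I (t + 1) (Function.update col (X t) c))
    (hQ : ∀ k τ, k ≤ 12 * cost off X a b + 1 → Same [3, 13, 20, 21, 22, 23, 24, 25] [2, 3] σ τ →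
      Base n D off nbr τ → I b (τ.arr 2) → Q k τ) :
    WP (colourUp A) σ Q := by
  refine .loop (fun t τ => ∃ i, τ.reg 13 = i ∧ a ≤ i ∧ i ≤ b ∧ I i (τ.arr 2) ∧
    Same [3, 13, 20, 21, 22, 23, 24, 25] [2, 3] σ τ ∧ Base n D off nbr τ ∧
    t ≤ 12 * cost off X a i) (fun τ => b - τ.reg 13) ?_ ?_ ?_
  · exact ⟨a, h13, le_rfl, hab, hI, .refl _ _ _, hσ, by simp⟩
  · rintro t τ ⟨i, h1, h2, h3, h4, h5, h6, h7⟩ hb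
    have e14 : τ.reg 14 = b := (h5.reg 14 (by decide)).trans h14
    have eA : τ.arr A = X := (h5.arr A hA).trans hX
    simp only [Test.Holds, h1, e14] at hb
    refine .instr_seq (.seq (.colour (n := n) (D := D) (v := X i) hG (hlt i h2 hb)
      (h6.same ((Same.refl [20] [] _).setReg (by decide) _) (by decide) (by decide))
      (by simp [Instr.effect, eA, h1]) ?_))
    intro k υ c hk hs hf hu hB
    have s1 := (h5.setReg (r := 20) (by decide) (τ.arr A (τ.reg 13))).trans hs
      (by decide) (by decide)
    have e13 : υ.reg 13 = i := by
      rw [hs.reg 13 (by decide)]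
      simp [Instr.effect, h1]
    refine .instr ⟨⟨i + 1, by simp [Instr.effect, e13], by omega, by omega, ?_,
      s1.setReg (by decide) _, hB.same ((Same.refl [13] [] _).setReg (by decide) _)
      (by decide) (by decide), ?_⟩, ?_⟩
    · simp only [Instr.effect, Memory.setReg_arr, hu]
      simp only [Instr.effect, Memory.setReg_arr] at hf
      exact hstep i _ c h2 hb h4 hf
    · rw [cost_succ h2]
      omega
    · simp [Instr.effect, e13, h1]
      omega
  · rintro t τ ⟨i, h1, h2, h3, h4, h5, h6, h7⟩ hb
    have e14 : τ.reg 14 = b := (h5.reg 14 (by decide)).trans h14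
    simp only [Test.Holds, h1, e14] at hb
    obtain rfl : i = b := by omega
    exact hQ _ _ (by omega) h5 h6 h4

theorem WP.colourDown {n D a b A : ℕ} {off nbr X : ℕ → ℕ} {σ : Memory} {Q : ℕ → Memory → Prop}
    (hG : AdjLists n off nbr) (hσ : Base n D off nbr σ) (h13 : σ.reg 13 = b) (h14 : σ.reg 14 = a)
    (hab : a ≤ b) (hX : σ.arr A = X) (hA : A ∉ [2, 3]) (hlt : ∀ t, a ≤ t → t < b → X t < n)
    (I : ℕ → (ℕ → ℕ) → Prop) (hI : I b (σ.arr 2))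
    (hstep : ∀ t col c, a ≤ t → t < b → I (t + 1) col → FirstFit off nbr col (X t) c →
      I t (Function.update col (X t) c))
    (hQ : ∀ k τ, k ≤ 12 * cost off X a b + 1 → Same [3, 13, 20, 21, 22, 23, 24, 25] [2, 3] σ τ →
      Base n D off nbr τ → I a (τ.arr 2) → Q k τ) :
    WP (colourDown A) σ Q := by
  refine .loop (fun t τ => ∃ i, τ.reg 13 = i ∧ a ≤ i ∧ i ≤ b ∧ I i (τ.arr 2) ∧
    Same [3, 13, 20, 21, 22, 23, 24, 25] [2, 3] σ τ ∧ Base n D off nbr τ ∧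
    t ≤ 12 * cost off X i b) (fun τ => τ.reg 13) ?_ ?_ ?_
  · exact ⟨b, h13, hab, le_rfl, hI, .refl _ _ _, hσ, by simp⟩
  · rintro t τ ⟨i, h1, h2, h3, h4, h5, h6, h7⟩ hb
    have e14 : τ.reg 14 = a := (h5.reg 14 (by decide)).trans h14
    have eA : τ.arr A = X := (h5.arr A hA).trans hX
    simp only [Test.Holds, h1, e14] at hb
    obtain ⟨j, rfl⟩ : ∃ j, i = j + 1 := ⟨i - 1, by omega⟩
    refine .instr_seq (.instr_seq (.colour (n := n) (D := D) (v := X j) hG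
      (hlt j (by omega) (by omega))
      (h6.same (((Same.refl [13, 20] [] _).setReg (by decide) _).setReg (by decide) _)
        (by decide) (by decide))
      (by simp [Instr.effect, eA, h1]) ?_))
    intro k υ c hk hs hf hu hB
    have s1 := ((h5.setReg (r := 13) (by decide) _).setReg (r := 20) (by decide) _).trans hs
      (by decide) (by decide)
    have e13 : υ.reg 13 = j := by
      rw [hs.reg 13 (by decide)]
      simp [Instr.effect, h1]
    refine ⟨⟨j, by simp [e13], by omega, by omega, ?_, s1, hB, ?_⟩, ?_⟩
    · simp only [Instr.effect, Memory.setReg_arr] at hf hu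
      rw [hu]
      exact hstep j _ c (by omega) (by omega) h4 hf
    · rw [cost_pred (by omega)]
      omega
    · simp [e13, h1]
  · rintro t τ ⟨i, h1, h2, h3, h4, h5, h6, h7⟩ hb
    have e14 : τ.reg 14 = a := (h5.reg 14 (by decide)).trans h14
    simp only [Test.Holds, h1, e14] at hb
    obtain rfl : i = a := by omega
    exact hQ _ _ (by omega) h5 h6 h4

/-- Breadth-first search: array `5` is the queue, register `4` points to its next entry, and
register `5` to its end; array `4` contains the positions in the queue, shifted by one. -/
def search : Program :=
  .loop (.lt 4 5) (Instr.load 20 5 4 ;;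
    forNbrs 20 (Instr.load 24 4 23 ;; .branch (.eq 24 2)
      (Instr.store 5 5 23 ;; Instr.succ 5 5 ;; Instr.store 4 23 5) skip) ;;
    Instr.succ 4 4)

/-- The queue may start with `a` finished entries from earlier components and `m - a` new roots.
What the colouring needs is that each entry from position `m` on has a neighbour earlier in the
queue; in reversed order that neighbour is still to come. Distances play no role. -/
theorem WP.search {n D a m : ℕ} {off nbr : ℕ → ℕ} {σ : Memory} {Q : ℕ → Memory → Prop}
    (hG : AdjLists n off nbr) (hσ : Base n D off nbr σ) (h4 : σ.reg 4 = a) (h5 : σ.reg 5 = m)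
    (ham : a ≤ m) (hL : Listing (· < n) m (σ.arr 5) (σ.arr 4))
    (hcl : ∀ t < a, ∀ w, Nbr off nbr (σ.arr 5 t) w → σ.arr 4 w ≠ 0)
    (hQ : ∀ k τ, Same [4, 5, 20, 21, 22, 23, 24] [4, 5] σ τ → m ≤ τ.reg 5 → τ.reg 4 = τ.reg 5 →
      Listing (· < n) (τ.reg 5) (τ.arr 5) (τ.arr 4) →
      (∀ t < τ.reg 5, ∀ w, Nbr off nbr (τ.arr 5 t) w → τ.arr 4 w ≠ 0) →
      (∀ t < m, τ.arr 5 t = σ.arr 5 t) →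
      (∀ t, m ≤ t → t < τ.reg 5 → ∃ s < t, Nbr off nbr (τ.arr 5 t) (τ.arr 5 s)) →
      k ≤ 16 * cost off (τ.arr 5) a (τ.reg 5) + 1 → Q k τ) :
    WP search σ Q := by
  refine .loop (fun t τ => Same [4, 5, 20, 21, 22, 23, 24] [4, 5] σ τ ∧ m ≤ τ.reg 5 ∧
      a ≤ τ.reg 4 ∧ τ.reg 4 ≤ τ.reg 5 ∧
      Listing (· < n) (τ.reg 5) (τ.arr 5) (τ.arr 4) ∧
      (∀ t < τ.reg 4, ∀ w, Nbr off nbr (τ.arr 5 t) w → τ.arr 4 w ≠ 0) ∧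
      (∀ t < m, τ.arr 5 t = σ.arr 5 t) ∧
      (∀ t, m ≤ t → t < τ.reg 5 → ∃ s < t, Nbr off nbr (τ.arr 5 t) (τ.arr 5 s)) ∧
      t ≤ 16 * cost off (τ.arr 5) a (τ.reg 4)) (fun τ => n - τ.reg 4) ?_ ?_ ?_
  · refine ⟨.refl _ _ _, h5.ge, h4.ge, by omega, by rwa [h5], by rwa [h4], fun _ _ => rfl,
      fun t h h' => by omega, by simp⟩
  · rintro t τ ⟨c1, c2, c3, c4, c5, c6, c7, c8, c9⟩ hb
    simp only [Test.Holds] at hb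
    have hB := hσ.same c1 (by decide) (by decide)
    have hu := (c5.mem _ hb).1
    have hmn := c5.le fun _ => id
    set u := τ.arr 5 (τ.reg 4) with hudef
    refine .instr_seq (.seq (.forNbrs (v := u) (off := off) (nbr := nbr) 5
      (fun i υ => Same [4, 5, 20, 21, 22, 23, 24] [4, 5] σ υ ∧ υ.reg 4 = τ.reg 4 ∧
        τ.reg 5 ≤ υ.reg 5 ∧ Listing (· < n) (υ.reg 5) (υ.arr 5) (υ.arr 4) ∧
        (∀ w, τ.arr 4 w ≠ 0 ∨ NbrBefore off nbr u i w → υ.arr 4 w ≠ 0) ∧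
        (∀ t < τ.reg 5, υ.arr 5 t = τ.arr 5 t) ∧
        (∀ t, τ.reg 5 ≤ t → t < υ.reg 5 → Nbr off nbr (υ.arr 5 t) u))
      (by simp [Instr.effect, hudef]) (by simpa [Instr.effect] using hB.off)
      (by simpa [Instr.effect] using hB.nbr) (hG.le u hu) ?_ ?_ ?_ ?_))
    · refine ⟨c1.setReg (by decide) _, by simp [Instr.effect], by simp [Instr.effect],
        by simpa [Instr.effect] using c5, ?_, fun t ht => rfl, ?_⟩
      · rintro w (hw | hw)
        · simpa [Instr.effect] using hw
        · exact absurd hw not_nbrBefore_self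
      · intro t ht ht'
        simp [Instr.effect] at ht'
        omega
    · rintro i υ r x hr hr' ⟨d1, d2, d3, d4, d5, d6, d7⟩
      have hr : r = 21 ∨ r = 22 ∨ r = 23 := by omega
      refine ⟨d1.setReg (by simp; omega) _, ?_⟩
      rcases hr with rfl | rfl | rfl <;> simpa using ⟨d2, d3, d4, d5, d6, d7⟩
    · rintro i υ hi hi' ⟨d1, d2, d3, d4, d5, d6, d7⟩ b0 b1 b23
      simp only [Nat.reduceAdd] at b23
      have hz : υ.reg 2 = 0 := (d1.reg 2 (by decide)).trans hσ.zero
      have hw : Nbr off nbr u (nbr i) := ⟨i, hi, hi', rfl⟩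
      refine .instr_seq (.branch (fun hb' => .instr_seq (.instr_seq (.instr ?_)))
        (fun hb' => .skip ?_))
      · simp only [Test.Holds, Instr.effect, Memory.setReg_reg, b23, hz, Nat.reduceEqDiff,
          if_true, if_false] at hb'
        refine ⟨by omega, by simp [Instr.effect, b0], by simp [Instr.effect, b1],
          by simp [Instr.effect], by simp [Instr.effect],
          (((d1.setReg (by decide) _).setArr (by decide) _ _).setReg (by decide) _).setArr
            (by decide) _ _, by simp [Instr.effect, d2], ?_, ?_, ?_, ?_, ?_⟩
        · simp [Instr.effect]
          omega
        · have := d4.push (hG.lt _ hu _ hw) hb'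
          simpa [Instr.effect, b23] using this
        · intro w hw'
          simp only [Instr.effect, Memory.setReg_reg, Memory.setReg_arr, Memory.setArr_arr, b23,
            Memory.setArr_reg, Nat.reduceEqDiff, if_true, if_false]
          rw [Function.update_apply]
          split_ifs with h
          · omega
          · refine d5 w (hw'.imp_right fun h' => ?_)
            rw [nbrBefore_succ hi] at h'
            exact h'.resolve_right h
        · intro t ht
          have : t ≠ υ.reg 5 := by omega
          simpa [Instr.effect, this] using d6 t ht
        · intro t ht ht'
          simp only [Instr.effect, Memory.setReg_reg, Memory.setReg_arr, Memory.setArr_arr, b23,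
            Memory.setArr_reg, Nat.reduceEqDiff, if_true, if_false] at ht' ⊢
          rw [Function.update_apply]
          split_ifs with h
          · exact hG.symm _ hu _ hw
          · exact d7 t ht (by omega)
      · simp only [Test.Holds, Instr.effect, Memory.setReg_reg, b23, hz, Nat.reduceEqDiff,
          if_true, if_false] at hb'
        refine ⟨by omega, by simp [Instr.effect, b0], by simp [Instr.effect, b1],
          by simp [Instr.effect], by simp [Instr.effect], d1.setReg (by decide) _,
          by simpa [Instr.effect] using d2, by simpa [Instr.effect] using d3,
          by simpa [Instr.effect] using d4, ?_, by simpa [Instr.effect] using d6,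
          by simpa [Instr.effect] using d7⟩
        intro w hw'
        rw [nbrBefore_succ hi, ← or_assoc] at hw'
        rcases hw' with hw' | rfl
        · exact d5 w hw'
        · exact hb'
    · rintro k υ hk ⟨d1, d2, d3, d4, d5, d6, d7⟩
      have d6' : ∀ t < τ.reg 4 + 1, υ.arr 5 t = τ.arr 5 t := fun t ht => d6 t (by omega)
      refine .instr ⟨⟨d1.setReg (by decide) _, by simp [Instr.effect]; omega,
        by simp [Instr.effect]; omega, by simp [Instr.effect]; omega, d4, ?_, ?_, ?_, ?_⟩, ?_⟩
      · intro t ht w hw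
        simp only [Instr.effect, Memory.setReg_reg, if_true, Memory.setReg_arr, d2] at ht hw ⊢
        rw [d6' t ht] at hw
        refine d5 w ?_
        rcases Nat.lt_succ_iff_lt_or_eq.1 ht with h1 | rfl
        · exact .inl (c6 t h1 w hw)
        · exact .inr hw
      · intro t ht
        exact (d6 t (by omega)).trans (c7 t ht)
      · intro t ht ht'
        simp only [Instr.effect, Memory.setReg_reg, Nat.reduceEqDiff, if_false, Memory.setReg_arr] at ht' ⊢
        by_cases h1 : t < τ.reg 5
        · obtain ⟨s, hs, hs'⟩ := c8 t ht h1
          exact ⟨s, hs, by rwa [d6 t h1, d6 s (by omega)]⟩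
        · refine ⟨τ.reg 4, by omega, ?_⟩
          rw [d6' (τ.reg 4) (by omega)]
          exact d7 t (by omega) ht'
      -- New entries are only appended, so the cost of the part already treated does not change.
      · have e : cost off (υ.arr 5) a (τ.reg 4) = cost off (τ.arr 5) a (τ.reg 4) :=
          cost_congr fun t h h' => d6' t (by omega)
        simp only [Instr.effect, Memory.setReg_reg, if_true, Memory.setReg_arr, d2]
        rw [cost_succ c3, e, d6' (τ.reg 4) (by omega), ← hudef]
        rw [← deg] at hk
        omega
      · simp [Instr.effect, d2]
        omega
  · rintro t τ ⟨c1, c2, c3, c4, c5, c6, c7, c8, c9⟩ hb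
    simp only [Test.Holds] at hb
    have he : τ.reg 4 = τ.reg 5 := by omega
    rw [he] at c6 c9
    exact hQ _ _ c1 c2 he c5 c6 c7 c8 (by omega)

end RAM

/-! ### Paths: forks, maximal extension, and the closing edge -/

/-- `X 0, …, X (k - 1)` is a path in the subgraph on `dom`, and `p` contains the positions,
shifted by one. -/
structure IsPath (off nbr : ℕ → ℕ) (dom : ℕ → Prop) (k : ℕ) (X p : ℕ → ℕ) : Prop
    extends Listing dom k X p where
  adj : ∀ i, i + 1 < k → Nbr off nbr (X i) (X (i + 1))

theorem IsPath.push {off nbr : ℕ → ℕ} {dom : ℕ → Prop} {k : ℕ} {X p : ℕ → ℕ}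
    (h : IsPath off nbr dom k X p) {w : ℕ} (hw : dom w) (hp : p w = 0)
    (hadj : 0 < k → Nbr off nbr (X (k - 1)) w) :
    IsPath off nbr dom (k + 1) (Function.update X k w) (Function.update p w (k + 1)) where
  toListing := h.toListing.push hw hp
  adj i hi := by
    rcases Nat.lt_succ_iff_lt_or_eq.1 hi with h1 | rfl
    · rw [Function.update_of_ne (by omega), Function.update_of_ne (by omega)]
      exact h.adj i h1
    · rw [Function.update_of_ne (by omega), Function.update_self]
      exact hadj (by omega)

namespace RAM

/-- Search for a path of length two with non-adjacent ends that starts at the vertex in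
register `6`. The second vertex is stored in register `10`, and the successor of the third one in
register `9`, which is `0` if there is no such path. -/
def findFork : Program :=
  Instr.succ 3 3 ;; Instr.store 3 6 3 ;; Instr.copy 20 6 ;; forNbrs 20 (Instr.store 3 23 3) ;;
    Instr.const 9 0 ;; Instr.copy 30 6 ;;
    forNbrs 30 (Instr.copy 20 33 ;; forNbrs 20 (Instr.load 24 3 23 ;;
      .branch (.ne 24 3) (Instr.succ 9 23 ;; Instr.copy 10 33) skip))

/-- The result of `findFork` after the neighbours `u` of `w` with `seen w u` have been tried. -/
def ForkResult (off nbr : ℕ → ℕ) (v : ℕ) (seen : ℕ → ℕ → Prop) (r9 r10 : ℕ) : Prop :=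
  (r9 = 0 ∧ ∀ w u, seen w u → u = v ∨ Nbr off nbr v u) ∨
    ∃ y, r9 = y + 1 ∧ Nbr off nbr v r10 ∧ Nbr off nbr r10 y ∧ y ≠ v ∧ ¬ Nbr off nbr v y

theorem ForkResult.mono {off nbr : ℕ → ℕ} {v r9 r10 : ℕ} {s s' : ℕ → ℕ → Prop}
    (h : ForkResult off nbr v s r9 r10) (hs : ∀ w u, s' w u → s w u) :
    ForkResult off nbr v s' r9 r10 :=
  h.imp_left fun h => ⟨h.1, fun w u hwu => h.2 w u (hs w u hwu)⟩

/-- The closed neighbourhood of `v` is stamped first, including `v` itself, so that an unstamped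
neighbour of a neighbour is at once distinct from `v` and not adjacent to it. The two nested loops
make the cost quadratic in `D + 1`. -/
theorem WP.findFork {n D v : ℕ} {off nbr : ℕ → ℕ} {σ : Memory} {Q : ℕ → Memory → Prop}
    (hG : AdjLists n off nbr) (hσ : Base n D off nbr σ) (hD : ∀ v < n, deg off v ≤ D)
    (h6 : σ.reg 6 = v) (hv : v < n)
    (hQ : ∀ k τ, k ≤ 22 * (D + 1) * (D + 1) →
      Same [3, 9, 10, 20, 21, 22, 23, 24, 30, 31, 32, 33] [3] σ τ → Base n D off nbr τ →
      ForkResult off nbr v (fun w u => Nbr off nbr v w ∧ Nbr off nbr w u) (τ.reg 9) (τ.reg 10) →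
      Q k τ) :
    WP findFork σ Q := by
  obtain ⟨h0, h1, hn, hDr, hz, hst⟩ := hσ
  refine .instr_seq (.instr_seq (.instr_seq (.seq ?_)))
  refine .forNbrs (v := v) (off := off) (nbr := nbr) 1
    (fun i τ => Same [3, 9, 10, 20, 21, 22, 23, 24, 30, 31, 32, 33] [3] σ τ ∧
      τ.reg 3 = σ.reg 3 + 1 ∧ (∀ c, τ.arr 3 c ≤ σ.reg 3 + 1) ∧
      ∀ c, τ.arr 3 c = σ.reg 3 + 1 ↔ c = v ∨ NbrBefore off nbr v i c)
    (by simpa [Instr.effect] using h6) (by simpa [Instr.effect] using h0)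
    (by simpa [Instr.effect] using h1) (hG.le v hv) ?_ ?_ ?_ ?_
  · refine ⟨(((Same.refl _ _ _).setReg (by decide) _).setArr (by decide) _ _).setReg
      (by decide) _, by simp [Instr.effect], ?_, ?_⟩
    · intro c
      have := hst c
      simp only [Instr.effect, Memory.setReg_reg, Memory.setReg_arr, Memory.setArr_arr, if_true,
        Function.update_apply]
      split_ifs <;> omega
    · intro c
      have := hst c
      simp only [Instr.effect, Memory.setReg_reg, Memory.setReg_arr, Memory.setArr_arr, if_true,
        Function.update_apply, not_nbrBefore_self, or_false, Nat.reduceEqDiff, if_false, h6]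
      split_ifs with h
      · simp [h]
      · simp [h]; omega
  · rintro i τ r x hr hr' ⟨a1, a2, a3, a4⟩
    have hr : r = 21 ∨ r = 22 ∨ r = 23 := by omega
    refine ⟨a1.setReg (by simp; omega) _, ?_, by simpa using a3, by simpa using a4⟩
    rcases hr with rfl | rfl | rfl <;> simpa using a2
  · rintro i τ hi hi' ⟨a1, a2, a3, a4⟩ b0 b1 b23
    simp only [Nat.reduceAdd] at b23
    refine .instr ⟨le_rfl, by simp [Instr.effect, b0], by simp [Instr.effect, b1],
      by simp [Instr.effect], by simp [Instr.effect], a1.setArr (by decide) _ _,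
      by simp [Instr.effect, a2], fun c => ?_, fun c => ?_⟩
    · simp only [Instr.effect, Memory.setArr_arr, if_true, Function.update_apply, a2]
      split_ifs
      · exact le_rfl
      · exact a3 c
    · simp only [Instr.effect, Memory.setArr_arr, if_true, Function.update_apply, a2, b23,
        nbrBefore_succ hi]
      split_ifs with h
      · simp [h]
      · simp [h, a4]
  rintro k₁ τ hk ⟨a1, a2, a3, a4⟩
  set S := [3, 9, 10, 20, 21, 22, 23, 24, 30, 31, 32, 33]
  have base : ∀ υ, Same S [3] σ υ → υ.reg 3 = σ.reg 3 + 1 →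
      υ.arr 3 = τ.arr 3 → Base n D off nbr υ := by
    intro υ f e1 e2
    exact ⟨(f.arr 0 (by decide)).trans h0, (f.arr 1 (by decide)).trans h1,
      (f.reg 0 (by decide)).trans hn, (f.reg 1 (by decide)).trans hDr,
      (f.reg 2 (by decide)).trans hz, by simpa [e1, e2] using a3⟩
  have b1 := base τ a1 a2 rfl
  refine .instr_seq (.instr_seq ?_)
  refine .forNbrs (v := v) (off := off) (nbr := nbr) (7 * D + 5)
    (fun i υ => Same S [3] σ υ ∧ υ.reg 3 = σ.reg 3 + 1 ∧ υ.arr 3 = τ.arr 3 ∧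
      ForkResult off nbr v (fun w u => NbrBefore off nbr v i w ∧ Nbr off nbr w u)
        (υ.reg 9) (υ.reg 10))
    ?_ (by simpa [Instr.effect] using b1.off)
    (by simpa [Instr.effect] using b1.nbr) (hG.le v hv) ?_ ?_ ?_ ?_
  · have := a1.reg 6 (by decide)
    simp [Instr.effect, this, h6]
  · refine ⟨(a1.setReg (by decide) _).setReg (by decide) _, by simp [Instr.effect, a2],
      by simp [Instr.effect], .inl ⟨by simp [Instr.effect], ?_⟩⟩
    intro w u h
    exact absurd h.1 not_nbrBefore_self
  · rintro i υ r x hr hr' ⟨c1, c2, c3, c4⟩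
    have hr : r = 31 ∨ r = 32 ∨ r = 33 := by omega
    refine ⟨c1.setReg (by simp [S]; omega) _, ?_⟩
    rcases hr with rfl | rfl | rfl <;> simpa using ⟨c2, c3, c4⟩
  · rintro i υ hi hi' ⟨c1, c2, c3, c4⟩ b0 b1 b33
    simp only [Nat.reduceAdd] at b33
    set w := nbr i with hwdef
    have hvw : Nbr off nbr v w := ⟨i, hi, hi', rfl⟩
    have hw : w < n := hG.lt v hv _ hvw
    refine .instr_seq (.forNbrs (v := w) (off := off) (nbr := nbr) 4
      (fun j ω => Same S [3] σ ω ∧ ω.reg 3 = σ.reg 3 + 1 ∧ ω.arr 3 = τ.arr 3 ∧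
        ω.reg 33 = w ∧ ω.reg 31 = υ.reg 31 ∧ ω.reg 32 = υ.reg 32 ∧
        ForkResult off nbr v (fun x u => NbrBefore off nbr v i x ∧ Nbr off nbr x u ∨
          x = w ∧ NbrBefore off nbr w j u) (ω.reg 9) (ω.reg 10))
      (by simpa [Instr.effect] using b33) (by simpa [Instr.effect] using b0)
      (by simpa [Instr.effect] using b1) (hG.le w hw) ?_ ?_ ?_ ?_)
    · refine ⟨c1.setReg (by decide) _, ?_⟩
      simp only [Instr.effect, Memory.setReg_reg, Memory.setReg_arr, Nat.reduceEqDiff, if_false, c2,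
        c3, b33, true_and]
      refine c4.mono ?_
      rintro x u (h | h)
      · exact h
      · exact absurd h.2 not_nbrBefore_self
    · rintro i υ r x hr hr' ⟨d1, d2, d3, d4, d5, d6, d7⟩
      have hr : r = 21 ∨ r = 22 ∨ r = 23 := by omega
      refine ⟨d1.setReg (by simp [S]; omega) _, ?_⟩
      rcases hr with rfl | rfl | rfl <;> simpa using ⟨d2, d3, d4, d5, d6, d7⟩
    · rintro j ω hj hj' ⟨d1, d2, d3, d4, d5, d6, d7⟩ e0 e1 e23
      simp only [Nat.reduceAdd] at e23
      have hwu : Nbr off nbr w (nbr j) := ⟨j, hj, hj', rfl⟩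
      have hval : ω.arr 3 (nbr j) = σ.reg 3 + 1 ↔ nbr j = v ∨ Nbr off nbr v (nbr j) := by
        rw [d3]
        exact a4 (nbr j)
      refine .instr_seq (.branch (fun hb => .instr_seq (.instr ?_)) (fun hb => .skip ?_))
      · simp only [Test.Holds, Instr.effect, Memory.setReg_reg, Nat.reduceEqDiff, if_true, if_false,
          e23, d2, ne_eq, hval] at hb
        push Not at hb
        refine ⟨by omega, by simp [Instr.effect, e0], by simp [Instr.effect, e1],
          by simp [Instr.effect], by simp [Instr.effect],
          ((d1.setReg (by decide) _).setReg (by decide) _).setReg (by decide) _, ?_⟩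
        simp only [Instr.effect, Memory.setReg_reg, Nat.reduceEqDiff, if_true, if_false,
          Memory.setReg_arr, d2, d3, d4, d5, d6, e23, true_and]
        exact .inr ⟨nbr j, rfl, hvw, hwu, hb.1, hb.2⟩
      · simp only [Test.Holds, Instr.effect, Memory.setReg_reg, Nat.reduceEqDiff, if_true, if_false,
          e23, d2, ne_eq, hval, not_not] at hb
        refine ⟨by omega, by simp [Instr.effect, e0], by simp [Instr.effect, e1],
          by simp [Instr.effect], by simp [Instr.effect], d1.setReg (by decide) _, ?_⟩
        simp only [Instr.effect, Memory.setReg_reg, Nat.reduceEqDiff, if_false,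
          Memory.setReg_arr, d2, d3, d4, d5, d6, true_and]
        rcases d7 with ⟨h1, h2⟩ | h
        · refine .inl ⟨h1, fun x u hxu => ?_⟩
          simp only [nbrBefore_succ hj] at hxu
          rcases hxu with h | ⟨rfl, h | rfl⟩
          · exact h2 x u (.inl h)
          · exact h2 w u (.inr ⟨rfl, h⟩)
          · exact hb
        · exact .inr h
    · rintro k ω hk ⟨d1, d2, d3, d4, d5, d6, d7⟩
      have b2 := base ω d1 d2 d3
      refine ⟨?_, b2.off, b2.nbr, d5, d6, d1, d2, d3, d7.mono ?_⟩
      · have := hD w hw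
        rw [← deg] at hk
        omega
      · intro x u hxu
        rw [nbrBefore_succ hi] at hxu
        rcases hxu with ⟨h | rfl, h'⟩
        · exact .inl ⟨h, h'⟩
        · exact .inr ⟨rfl, h'⟩
  · rintro k υ hk' ⟨c1, c2, c3, c4⟩
    refine hQ _ _ ?_ c1 (base υ c1 c2 c3) c4
    have := hD v hv
    rw [← deg] at hk hk'
    have := Nat.mul_le_mul_left (7 * D + 5 + 3) this
    nlinarith

/-- Extend the path in array `6`, of length register `7`, first by the predecessor of register `9`,
and then until its last vertex has all its neighbours on the path. -/
def walk : Program :=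
  .loop (.ne 9 2) (Instr.pred 20 9 ;; Instr.store 6 7 20 ;; Instr.succ 7 7 ;; Instr.store 7 20 7 ;;
    Instr.const 9 0 ;;
    forNbrs 20 (Instr.load 24 7 23 ;; .branch (.eq 24 2) (Instr.succ 9 23) skip))

/-- Register `9` holds the next vertex, shifted by one, and is `0` once every neighbour of the last
vertex has a position. The walk ends because a path in `dom` has at most `n` vertices. -/
theorem WP.walk {n D k x : ℕ} {off nbr : ℕ → ℕ} {dom : ℕ → Prop} {σ : Memory}
    {Q : ℕ → Memory → Prop}
    (hG : AdjLists n off nbr) (hσ : Base n D off nbr σ) (hD : ∀ v < n, deg off v ≤ D)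
    (hdom : ∀ v, dom v → v < n ∧ ∀ w, Nbr off nbr v w → dom w)
    (h7 : σ.reg 7 = k) (h9 : σ.reg 9 = x + 1) (hX : IsPath off nbr dom k (σ.arr 6) (σ.arr 7))
    (hx : dom x) (hpx : σ.arr 7 x = 0) (hadj : 0 < k → Nbr off nbr (σ.arr 6 (k - 1)) x)
    (hQ : ∀ l τ m, Same [7, 9, 20, 21, 22, 23, 24] [6, 7] σ τ → τ.reg 7 = m → k < m →
      IsPath off nbr dom m (τ.arr 6) (τ.arr 7) → (∀ t < k, τ.arr 6 t = σ.arr 6 t) →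
      τ.arr 6 k = x → (∀ w, Nbr off nbr (τ.arr 6 (m - 1)) w → τ.arr 7 w ≠ 0) →
      l ≤ 10 * (D + 1) * (m - k) + 1 → Q l τ) :
    WP walk σ Q := by
  -- The clauses for `k = m` and `k < m` record that the first vertex appended is `x`; this keeps
  -- the third vertex of the fork in place.
  refine .loop (fun t τ => ∃ m, τ.reg 7 = m ∧ k ≤ m ∧ Same [7, 9, 20, 21, 22, 23, 24] [6, 7] σ τ ∧
      IsPath off nbr dom m (τ.arr 6) (τ.arr 7) ∧ (∀ t < k, τ.arr 6 t = σ.arr 6 t) ∧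
      (k = m → τ.reg 9 = x + 1) ∧ (k < m → τ.arr 6 k = x) ∧
      (∀ y, τ.reg 9 = y + 1 → dom y ∧ τ.arr 7 y = 0 ∧
        (0 < m → Nbr off nbr (τ.arr 6 (m - 1)) y)) ∧
      (τ.reg 9 = 0 → ∀ w, Nbr off nbr (τ.arr 6 (m - 1)) w → τ.arr 7 w ≠ 0) ∧
      t ≤ 10 * (D + 1) * (m - k)) (fun τ => n - τ.reg 7) ?_ ?_ ?_
  · refine ⟨k, h7, le_rfl, .refl _ _ _, hX, fun _ _ => rfl, fun _ => h9, by simp, ?_, by simp [h9],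
      by simp⟩
    intro y hy
    obtain rfl : y = x := by omega
    exact ⟨hx, hpx, hadj⟩
  · rintro t τ ⟨m, c1, c2, c3, c4, c5, c6, c7, c8, c9, c10⟩ hb
    have hB := hσ.same c3 (by decide) (by decide)
    simp only [Test.Holds, hB.zero] at hb
    obtain ⟨y, hy⟩ : ∃ y, τ.reg 9 = y + 1 := ⟨τ.reg 9 - 1, by omega⟩
    obtain ⟨e1, e2, e3⟩ := c8 y hy
    have hyn := (hdom y e1).1
    have hP := c4.push e1 e2 e3
    have hmn := hP.le fun v hv => (hdom v hv).1
    set X := Function.update (τ.arr 6) m y with hXdef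
    set p := Function.update (τ.arr 7) y (m + 1) with hpdef
    refine .instr_seq (.instr_seq (.instr_seq (.instr_seq (.instr_seq ?_))))
    refine .forNbrs (v := y) (off := off) (nbr := nbr) 3
      (fun i υ => Same [7, 9, 20, 21, 22, 23, 24] [6, 7] σ υ ∧ υ.reg 7 = m + 1 ∧ υ.arr 6 = X ∧
        υ.arr 7 = p ∧ (∀ z, υ.reg 9 = z + 1 → p z = 0 ∧ Nbr off nbr y z) ∧
        (υ.reg 9 = 0 → ∀ w, NbrBefore off nbr y i w → p w ≠ 0))
      (by simp [Instr.effect, hy]) (by simpa [Instr.effect] using hB.off)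
      (by simpa [Instr.effect] using hB.nbr) (hG.le y hyn) ?_ ?_ ?_ ?_
    · refine ⟨(((((c3.setReg (by decide) _).setArr (by decide) _ _).setReg (by decide) _).setArr
        (by decide) _ _).setReg (by decide) _), by simp [Instr.effect, c1],
        by simp [Instr.effect, c1, hy, hXdef], by simp [Instr.effect, c1, hy, hpdef],
        by simp [Instr.effect], fun _ w hw => absurd hw not_nbrBefore_self⟩
    · rintro i υ r x hr hr' ⟨d1, d2, d3, d4, d5, d6⟩
      have hr : r = 21 ∨ r = 22 ∨ r = 23 := by omega
      refine ⟨d1.setReg (by simp; omega) _, ?_⟩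
      rcases hr with rfl | rfl | rfl <;> simpa using ⟨d2, d3, d4, d5, d6⟩
    · rintro i υ hi hi' ⟨d1, d2, d3, d4, d5, d6⟩ b0 b1 b23
      simp only [Nat.reduceAdd] at b23
      have hz : υ.reg 2 = 0 := (d1.reg 2 (by decide)).trans hσ.zero
      refine .instr_seq (.branch (fun hb' => .instr ?_) (fun hb' => .skip ?_))
      · simp only [Test.Holds, Instr.effect, Memory.setReg_reg, b23, hz, Nat.reduceEqDiff,
          if_true, if_false, d4] at hb'
        refine ⟨by omega, by simp [Instr.effect, b0], by simp [Instr.effect, b1],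
          by simp [Instr.effect], by simp [Instr.effect],
          (d1.setReg (by decide) _).setReg (by decide) _, ?_⟩
        simp only [Instr.effect, Memory.setReg_reg, b23, Nat.reduceEqDiff, Memory.setReg_arr,
          if_true, if_false, d2, d3, d4, true_and]
        refine ⟨fun z hz' => ?_, by simp⟩
        obtain rfl : nbr i = z := by omega
        exact ⟨hb', i, hi, hi', rfl⟩
      · simp only [Test.Holds, Instr.effect, Memory.setReg_reg, b23, hz, Nat.reduceEqDiff,
          if_true, if_false, d4] at hb'
        refine ⟨by omega, by simp [Instr.effect, b0], by simp [Instr.effect, b1],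
          by simp [Instr.effect], by simp [Instr.effect], d1.setReg (by decide) _, ?_⟩
        simp only [Instr.effect, Memory.setReg_reg, Nat.reduceEqDiff, Memory.setReg_arr,
          if_false, d2, d3, d4, true_and]
        refine ⟨d5, fun h w hw => ?_⟩
        rw [nbrBefore_succ hi] at hw
        rcases hw with hw | rfl
        · exact d6 h w hw
        · exact hb'
    · rintro l υ hl ⟨d1, d2, d3, d4, d5, d6⟩
      refine ⟨⟨m + 1, d2, by omega, d1, by rwa [d3, d4], ?_, by omega, ?_, ?_, ?_, ?_⟩, ?_⟩
      · intro t ht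
        rw [d3, hXdef, Function.update_of_ne (by omega)]
        exact c5 t ht
      · intro _
        rw [d3, hXdef]
        by_cases h : k = m
        · rw [h, Function.update_self]
          have := c6 h
          omega
        · rw [Function.update_of_ne h]
          exact c7 (by omega)
      · intro z hz
        have h1 := d5 z hz
        refine ⟨(hdom y e1).2 z h1.2, by rw [d4]; exact h1.1, fun _ => ?_⟩
        simpa [d3, hXdef] using h1.2
      · intro h w hw
        rw [d4]
        simp only [d3, hXdef, Nat.add_sub_cancel, Function.update_self] at hw
        exact d6 h w hw
      · have := hD y hyn
        rw [← deg] at hl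
        rw [show m + 1 - k = (m - k) + 1 by omega, mul_add]
        omega
      · rw [d2]
        omega
  · rintro t τ ⟨m, c1, c2, c3, c4, c5, c6, c7, c8, c9, c10⟩ hb
    have hz : τ.reg 2 = 0 := (c3.reg 2 (by decide)).trans hσ.zero
    simp only [Test.Holds, hz, ne_eq, not_not] at hb
    have hkm : k < m := by
      rcases c2.lt_or_eq with h | h
      · exact h
      · have := c6 h
        omega
    exact hQ _ _ m c3 c1 hkm c4 c5 (c7 hkm) (c9 hb) (by omega)

/-- Store in register `8` the smallest position on the path of a neighbour of its last vertex,
or the position of the last vertex if it has no neighbour. -/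
def firstReturn : Program :=
  Instr.pred 8 7 ;; Instr.load 20 6 8 ;;
    forNbrs 20 (Instr.load 24 7 23 ;; Instr.pred 24 24 ;; .branch (.lt 24 8) (Instr.copy 8 24) skip)

/-- Taking the smallest position puts all neighbours of the last vertex on the resulting cycle. The
minimum starts at `k - 1`, the position of the last vertex itself, which survives only if that
vertex has no neighbour at a smaller position. -/
theorem WP.firstReturn {n D k u : ℕ} {off nbr : ℕ → ℕ} {σ : Memory} {Q : ℕ → Memory → Prop}
    (hG : AdjLists n off nbr) (hσ : Base n D off nbr σ) (hD : ∀ v < n, deg off v ≤ D)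
    (h7 : σ.reg 7 = k) (hk : 0 < k) (hu : σ.arr 6 (k - 1) = u) (hun : u < n)
    (hnb : ∀ w, Nbr off nbr u w → σ.arr 7 w ≠ 0)
    (hQ : ∀ l τ j, Same [8, 20, 21, 22, 23, 24] [] σ τ → τ.reg 8 = j → j < k →
      (∀ w, Nbr off nbr u w → j < σ.arr 7 w) →
      (j + 1 = k ∨ ∃ w, Nbr off nbr u w ∧ σ.arr 7 w = j + 1) → l ≤ 7 * (D + 1) → Q l τ) :
    WP firstReturn σ Q := by
  refine .instr_seq (.instr_seq (.forNbrs (v := u) (off := off) (nbr := nbr) 4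
    (fun i υ => Same [8, 20, 21, 22, 23, 24] [] σ υ ∧ υ.reg 8 < k ∧
      (∀ w, NbrBefore off nbr u i w → υ.reg 8 < σ.arr 7 w) ∧
      (υ.reg 8 + 1 = k ∨ ∃ w, Nbr off nbr u w ∧ σ.arr 7 w = υ.reg 8 + 1))
      (by simp [Instr.effect, h7, hu]) (by simpa [Instr.effect] using hσ.off)
      (by simpa [Instr.effect] using hσ.nbr) (hG.le u hun) ?_ ?_ ?_ ?_))
  · refine ⟨((Same.refl _ _ _).setReg (by decide) _).setReg (by decide) _, ?_, ?_, .inl ?_⟩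
    · simp [Instr.effect, h7, hk]
    · exact fun w hw => absurd hw not_nbrBefore_self
    · simp [Instr.effect]
      omega
  · rintro i υ r x hr hr' ⟨d1, d2, d3, d4⟩
    have hr : r = 21 ∨ r = 22 ∨ r = 23 := by omega
    refine ⟨d1.setReg (by simp; omega) _, ?_⟩
    rcases hr with rfl | rfl | rfl <;> simpa using ⟨d2, d3, d4⟩
  · rintro i υ hi hi' ⟨d1, d2, d3, d4⟩ b0 b1 b23
    simp only [Nat.reduceAdd] at b23
    have e7 : υ.arr 7 = σ.arr 7 := d1.arr 7 (by decide)
    have hw : Nbr off nbr u (nbr i) := ⟨i, hi, hi', rfl⟩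
    have hnw := hnb _ hw
    refine .instr_seq (.instr_seq (.branch (fun hb => .instr ?_) (fun hb => .skip ?_)))
    · simp only [Test.Holds, Instr.effect, Memory.setReg_reg, b23, Nat.reduceEqDiff, if_true,
        if_false, e7] at hb
      refine ⟨by omega, by simp [Instr.effect, b0], by simp [Instr.effect, b1],
        by simp [Instr.effect], by simp [Instr.effect],
        ((d1.setReg (by decide) _).setReg (by decide) _).setReg (by decide) _, ?_⟩
      simp only [Instr.effect, Memory.setReg_reg, b23, if_true, e7]
      refine ⟨by omega, fun w hw' => ?_, .inr ⟨_, hw, by omega⟩⟩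
      rw [nbrBefore_succ hi] at hw'
      rcases hw' with hw' | rfl
      · have := d3 w hw'
        omega
      · omega
    · simp only [Test.Holds, Instr.effect, Memory.setReg_reg, b23, Nat.reduceEqDiff, if_true,
        if_false, e7] at hb
      refine ⟨by omega, by simp [Instr.effect, b0], by simp [Instr.effect, b1],
        by simp [Instr.effect], by simp [Instr.effect],
        (d1.setReg (by decide) _).setReg (by decide) _, ?_⟩
      simp only [Instr.effect, Memory.setReg_reg, Nat.reduceEqDiff, if_false]
      refine ⟨d2, fun w hw' => ?_, d4⟩
      rw [nbrBefore_succ hi] at hw'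
      rcases hw' with hw' | rfl
      · exact d3 w hw'
      · omega
  · rintro l υ hl ⟨d1, d2, d3, d4⟩
    refine hQ _ _ _ d1 rfl d2 d3 d4 ?_
    have := hD u hun
    rw [← deg] at hl
    omega

/-- Append the part of the path from the position in register `8` to the queue. The new end of the
queue is also stored in register `14`. -/
def seed : Program :=
  Instr.copy 13 8 ;; .loop (.lt 13 7) (Instr.load 20 6 13 ;; Instr.store 5 5 20 ;;
    Instr.succ 5 5 ;; Instr.store 4 20 5 ;; Instr.succ 13 13) ;; Instr.copy 14 5

theorem WP.seed {n j k m : ℕ} {X : ℕ → ℕ} {σ : Memory} {Q : ℕ → Memory → Prop}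
    (h5 : σ.reg 5 = m) (h7 : σ.reg 7 = k) (h8 : σ.reg 8 = j) (hjk : j ≤ k) (h6 : σ.arr 6 = X)
    (hX : ∀ t < k, X t < n ∧ σ.arr 4 (X t) = 0) (hinj : ∀ s < k, ∀ t < k, X s = X t → s = t)
    (hL : Listing (· < n) m (σ.arr 5) (σ.arr 4))
    (hQ : ∀ l τ, Same [5, 13, 14, 20] [4, 5] σ τ → τ.reg 5 = m + (k - j) →
      τ.reg 14 = m + (k - j) → Listing (· < n) (m + (k - j)) (τ.arr 5) (τ.arr 4) →
      (∀ t < m, τ.arr 5 t = σ.arr 5 t) →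
      (∀ t, j ≤ t → t < k → τ.arr 5 (m + (t - j)) = X t) → l ≤ 6 * (k - j) + 3 → Q l τ) :
    WP seed σ Q := by
  refine .instr_seq (.seq (.loop (fun t τ => ∃ i, τ.reg 13 = i ∧ j ≤ i ∧ i ≤ k ∧
      Same [5, 13, 14, 20] [4, 5] σ τ ∧ τ.reg 5 = m + (i - j) ∧
      Listing (· < n) (m + (i - j)) (τ.arr 5) (τ.arr 4) ∧ (∀ t < m, τ.arr 5 t = σ.arr 5 t) ∧
      (∀ t, j ≤ t → t < i → τ.arr 5 (m + (t - j)) = X t) ∧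
      (∀ t, i ≤ t → t < k → τ.arr 4 (X t) = 0) ∧ t ≤ 6 * (i - j)) (fun τ => k - τ.reg 13) ?_ ?_ ?_))
  · refine ⟨j, by simp [Instr.effect, h8], le_rfl, hjk, (Same.refl _ _ _).setReg (by decide) _,
      by simp [Instr.effect, h5], by simpa [Instr.effect] using hL, fun _ _ => rfl,
      fun t _ _ => by omega, fun t _ ht => (hX t ht).2, by simp⟩
  · rintro t τ ⟨i, c1, c2, c3, c4, c5, c6, c7, c8, c9, c10⟩ hb
    have e6 : τ.arr 6 = X := (c4.arr 6 (by decide)).trans h6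
    have e7 : τ.reg 7 = k := (c4.reg 7 (by decide)).trans h7
    simp only [Test.Holds, c1, e7] at hb
    have hi : m + (i + 1 - j) = m + (i - j) + 1 := by omega
    refine .instr_seq (.instr_seq (.instr_seq (.instr_seq (.instr ⟨⟨i + 1, ?_, by omega, by omega,
      ((((c4.setReg (by decide) _).setArr (by decide) _ _).setReg (by decide) _).setArr
        (by decide) _ _).setReg (by decide) _, ?_, ?_, ?_, ?_, ?_, ?_⟩, ?_⟩))))
    · simp [Instr.effect, c1]
    · simp [Instr.effect, c5]
      omega
    · rw [hi]
      have := c6.push (hX i hb).1 (c9 i le_rfl hb)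
      simpa [Instr.effect, c1, c5, e6] using this
    · intro t ht
      have : t ≠ m + (i - j) := by omega
      simpa [Instr.effect, c5, this] using c7 t ht
    · intro t ht ht'
      simp only [Instr.effect, Memory.setReg_reg, Memory.setReg_arr, Memory.setArr_arr,
        Memory.setArr_reg, Nat.reduceEqDiff, if_true, if_false, c5, c1, e6]
      rw [Function.update_apply]
      split_ifs with h
      · rw [show t = i by omega]
      · exact c8 t ht (by omega)
    · intro t ht ht'
      have : X t ≠ X i := fun h => by
        have := hinj t ht' i hb h
        omega
      simpa [Instr.effect, c1, e6, this] using c9 t (by omega) ht'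
    · omega
    · simp [Instr.effect, c1]
      omega
  · rintro t τ ⟨i, c1, c2, c3, c4, c5, c6, c7, c8, c9, c10⟩ hb
    have e7 : τ.reg 7 = k := (c4.reg 7 (by decide)).trans h7
    simp only [Test.Holds, c1, e7] at hb
    obtain rfl : i = k := by omega
    exact .instr (hQ _ _ (c4.setReg (by decide) _) (by simp [Instr.effect, c5])
      (by simp [Instr.effect, c5]) c6 c7 c8 (by omega))

/-- Search for the last vertex on the path, from the position in register `8`, with a coloured
neighbour. Its position, increased by one, is stored in register `12`, and the neighbour in
register `10`. Register `12` is `0` if there is no such vertex. -/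
def scan : Program :=
  Instr.const 12 0 ;; Instr.copy 13 8 ;; .loop (.lt 13 7) (Instr.load 20 6 13 ;;
    forNbrs 20 (Instr.load 24 2 23 ;;
      .branch (.ne 24 2) (Instr.copy 10 23 ;; Instr.succ 12 13) skip) ;;
    Instr.succ 13 13)

/-- The result of `scan` after the pairs `(t, w)` with `seen t w` have been tried, where `t` is a
position on the path and `w` is a neighbour of `X t`. -/
def ScanResult (off nbr X col : ℕ → ℕ) (j k : ℕ) (seen : ℕ → ℕ → Prop) (r12 r10 : ℕ) : Prop :=
  (r12 = 0 ∧ ∀ t w, seen t w → col w = 0) ∨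
    ∃ i, r12 = i + 1 ∧ j ≤ i ∧ i < k ∧ Nbr off nbr (X i) r10 ∧ col r10 ≠ 0 ∧
      ∀ t w, i < t → seen t w → col w = 0

theorem ScanResult.mono {off nbr X col : ℕ → ℕ} {j k k' r12 r10 : ℕ} {s s' : ℕ → ℕ → Prop}
    (h : ScanResult off nbr X col j k s r12 r10) (hk : k ≤ k') (hs : ∀ w u, s' w u → s w u) :
    ScanResult off nbr X col j k' s' r12 r10 := by
  rcases h with ⟨h1, h2⟩ | ⟨i, h1, h2, h3, h4, h5, h6⟩
  · exact .inl ⟨h1, fun t w h => h2 t w (hs t w h)⟩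
  · exact .inr ⟨i, h1, h2, by omega, h4, h5, fun t w h h' => h6 t w h (hs t w h')⟩

/-- Positions are visited in increasing order and later finds overwrite earlier ones, so the
recorded position is the last one. The later vertices of the cycle therefore have no coloured
neighbour. -/
theorem WP.scan {n D j k : ℕ} {off nbr X col : ℕ → ℕ} {σ : Memory} {Q : ℕ → Memory → Prop}
    (hG : AdjLists n off nbr) (hσ : Base n D off nbr σ) (hD : ∀ v < n, deg off v ≤ D)
    (h7 : σ.reg 7 = k) (h8 : σ.reg 8 = j) (hjk : j ≤ k) (h6 : σ.arr 6 = X) (h2 : σ.arr 2 = col)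
    (hX : ∀ t < k, X t < n)
    (hQ : ∀ l τ, Same [10, 12, 13, 20, 21, 22, 23, 24] [] σ τ →
      ScanResult off nbr X col j k (fun t w => j ≤ t ∧ t < k ∧ Nbr off nbr (X t) w)
        (τ.reg 12) (τ.reg 10) → l ≤ 7 * (D + 1) * (k - j) + 3 → Q l τ) :
    WP scan σ Q := by
  refine .instr_seq (.instr_seq (.loop (fun t τ => ∃ i, τ.reg 13 = i ∧ j ≤ i ∧ i ≤ k ∧
      Same [10, 12, 13, 20, 21, 22, 23, 24] [] σ τ ∧
      ScanResult off nbr X col j i (fun t w => j ≤ t ∧ t < i ∧ Nbr off nbr (X t) w)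
        (τ.reg 12) (τ.reg 10) ∧ t ≤ 7 * (D + 1) * (i - j)) (fun τ => k - τ.reg 13) ?_ ?_ ?_))
  · refine ⟨j, by simp [Instr.effect, h8], le_rfl, hjk,
      ((Same.refl _ _ _).setReg (by decide) _).setReg (by decide) _,
      .inl ⟨by simp [Instr.effect], fun t w h => by omega⟩, by simp⟩
  · rintro t τ ⟨i, c1, c2, c3, c4, c5, c6⟩ hb
    have hB := hσ.same c4 (by decide) (by decide)
    have e6 : τ.arr 6 = X := (c4.arr 6 (by decide)).trans h6
    have e7 : τ.reg 7 = k := (c4.reg 7 (by decide)).trans h7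
    simp only [Test.Holds, c1, e7] at hb
    have hu := hX i hb
    refine .instr_seq (.seq (.forNbrs (v := X i) (off := off) (nbr := nbr) 4
      (fun a υ => Same [10, 12, 13, 20, 21, 22, 23, 24] [] σ υ ∧ υ.reg 13 = i ∧
        ScanResult off nbr X col j (i + 1) (fun t w => j ≤ t ∧ t < i ∧ Nbr off nbr (X t) w ∨
          t = i ∧ NbrBefore off nbr (X i) a w) (υ.reg 12) (υ.reg 10))
      (by simp [Instr.effect, c1, e6]) (by simpa [Instr.effect] using hB.off)
      (by simpa [Instr.effect] using hB.nbr) (hG.le _ hu) ?_ ?_ ?_ ?_))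
    · refine ⟨c4.setReg (by decide) _, by simp [Instr.effect, c1], ?_⟩
      simp only [Instr.effect, Memory.setReg_reg, Nat.reduceEqDiff, if_false]
      refine c5.mono (by omega) ?_
      rintro t w (h | h)
      · exact h
      · exact absurd h.2 not_nbrBefore_self
    · rintro i υ r x hr hr' ⟨d1, d2, d3⟩
      have hr : r = 21 ∨ r = 22 ∨ r = 23 := by omega
      refine ⟨d1.setReg (by simp; omega) _, ?_⟩
      rcases hr with rfl | rfl | rfl <;> simpa using ⟨d2, d3⟩
    · rintro a υ ha ha' ⟨d1, d2, d3⟩ b0 b1 b23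
      simp only [Nat.reduceAdd] at b23
      have hz : υ.reg 2 = 0 := (d1.reg 2 (by decide)).trans hσ.zero
      have e2 : υ.arr 2 = col := (d1.arr 2 (by decide)).trans h2
      have hw : Nbr off nbr (X i) (nbr a) := ⟨a, ha, ha', rfl⟩
      refine .instr_seq (.branch (fun hb => .instr_seq (.instr ?_)) (fun hb => .skip ?_))
      · simp only [Test.Holds, Instr.effect, Memory.setReg_reg, b23, hz, Nat.reduceEqDiff,
          if_true, if_false, e2] at hb
        refine ⟨by omega, by simp [Instr.effect, b0], by simp [Instr.effect, b1],
          by simp [Instr.effect], by simp [Instr.effect],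
          ((d1.setReg (by decide) _).setReg (by decide) _).setReg (by decide) _,
          by simp [Instr.effect, d2], .inr ⟨i, ?_⟩⟩
        simp only [Instr.effect, Memory.setReg_reg, b23, Nat.reduceEqDiff, if_true, if_false, d2]
        refine ⟨trivial, c2, by omega, hw, hb, fun t w ht h => ?_⟩
        omega
      · simp only [Test.Holds, Instr.effect, Memory.setReg_reg, b23, hz, Nat.reduceEqDiff,
          if_true, if_false, e2, ne_eq, not_not] at hb
        refine ⟨by omega, by simp [Instr.effect, b0], by simp [Instr.effect, b1],
          by simp [Instr.effect], by simp [Instr.effect], d1.setReg (by decide) _,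
          by simp [Instr.effect, d2], ?_⟩
        simp only [Instr.effect, Memory.setReg_reg, Nat.reduceEqDiff, if_false]
        rcases d3 with ⟨f1, f2⟩ | ⟨i', f1, f2, f3, f4, f5, f6⟩
        · refine .inl ⟨f1, fun t w h => ?_⟩
          simp only [nbrBefore_succ ha] at h
          rcases h with h | ⟨h, h' | rfl⟩
          · exact f2 t w (.inl h)
          · exact f2 t w (.inr ⟨h, h'⟩)
          · exact hb
        · refine .inr ⟨i', f1, f2, f3, f4, f5, fun t w h' h => ?_⟩
          simp only [nbrBefore_succ ha] at h
          rcases h with h | ⟨h, h'' | rfl⟩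
          · exact f6 t w h' (.inl h)
          · exact f6 t w h' (.inr ⟨h, h''⟩)
          · exact hb
    · rintro l υ hl ⟨d1, d2, d3⟩
      refine .instr ⟨⟨i + 1, by simp [Instr.effect, d2], by omega, by omega,
        d1.setReg (by decide) _, ?_, ?_⟩, ?_⟩
      · simp only [Instr.effect, Memory.setReg_reg, Nat.reduceEqDiff, if_false]
        refine d3.mono le_rfl ?_
        rintro t w ⟨h1, h2, h3⟩
        rcases Nat.lt_succ_iff_lt_or_eq.1 h2 with h4 | rfl
        · exact .inl ⟨h1, h4, h3⟩
        · exact .inr ⟨rfl, h3⟩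
      · have := hD _ hu
        rw [← deg] at hl
        rw [show i + 1 - j = (i - j) + 1 by omega, mul_add]
        omega
      · simp [Instr.effect, d2, c1]
        omega
  · rintro t τ ⟨i, c1, c2, c3, c4, c5, c6⟩ hb
    have e7 : τ.reg 7 = k := (c4.reg 7 (by decide)).trans h7
    simp only [Test.Holds, c1, e7] at hb
    obtain rfl : i = k := by omega
    exact hQ _ _ c4 c5 (by omega)

end RAM

/-! ### Three ways to colour the cycle -/

/-- `col'` arises from `col` by colouring the vertices `X s` with `A s`. -/
def Recoloured (X : ℕ → ℕ) (A : ℕ → Prop) (col col' : ℕ → ℕ) : Prop :=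
  (∀ s, A s → col' (X s) ≠ 0) ∧ ∀ v, (∀ s, A s → X s ≠ v) → col' v = col v

theorem Recoloured.refl {X : ℕ → ℕ} {A : ℕ → Prop} (hA : ∀ s, ¬ A s) (col : ℕ → ℕ) :
    Recoloured X A col col :=
  ⟨fun s h => absurd h (hA s), fun _ _ => rfl⟩

theorem Recoloured.update {X : ℕ → ℕ} {A A' : ℕ → Prop} {col col' : ℕ → ℕ}
    (h : Recoloured X A col col') {t c : ℕ} (hc : c ≠ 0) (hA : ∀ s, A' s ↔ A s ∨ s = t) :
    Recoloured X A' col (Function.update col' (X t) c) := by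
  constructor
  · intro s hs
    rw [Function.update_apply]
    split_ifs with hst
    · exact hc
    · rcases (hA s).1 hs with hs | rfl
      · exact h.1 s hs
      · exact absurd rfl hst
  · intro v hv
    rw [Function.update_of_ne (hv t ((hA t).2 (.inr rfl))).symm]
    exact h.2 v fun s hs => hv s ((hA s).2 (.inl hs))

theorem Recoloured.congr {X : ℕ → ℕ} {A A' : ℕ → Prop} {col col' : ℕ → ℕ}
    (h : Recoloured X A col col') (hA : ∀ s, A' s ↔ A s) : Recoloured X A' col col' := by
  obtain rfl : A' = A := funext fun s => propext (hA s)
  exact h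

/-- The usual source of slack: a neighbour at a position not yet treated keeps its old colour, which
is `0` in the applications to uncoloured vertices. Injectivity of `X` is needed to pass from
vertices to positions. -/
theorem Recoloured.eq_of_not {k t : ℕ} {X : ℕ → ℕ} {A : ℕ → Prop} {col col' : ℕ → ℕ}
    (h : Recoloured X A col col') (hinj : ∀ s < k, ∀ t < k, X s = X t → s = t)
    (hA : ∀ s, A s → s < k) (ht : t < k) (hAt : ¬ A t) : col' (X t) = col (X t) :=
  h.2 _ fun s hs hst => hAt (hinj s (hA s hs) t ht hst ▸ hs)

/-- `Exc` contains the vertices of the complete components with `D + 1` vertices, and those of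
the `D`-regular odd cycles. -/
structure ExcSpec (n D : ℕ) (off nbr : ℕ → ℕ) (Exc : ℕ → Prop) : Prop where
  closed : ∀ v < n, ∀ w, Nbr off nbr v w → Exc v → Exc w
  complete : ∀ v < n, deg off v = D → (∀ w, Nbr off nbr v w → deg off w = D) →
    (∀ w, Nbr off nbr v w → ∀ u, Nbr off nbr w u → u = v ∨ Nbr off nbr v u) → Exc v
  cycle : ∀ (k : ℕ) (X : ℕ → ℕ), 3 ≤ k → k % 2 = 1 → (∀ t < k, X t < n ∧ deg off (X t) = D) →
    (∀ s < k, ∀ t < k, X s = X t → s = t) →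
    (∀ t < k, ∀ w, Nbr off nbr (X t) w ↔ ∃ s < k, w = X s ∧
      (s = t + 1 ∨ s + 1 = t ∨ t = 0 ∧ s + 1 = k ∨ t + 1 = k ∧ s = 0)) → Exc (X 0)

theorem FirstFit.eq_one {off nbr col : ℕ → ℕ} {v c : ℕ} (h : FirstFit off nbr col v c)
    (h0 : ∀ w, Nbr off nbr v w → col w = 0) : c = 1 := by
  by_contra hc
  obtain ⟨w, hw, hw'⟩ := h.min 1 le_rfl (by have := h.pos; omega)
  have := h0 w hw
  omega

namespace RAM

/-- The last vertex with a coloured neighbour on the cycle is known: its successor receives the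
colour of that neighbour, and the other vertices of the cycle follow in cyclic order. -/
def finishCycle : Program :=
  Instr.load 24 2 10 ;; Instr.load 20 6 12 ;; Instr.store 2 20 24 ;; Instr.succ 13 12 ;;
    Instr.copy 14 7 ;; colourUp 6 ;; Instr.copy 13 8 ;; Instr.copy 14 12 ;; colourUp 6

/-- `X (i + 1)` may take the colour of `y` because it sees no coloured vertex. On the way around,
every vertex has an uncoloured successor, except the final `X i`, which has slack through the equal
colours of `y` and `X (i + 1)`. -/
theorem WP.finishCycle {n D i j k y : ℕ} {off nbr X col : ℕ → ℕ} {Exc : ℕ → Prop} {σ : Memory}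
    {Q : ℕ → Memory → Prop}
    (hG : AdjLists n off nbr) (hσ : Base n D off nbr σ) (hD : ∀ v < n, deg off v ≤ D)
    (hE : ExcSpec n D off nbr Exc)
    (h7 : σ.reg 7 = k) (h8 : σ.reg 8 = j) (h12 : σ.reg 12 = i + 1) (h10 : σ.reg 10 = y)
    (h6 : σ.arr 6 = X) (h2 : σ.arr 2 = col)
    (hX : ∀ t < k, X t < n) (hinj : ∀ s < k, ∀ t < k, X s = X t → s = t)
    (hadj : ∀ t, t + 1 < k → Nbr off nbr (X t) (X (t + 1)))
    (hcyc : Nbr off nbr (X (k - 1)) (X j)) (hji : j ≤ i) (hik : i + 1 < k)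
    (hcol : GoodColouring n D off nbr Exc col) (hC : ∀ t, j ≤ t → t < k → col (X t) = 0)
    (hy : Nbr off nbr (X i) y) (hy0 : col y ≠ 0)
    (hlast : ∀ w, Nbr off nbr (X (i + 1)) w → col w = 0)
    (hQ : ∀ l τ, Same [3, 13, 14, 20, 21, 22, 23, 24, 25] [2, 3] σ τ → Base n D off nbr τ →
      GoodColouring n D off nbr Exc (τ.arr 2) →
      Recoloured X (fun s => j ≤ s ∧ s < k) col (τ.arr 2) →
      l ≤ 12 * (D + 1) * (k - j) + 9 → Q l τ) :
    WP finishCycle σ Q := by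
  have hyn : y < n := hG.lt _ (hX i (by omega)) y hy
  have hXy : ∀ s, j ≤ s → s < k → X s ≠ y := fun s hs hs' h => hy0 (h ▸ hC s hs hs')
  refine .instr_seq (.instr_seq (.instr_seq (.instr_seq (.instr_seq (.seq ?_)))))
  refine .colourUp (n := n) (D := D) (off := off) (nbr := nbr) (X := X) (a := i + 2) (b := k) hG
    (hσ.same (rs := [13, 14, 20, 24]) (as := [2]) ?_ (by decide) (by decide))
    (by simp [Instr.effect, h12]) (by simp [Instr.effect, h7]) (by omega)
    (by simp [Instr.effect, h6]) (by decide) (fun t _ ht => hX t ht)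
    (fun t col' => GoodColouring n D off nbr Exc col' ∧
      Recoloured X (fun s => i + 1 ≤ s ∧ s < t) col col' ∧ col' (X (i + 1)) = col y) ?_ ?_ ?_
  · exact (((((Same.refl _ _ _).setReg (by decide) _).setReg (by decide) _).setArr
      (by decide) _ _).setReg (by decide) _).setReg (by decide) _
  · simp only [Instr.effect, Memory.setReg_reg, Memory.setReg_arr, Memory.setArr_arr, if_true,
      Nat.reduceEqDiff, if_false, h2, h10, h12, h6]
    refine ⟨hcol.update hG (hX _ hik) (fun w hw h => hy0 (h.symm.trans (hlast w hw)))
      (hcol.le_succ y hyn) (fun h => hcol.le y hyn fun h' => h ?_),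
      (Recoloured.refl (A := fun _ => False) (by simp) col).update hy0 (fun s => ?_), by simp⟩
    -- The copied colour is not a first-fit colour, so its bound comes from `y`: exceptionality
    -- passes along the edges from `y` to `X i` and on to `X (i + 1)`.
    · exact hE.closed _ (hX i (by omega)) _ (hadj i hik)
        (hE.closed _ hyn _ (hG.symm _ (hX i (by omega)) _ hy) h')
    · simp only [false_or]
      omega
  · rintro t col' c ht ht' ⟨a1, a2, a3⟩ hf
    have hXt := hX t ht'
    refine ⟨a1.firstFit hG hXt (hD _ hXt) hf (.inr (.inr (.inl ?_))),
      a2.update (by have := hf.pos; omega) (by omega), ?_⟩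
    · by_cases htk : t + 1 < k
      · refine ⟨_, hadj t htk, ?_⟩
        rw [a2.eq_of_not hinj (fun s hs => by omega) htk (by omega)]
        exact hC _ (by omega) htk
      -- The successor of the last vertex is `X j`, across the closing edge; it is coloured only in
      -- the second round.
      · obtain rfl : t = k - 1 := by omega
        refine ⟨_, hcyc, ?_⟩
        rw [a2.eq_of_not hinj (fun s hs => by omega) (by omega) (by omega)]
        exact hC _ le_rfl (by omega)
    · rw [Function.update_of_ne, a3]
      intro h
      have := hinj _ hik _ ht' h
      omega
  intro l₁ τ hl₁ s1 hB ⟨g1, r1, e1⟩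
  have s1' : Same [3, 13, 14, 20, 21, 22, 23, 24, 25] [2, 3] σ τ :=
    ((((((Same.refl _ _ _).setReg (by decide) _).setReg (by decide) _).setArr
      (by decide) _ _).setReg (by decide) _).setReg (by decide) _).trans s1 (by decide) (by decide)
  refine .instr_seq (.instr_seq ?_)
  refine .colourUp (n := n) (D := D) (off := off) (nbr := nbr) (X := X) (a := j) (b := i + 1) hG
    (hB.same (((Same.refl [13, 14] [] _).setReg (by decide) _).setReg (by decide) _) (by decide)
      (by decide))
    (by simpa [Instr.effect] using (s1'.reg 8 (by decide)).trans h8)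
    (by simpa [Instr.effect] using (s1'.reg 12 (by decide)).trans h12) (by omega)
    (by simpa [Instr.effect] using (s1'.arr 6 (by decide)).trans h6) (by decide)
    (fun t _ ht => hX t (by omega))
    (fun t col' => GoodColouring n D off nbr Exc col' ∧
      Recoloured X (fun s => i + 1 ≤ s ∧ s < k ∨ j ≤ s ∧ s < t) col col' ∧
      col' (X (i + 1)) = col y) ?_ ?_ ?_
  · exact ⟨g1, r1.congr (by omega), e1⟩
  · rintro t col' c ht ht' ⟨a1, a2, a3⟩ hf
    have hXt := hX t (by omega)
    refine ⟨a1.firstFit hG hXt (hD _ hXt) hf (.inr (.inr ?_)),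
      a2.update (by have := hf.pos; omega) (by omega), ?_⟩
    -- Only `X i` has its successor already coloured. Its neighbours `X (i + 1)` and `y` are
    -- distinct because `y` was coloured beforehand and the cycle was not.
    · by_cases hti : t = i
      · subst hti
        refine .inr ⟨X (t + 1), y, hadj t hik, hy, hXy _ (by omega) hik, ?_⟩
        rw [a3, a2.2 y]
        intro s hs
        exact hXy s (by omega) (by omega)
      · refine .inl ⟨_, hadj t (by omega), ?_⟩
        rw [a2.eq_of_not hinj (fun s hs => by omega) (by omega) (by omega)]
        exact hC _ (by omega) (by omega)
    · rw [Function.update_of_ne, a3]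
      intro h
      have := hinj _ hik _ (by omega) h
      omega
  intro l₂ υ hl₂ s2 hB' ⟨g2, r2, e2⟩
  refine hQ _ _ (((s1'.setReg (by decide) _).setReg (by decide) _).trans s2 (by decide)
    (by decide)) hB' g2 (r2.congr (by omega)) ?_
  have b1 : cost off X (i + 2) k ≤ (D + 1) * (k - (i + 2)) :=
    cost_le fun t _ ht => hD _ (hX t ht)
  have b2 : cost off X j (i + 1) ≤ (D + 1) * (i + 1 - j) :=
    cost_le fun t _ ht => hD _ (hX t (by omega))
  have b3 : 12 * (D + 1) * (k - j) =
      12 * ((D + 1) * (k - (i + 2))) + 12 * ((D + 1) * (i + 1 - j)) + 12 * (D + 1) := by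
    rw [show k - j = (k - (i + 2)) + (i + 1 - j) + 1 by omega]
    ring
  omega

/-- Store in register `12` a position, shifted by one, of a neighbour of the second vertex of the
path that is not among the first three vertices, or `0`. -/
def findChord : Program :=
  Instr.const 12 0 ;; .branch (.ne 11 2) (Instr.const 20 1 ;; Instr.load 20 6 20 ;;
    Instr.const 25 3 ;; forNbrs 20 (Instr.load 24 7 23 ;;
      .branch (.lt 25 24) (Instr.copy 12 24) skip)) skip

/-- Array `7` holds positions shifted by one, so an entry greater than `3` means a position of at
least `3`. The program does not look for a chord if no fork was found, since the path may then lack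
a second vertex. -/
theorem WP.findChord {n D u : ℕ} {off nbr : ℕ → ℕ} {σ : Memory} {Q : ℕ → Memory → Prop}
    (hG : AdjLists n off nbr) (hσ : Base n D off nbr σ) (hD : ∀ v < n, deg off v ≤ D)
    (hu : σ.reg 11 ≠ 0 → σ.arr 6 1 = u ∧ u < n)
    (hQ : ∀ l τ, Same [12, 20, 21, 22, 23, 24, 25] [] σ τ →
      (τ.reg 12 = 0 ∧ (σ.reg 11 = 0 ∨ ∀ w, Nbr off nbr u w → σ.arr 7 w ≤ 3) ∨
        σ.reg 11 ≠ 0 ∧ 3 < τ.reg 12 ∧ ∃ w, Nbr off nbr u w ∧ σ.arr 7 w = τ.reg 12) →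
      l ≤ 6 * D + 9 → Q l τ) :
    WP findChord σ Q := by
  refine .instr_seq (.branch (fun hb => ?_) (fun hb => .skip ?_))
  · simp only [Test.Holds, Instr.effect, Memory.setReg_reg, Nat.reduceEqDiff, if_false,
      hσ.zero] at hb
    obtain ⟨hu, hun⟩ := hu hb
    refine .instr_seq (.instr_seq (.instr_seq ?_))
    refine .forNbrs (v := u) (off := off) (nbr := nbr) 3
      (fun i υ => Same [12, 20, 21, 22, 23, 24, 25] [] σ υ ∧ υ.reg 25 = 3 ∧
        (υ.reg 12 = 0 ∧ (∀ w, NbrBefore off nbr u i w → σ.arr 7 w ≤ 3) ∨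
          3 < υ.reg 12 ∧ ∃ w, Nbr off nbr u w ∧ σ.arr 7 w = υ.reg 12))
      (by simp [Instr.effect, hu]) (by simpa [Instr.effect] using hσ.off)
      (by simpa [Instr.effect] using hσ.nbr) (hG.le u hun) ?_ ?_ ?_ ?_
    · exact ⟨(((((Same.refl _ _ _).setReg (by decide) _).setReg (by decide) _).setReg
        (by decide) _).setReg (by decide) _), by simp [Instr.effect],
        .inl ⟨by simp [Instr.effect], fun w hw => absurd hw not_nbrBefore_self⟩⟩
    · rintro i υ r x hr hr' ⟨d1, d2, d3⟩
      have hr : r = 21 ∨ r = 22 ∨ r = 23 := by omega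
      refine ⟨d1.setReg (by simp; omega) _, ?_⟩
      rcases hr with rfl | rfl | rfl <;> simpa using ⟨d2, d3⟩
    · rintro i υ hi hi' ⟨d1, d2, d3⟩ b0 b1 b23
      simp only [Nat.reduceAdd] at b23
      have e7 : υ.arr 7 = σ.arr 7 := d1.arr 7 (by decide)
      have hw : Nbr off nbr u (nbr i) := ⟨i, hi, hi', rfl⟩
      refine .instr_seq (.branch (fun hb => .instr ?_) (fun hb => .skip ?_))
      · simp only [Test.Holds, Instr.effect, Memory.setReg_reg, b23, Nat.reduceEqDiff, if_true,
          if_false, e7, d2] at hb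
        refine ⟨by omega, by simp [Instr.effect, b0], by simp [Instr.effect, b1],
          by simp [Instr.effect], by simp [Instr.effect],
          (d1.setReg (by decide) _).setReg (by decide) _, by simp [Instr.effect, d2], .inr ?_⟩
        simp only [Instr.effect, Memory.setReg_reg, b23, if_true, e7]
        exact ⟨hb, _, hw, rfl⟩
      · simp only [Test.Holds, Instr.effect, Memory.setReg_reg, b23, Nat.reduceEqDiff, if_true,
          if_false, e7, d2] at hb
        refine ⟨by omega, by simp [Instr.effect, b0], by simp [Instr.effect, b1],
          by simp [Instr.effect], by simp [Instr.effect], d1.setReg (by decide) _,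
          by simp [Instr.effect, d2], ?_⟩
        simp only [Instr.effect, Memory.setReg_reg, Nat.reduceEqDiff, if_false]
        refine d3.imp_left fun h => ⟨h.1, fun w hw' => ?_⟩
        rw [nbrBefore_succ hi] at hw'
        rcases hw' with hw' | rfl
        · exact h.2 w hw'
        · omega
    · rintro l υ hl ⟨d1, d2, d3⟩
      refine hQ _ _ d1 ?_ ?_
      · rcases d3 with h | h
        · exact .inl ⟨h.1, .inr h.2⟩
        · exact .inr ⟨hb, h⟩
      · have := hD u hun
        rw [← deg] at hl
        omega
  · simp only [Test.Holds, Instr.effect, Memory.setReg_reg, Nat.reduceEqDiff, if_false,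
      hσ.zero, ne_eq, not_not] at hb
    exact hQ _ _ ((Same.refl _ _ _).setReg (by decide) _)
      (.inl ⟨by simp [Instr.effect], .inl hb⟩) (by omega)

/-- The path is a Hamiltonian cycle of the component, its first vertex is not adjacent to the third
one, and its second one is adjacent to a further vertex: colour the first and the third vertex,
then the others towards the second one. -/
def finishChord : Program :=
  Instr.const 20 0 ;; Instr.load 20 6 20 ;; colour ;; Instr.const 20 2 ;; Instr.load 20 6 20 ;;
    colour ;; Instr.const 13 3 ;; Instr.pred 14 12 ;; colourUp 6 ;; Instr.copy 13 7 ;;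
    Instr.pred 14 12 ;; colourDown 6 ;; Instr.const 20 1 ;; Instr.load 20 6 20 ;; colour

/-- The order is `X 0`, `X 2`, then `X 3, …, X (b - 1)` upwards, then `X (k - 1), …, X b` downwards,
then `X 1`. Ascending vertices have an uncoloured successor and descending ones an uncoloured
predecessor, except `X b`, which has `X 1`. Finally `X 1` sees colour `1` twice. The closing edge of
the cycle is not needed. -/
theorem WP.finishChord {n D b k : ℕ} {off nbr X col : ℕ → ℕ} {Exc : ℕ → Prop} {σ : Memory}
    {Q : ℕ → Memory → Prop}
    (hG : AdjLists n off nbr) (hσ : Base n D off nbr σ) (hD : ∀ v < n, deg off v ≤ D)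
    (h7 : σ.reg 7 = k) (h12 : σ.reg 12 = b + 1) (h6 : σ.arr 6 = X) (h2 : σ.arr 2 = col)
    (hX : ∀ t < k, X t < n) (hinj : ∀ s < k, ∀ t < k, X s = X t → s = t)
    (hadj : ∀ t, t + 1 < k → Nbr off nbr (X t) (X (t + 1)))
    (hcol : GoodColouring n D off nbr Exc col) (hC : ∀ t < k, col (X t) = 0)
    (hC' : ∀ t < k, ∀ w, Nbr off nbr (X t) w → col w = 0)
    (h02 : ¬ Nbr off nbr (X 0) (X 2)) (hb : 3 ≤ b) (hbk : b < k)
    (h1b : Nbr off nbr (X 1) (X b))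
    (hQ : ∀ l τ, Same [3, 13, 14, 20, 21, 22, 23, 24, 25] [2, 3] σ τ → Base n D off nbr τ →
      GoodColouring n D off nbr Exc (τ.arr 2) →
      Recoloured X (fun s => s < k) col (τ.arr 2) → l ≤ 12 * (D + 1) * k + 12 → Q l τ) :
    WP finishChord σ Q := by
  have hadj' : ∀ t, t + 1 < k → Nbr off nbr (X (t + 1)) (X t) := fun t ht =>
    hG.symm _ (hX t (by omega)) _ (hadj t ht)
  have ne : ∀ s < k, ∀ t < k, s ≠ t → X s ≠ X t := fun s hs t ht hst h => hst (hinj s hs t ht h)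
  refine .instr_seq (.instr_seq (.seq ?_))
  refine .colour (n := n) (D := D) (v := X 0) hG (hX 0 (by omega))
    (hσ.same (((Same.refl [20] [] _).setReg (by decide) _).setReg (by decide) _) (by decide)
      (by decide)) (by simp [Instr.effect, h6]) ?_
  intro l₁ σ₁ c hl₁ s1 hf hu1 hB1
  simp only [Instr.effect, Memory.setReg_arr, h2] at hf hu1
  obtain rfl := hf.eq_one (hC' 0 (by omega))
  have g1 := hcol.firstFit hG (hX 0 (by omega)) (hD _ (hX 0 (by omega))) hf
    (.inr (.inr (.inl ⟨X 1, hadj 0 (by omega), hC 1 (by omega)⟩)))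
  have r1 := (Recoloured.refl (X := X) (A := fun _ => False) (by simp) col).update (t := 0)
    one_ne_zero (A' := fun s => s = 0) (by simp)
  have S1 : Same [3, 13, 14, 20, 21, 22, 23, 24, 25] [2, 3] σ σ₁ :=
    (((Same.refl _ _ _).setReg (by decide) _).setReg (by decide) _).trans s1 (by decide) (by decide)
  rw [← hu1] at g1 r1
  have e1 : σ₁.arr 2 (X 0) = 1 := by simp [hu1]
  refine .instr_seq (.instr_seq (.seq ?_))
  refine .colour (n := n) (D := D) (v := X 2) hG (hX 2 (by omega))
    (hB1.same (((Same.refl [20] [] _).setReg (by decide) _).setReg (by decide) _) (by decide)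
      (by decide)) (by simp [Instr.effect, (S1.arr 6 (by decide)).trans h6]) ?_
  intro l₂ σ₂ c hl₂ s2 hf hu2 hB2
  simp only [Instr.effect, Memory.setReg_arr] at hf hu2
  -- `X 0` is the only coloured vertex of the component, and it is not adjacent to `X 2`, so
  -- first-fit gives `1` again.
  obtain rfl := hf.eq_one fun w hw => by
    rw [r1.2 w]
    · exact hC' 2 (by omega) w hw
    · rintro s rfl rfl
      exact h02 (hG.symm _ (hX 2 (by omega)) _ hw)
  have g2 := g1.firstFit hG (hX 2 (by omega)) (hD _ (hX 2 (by omega))) hf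
    (.inr (.inr (.inl ⟨X 1, hadj' 1 (by omega), by
      rw [r1.eq_of_not hinj (by omega) (by omega) (by omega)]
      exact hC 1 (by omega)⟩)))
  have r2 := r1.update (t := 2) one_ne_zero (A' := fun s => s = 0 ∨ s = 2) (fun s => Iff.rfl)
  rw [← hu2] at g2 r2
  have S2 : Same [3, 13, 14, 20, 21, 22, 23, 24, 25] [2, 3] σ σ₂ :=
    ((S1.setReg (by decide) _).setReg (by decide) _).trans s2 (by decide) (by decide)
  have e2 : σ₂.arr 2 (X 0) = 1 ∧ σ₂.arr 2 (X 2) = 1 := by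
    rw [hu2, Function.update_of_ne (ne 0 (by omega) 2 (by omega) (by omega)), e1]
    simp
  refine .instr_seq (.instr_seq (.seq ?_))
  refine .colourUp (n := n) (D := D) (off := off) (nbr := nbr) (X := X) (a := 3) (b := b) hG
    (hB2.same (((Same.refl [13, 14] [] _).setReg (by decide) _).setReg (by decide) _) (by decide)
      (by decide)) (by simp [Instr.effect])
    (by simp [Instr.effect, (S2.reg 12 (by decide)).trans h12]) hb
    (by simpa [Instr.effect] using (S2.arr 6 (by decide)).trans h6) (by decide)
    (fun t _ ht => hX t (by omega))
    (fun t col' => GoodColouring n D off nbr Exc col' ∧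
      Recoloured X (fun s => s = 0 ∨ s = 2 ∨ 3 ≤ s ∧ s < t) col col' ∧
      col' (X 0) = 1 ∧ col' (X 2) = 1) ?_ ?_ ?_
  · exact ⟨g2, r2.congr (by omega), e2⟩
  · rintro t col' c ht ht' ⟨a1, a2, a3, a4⟩ hf
    have hXt := hX t (by omega)
    refine ⟨a1.firstFit hG hXt (hD _ hXt) hf (.inr (.inr (.inl ⟨_, hadj t (by omega), ?_⟩))),
      a2.update (by have := hf.pos; omega) (by omega), ?_, ?_⟩
    · rw [a2.eq_of_not hinj (fun s hs => by omega) (by omega) (by omega)]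
      exact hC _ (by omega)
    · rwa [Function.update_of_ne (ne _ (by omega) _ (by omega) (by omega))]
    · rwa [Function.update_of_ne (ne _ (by omega) _ (by omega) (by omega))]
  intro l₃ σ₃ hl₃ s3 hB3 ⟨g3, r3, e3⟩
  have S3 : Same [3, 13, 14, 20, 21, 22, 23, 24, 25] [2, 3] σ σ₃ :=
    ((S2.setReg (by decide) _).setReg (by decide) _).trans s3 (by decide) (by decide)
  refine .instr_seq (.instr_seq (.seq ?_))
  refine .colourDown (n := n) (D := D) (off := off) (nbr := nbr) (X := X) (a := b) (b := k) hG
    (hB3.same (((Same.refl [13, 14] [] _).setReg (by decide) _).setReg (by decide) _) (by decide)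
      (by decide)) (by simpa [Instr.effect] using (S3.reg 7 (by decide)).trans h7)
    (by simp [Instr.effect, (S3.reg 12 (by decide)).trans h12]) (by omega)
    (by simpa [Instr.effect] using (S3.arr 6 (by decide)).trans h6) (by decide)
    (fun t _ ht => hX t (by omega))
    (fun t col' => GoodColouring n D off nbr Exc col' ∧
      Recoloured X (fun s => s = 0 ∨ s = 2 ∨ 3 ≤ s ∧ s < b ∨ t ≤ s ∧ s < k) col col' ∧
      col' (X 0) = 1 ∧ col' (X 2) = 1) ?_ ?_ ?_
  · exact ⟨g3, r3.congr (by omega), e3⟩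
  · rintro t col' c ht ht' ⟨a1, a2, a3, a4⟩ hf
    have hXt := hX t (by omega)
    refine ⟨a1.firstFit hG hXt (hD _ hXt) hf (.inr (.inr (.inl ?_))),
      a2.update (by have := hf.pos; omega) (by omega), ?_, ?_⟩
    -- For `t = b` the predecessor is already coloured (it may be `X 2`), and the chord to `X 1`
    -- supplies the uncoloured neighbour.
    · rcases ht.lt_or_eq with h | rfl
      · obtain ⟨t, rfl⟩ : ∃ s, t = s + 1 := ⟨t - 1, by omega⟩
        refine ⟨_, hadj' t ht', ?_⟩
        rw [a2.eq_of_not hinj (fun s hs => by omega) (by omega) (by omega)]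
        exact hC _ (by omega)
      · refine ⟨_, hG.symm _ (hX 1 (by omega)) _ h1b, ?_⟩
        rw [a2.eq_of_not hinj (fun s hs => by omega) (by omega) (by omega)]
        exact hC _ (by omega)
    · rwa [Function.update_of_ne (ne _ (by omega) _ (by omega) (by omega))]
    · rwa [Function.update_of_ne (ne _ (by omega) _ (by omega) (by omega))]
  intro l₄ σ₄ hl₄ s4 hB4 ⟨g4, r4, e4, e4'⟩
  have S4 : Same [3, 13, 14, 20, 21, 22, 23, 24, 25] [2, 3] σ σ₄ :=
    ((S3.setReg (by decide) _).setReg (by decide) _).trans s4 (by decide) (by decide)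
  refine .instr_seq (.instr_seq ?_)
  refine .colour (n := n) (D := D) (v := X 1) hG (hX 1 (by omega))
    (hB4.same (((Same.refl [20] [] _).setReg (by decide) _).setReg (by decide) _) (by decide)
      (by decide)) (by simp [Instr.effect, (S4.arr 6 (by decide)).trans h6]) ?_
  intro l₅ σ₅ c hl₅ s5 hf hu5 hB5
  simp only [Instr.effect, Memory.setReg_arr] at hf hu5
  have g5 := g4.firstFit hG (hX 1 (by omega)) (hD _ (hX 1 (by omega))) hf
    (.inr (.inr (.inr ⟨X 0, X 2, hadj' 0 (by omega), hadj 1 (by omega),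
      ne _ (by omega) _ (by omega) (by omega), e4.trans e4'.symm⟩)))
  have r5 := r4.update (t := 1) (by have := hf.pos; omega) (A' := fun s => s < k) (c := c)
    (by omega)
  rw [← hu5] at g5 r5
  refine hQ _ _ (((S4.setReg (by decide) _).setReg (by decide) _).trans s5 (by decide)
    (by decide)) hB5 g5 r5 ?_
  have b1 : cost off X 3 b ≤ (D + 1) * (b - 3) :=
    cost_le fun t _ ht => hD _ (hX t (by omega))
  have b2 : cost off X b k ≤ (D + 1) * (k - b) :=
    cost_le fun t _ ht => hD _ (hX t (by omega))
  have b3 : 12 * (D + 1) * k =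
      12 * ((D + 1) * (b - 3)) + 12 * ((D + 1) * (k - b)) + 36 * (D + 1) := by
    conv_lhs => rw [show k = (b - 3) + (k - b) + 3 by omega]
    ring
  have d0 := hD _ (hX 0 (by omega))
  have d1 := hD _ (hX 1 (by omega))
  have d2 := hD _ (hX 2 (by omega))
  omega

/-- Colour the path from its first to its last vertex. -/
def finishPlain : Program :=
  Instr.const 13 0 ;; Instr.copy 14 7 ;; colourUp 6

/-- On an exceptional component `D + 1` colours are allowed and nothing has to be shown. On an even
cycle first-fit in path order alternates `1, 2, 1, 2, …`, so the last vertex sees the same colour on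
both sides. -/
theorem WP.finishPlain {n D k : ℕ} {off nbr X col : ℕ → ℕ} {Exc : ℕ → Prop} {σ : Memory}
    {Q : ℕ → Memory → Prop}
    (hG : AdjLists n off nbr) (hσ : Base n D off nbr σ) (hD : ∀ v < n, deg off v ≤ D)
    (h7 : σ.reg 7 = k) (h6 : σ.arr 6 = X) (h2 : σ.arr 2 = col)
    (hX : ∀ t < k, X t < n) (hinj : ∀ s < k, ∀ t < k, X s = X t → s = t)
    (hcol : GoodColouring n D off nbr Exc col) (hC : ∀ t < k, col (X t) = 0)
    (hcase : (∀ t < k, Exc (X t)) ∨ 3 ≤ k ∧ k % 2 = 0 ∧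
      ∀ t < k, ∀ w, Nbr off nbr (X t) w ↔ ∃ s < k, w = X s ∧
        (s = t + 1 ∨ s + 1 = t ∨ t = 0 ∧ s + 1 = k ∨ t + 1 = k ∧ s = 0))
    (hQ : ∀ l τ, Same [3, 13, 14, 20, 21, 22, 23, 24, 25] [2, 3] σ τ → Base n D off nbr τ →
      GoodColouring n D off nbr Exc (τ.arr 2) →
      Recoloured X (fun s => s < k) col (τ.arr 2) → l ≤ 12 * (D + 1) * k + 3 → Q l τ) :
    WP finishPlain σ Q := by
  refine .instr_seq (.instr_seq ?_)
  refine .colourUp (n := n) (D := D) (off := off) (nbr := nbr) (X := X) (a := 0) (b := k) hG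
    (hσ.same (((Same.refl [13, 14] [] _).setReg (by decide) _).setReg (by decide) _) (by decide)
      (by decide)) (by simp [Instr.effect]) (by simpa [Instr.effect] using h7) (by omega)
    (by simpa [Instr.effect] using h6) (by decide) (fun t _ ht => hX t ht)
    (fun t col' => GoodColouring n D off nbr Exc col' ∧
      Recoloured X (fun s => s < t) col col' ∧
      -- The pattern is claimed only before the last vertex, because the last one also has the
      -- coloured neighbour `X 0`, and its own colour is not used later.
      ((∀ t < k, Exc (X t)) ∨ ∀ s < t, s + 1 < k → col' (X s) = 1 + s % 2)) ?_ ?_ ?_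
  · simp only [Instr.effect, Memory.setReg_arr, h2]
    exact ⟨hcol, .refl (by simp) _, .inr (by simp)⟩
  · rintro t col' c - ht' ⟨a1, a2, a3⟩ hf
    have hXt := hX t ht'
    have r := a2.update (t := t) (c := c) (by have := hf.pos; omega) (A' := fun s => s < t + 1)
      (by omega)
    by_cases hExc : ∀ t < k, Exc (X t)
    · exact ⟨a1.firstFit hG hXt (hD _ hXt) hf (.inl (hExc t ht')), r, .inl hExc⟩
    obtain ⟨hk3, hk, hnb⟩ := hcase.resolve_left hExc
    replace a3 := a3.resolve_left hExc
    have h0 : ∀ s < k, t ≤ s → col' (X s) = 0 := fun s hs hts => by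
      rw [a2.eq_of_not hinj (by omega) hs (by omega), hC s hs]
    refine ⟨a1.firstFit hG hXt (hD _ hXt) hf (.inr (.inr ?_)), r, .inr ?_⟩
    · by_cases htk : t + 1 < k
      · exact .inl ⟨X (t + 1), (hnb t ht' _).2 ⟨t + 1, htk, rfl, .inl rfl⟩, h0 _ htk (by omega)⟩
      -- Here `t = k - 1` with `k` even, so the positions `t - 1` and `0` are both even and carry
      -- colour `1`.
      · refine .inr ⟨X (t - 1), X 0, (hnb t ht' _).2 ⟨t - 1, by omega, rfl, by omega⟩,
          (hnb t ht' _).2 ⟨0, by omega, rfl, by omega⟩, fun h => ?_, ?_⟩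
        · have := hinj _ (by omega) _ (by omega) h
          omega
        · rw [a3 _ (by omega) (by omega), a3 _ (by omega) (by omega)]
          omega
    · intro s hs hsk
      rcases Nat.lt_succ_iff_lt_or_eq.1 hs with h | rfl
      · rw [Function.update_of_ne]
        · exact a3 s h hsk
        · intro h'
          have := hinj _ (by omega) _ ht' h'
          omega
      rw [Function.update_self]
      have hcol' : ∀ w, Nbr off nbr (X s) w →
          col' w = 0 ∨ 0 < s ∧ w = X (s - 1) ∧ col' w = 1 + (s - 1) % 2 := by
        intro w hw
        obtain ⟨u, hu, rfl, h⟩ := (hnb s ht' w).1 hw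
        rcases h with h | h | h | h
        · exact .inl (h0 u hu (by omega))
        · obtain rfl : u = s - 1 := by omega
          exact .inr ⟨by omega, rfl, a3 _ (by omega) (by omega)⟩
        · exact .inl (h0 u hu (by omega))
        · omega
      have hc1 := hf.pos
      -- The predecessor is the only coloured neighbour, so every colour skipped by first-fit is its
      -- colour. Hence `c` is the other element of `{1, 2}`, and it is `1` for `s = 0`.
      have hmin : ∀ d, 1 ≤ d → d < c → 0 < s ∧ d = 1 + (s - 1) % 2 := by
        intro d hd hd'
        obtain ⟨w, hw, rfl⟩ := hf.min d hd hd'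
        rcases hcol' w hw with h | h
        · omega
        · exact ⟨h.1, h.2.2⟩
      have hne : 0 < s → c ≠ 1 + (s - 1) % 2 := by
        intro hs0 h
        refine hf.ne (X (s - 1)) ((hnb s ht' _).2 ⟨s - 1, by omega, rfl, by omega⟩) ?_
        rw [a3 _ (by omega) (by omega), h]
      by_contra hcon
      rcases Nat.eq_zero_or_pos s with rfl | hs0
      · have := (hmin 1 le_rfl (by omega)).1
        omega
      · have h1 := hne hs0
        have h2 := hmin 1 le_rfl
        have h3 := hmin 2 (by omega)
        omega
  · intro l τ hl s hB ⟨g, r, _⟩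
    refine hQ _ _ ((((Same.refl _ _ _).setReg (by decide) _).setReg (by decide) _).trans s
      (by decide) (by decide)) hB g r ?_
    have b1 : cost off X 0 k ≤ (D + 1) * (k - 0) :=
      cost_le fun t _ ht => hD _ (hX t (by omega))
    have : 12 * (D + 1) * k = 12 * ((D + 1) * (k - 0)) := by
      rw [Nat.sub_zero]
      ring
    omega

end RAM

/-! ### Lassos that exhaust their component -/

/-- `X 0, …, X (k - 1)` is a path starting at `v` whose last vertex has all its neighbours among
`X j, …, X (k - 2)` and is adjacent to `X j`, unless it is isolated. If `found` is not zero, then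
the first and the third vertex are not adjacent, and otherwise all vertices at distance at most two
from `v` are adjacent to `v`. -/
structure Lasso (off nbr : ℕ → ℕ) (dom : ℕ → Prop) (v k j : ℕ) (X p : ℕ → ℕ) (found : ℕ) : Prop
    extends IsPath off nbr dom k X p where
  lt : j < k
  start : X 0 = v
  last : ∀ w, Nbr off nbr (X (k - 1)) w → ∃ s, j ≤ s ∧ s + 1 < k ∧ X s = w
  cyc : j + 1 = k ∨ Nbr off nbr (X (k - 1)) (X j)
  fork : found = 0 ∧ (∀ w, Nbr off nbr v w → ∀ u, Nbr off nbr w u → u = v ∨ Nbr off nbr v u) ∨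
    found ≠ 0 ∧ 3 ≤ k ∧ ¬ Nbr off nbr (X 0) (X 2)

theorem AdjLists.nbr_iff_of_deg_eq_two {n v a b : ℕ} {off nbr : ℕ → ℕ} (hG : AdjLists n off nbr)
    (hv : v < n) (hd : deg off v = 2) (ha : Nbr off nbr v a) (hb : Nbr off nbr v b) (hab : a ≠ b)
    (w : ℕ) : Nbr off nbr v w ↔ w = a ∨ w = b := by
  have h1 : ({a, b} : Finset ℕ) ⊆ nbrs off nbr v := by
    intro x hx
    rcases Finset.mem_insert.1 hx with rfl | hx
    · exact mem_nbrs.2 ha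
    · rw [Finset.mem_singleton.1 hx]
      exact mem_nbrs.2 hb
  have h2 := Finset.eq_of_subset_of_card_le h1 (by
    rw [hG.card v hv, hd, Finset.card_pair hab])
  rw [← mem_nbrs, ← h2]
  simp

/-- In a regular graph, a path of the form `Lasso` that is closed under adjacency and whose second
vertex has no neighbour behind the third one is exceptional or an even cycle. -/
theorem Lasso.exc_or_even {n D v k : ℕ} {off nbr X p : ℕ → ℕ} {dom Exc : ℕ → Prop} {found : ℕ}
    (hG : AdjLists n off nbr) (hE : ExcSpec n D off nbr Exc)
    (hdom : ∀ v, dom v → v < n ∧ deg off v = D ∧ ∀ w, Nbr off nbr v w → dom w)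
    (h : Lasso off nbr dom v k 0 X p found)
    (hcl : ∀ t < k, ∀ w, Nbr off nbr (X t) w → ∃ s < k, X s = w)
    (hch : found = 0 ∨ ∀ w, Nbr off nbr (X 1) w → p w ≤ 3) :
    (∀ t < k, Exc (X t)) ∨ 3 ≤ k ∧ k % 2 = 0 ∧
      ∀ t < k, ∀ w, Nbr off nbr (X t) w ↔ ∃ s < k, w = X s ∧
        (s = t + 1 ∨ s + 1 = t ∨ t = 0 ∧ s + 1 = k ∨ t + 1 = k ∧ s = 0) := by
  have hk := h.lt
  have hdX : ∀ t < k, dom (X t) := fun t ht => (h.mem t ht).1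
  have hX : ∀ t < k, X t < n := fun t ht => (hdom _ (hdX t ht)).1
  have hinj : ∀ s < k, ∀ t < k, X s = X t → s = t := fun s hs t ht => h.inj hs ht
  have hadj' : ∀ t, t + 1 < k → Nbr off nbr (X (t + 1)) (X t) := fun t ht =>
    hG.symm _ (hX t (by omega)) _ (h.adj t ht)
  have all : Exc (X 0) → ∀ t < k, Exc (X t) := by
    intro h0 t
    induction t with
    | zero => exact fun _ => h0
    | succ t ih => exact fun ht => hE.closed _ (hX t (by omega)) _ (h.adj t ht) (ih (by omega))
  rcases h.fork with ⟨-, hf⟩ | ⟨hf, hk3, h02⟩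
  · refine .inl (all ?_)
    rw [h.start]
    have hv := hdX 0 hk
    rw [h.start] at hv
    exact hE.complete v (hdom v hv).1 (hdom v hv).2.1
      (fun w hw => (hdom w ((hdom v hv).2.2 w hw)).2.1) hf
  -- With a fork but no chord at `X 1`, the neighbours of `X 1` are exactly `X 0` and `X 2`;
  -- regularity carries the degree two to the whole graph on `dom`.
  have hD2 : D = 2 := by
    have h1 : nbrs off nbr (X 1) = {X 0, X 2} := by
      ext w
      rw [mem_nbrs, Finset.mem_insert, Finset.mem_singleton]
      constructor
      · intro hw
        have h3 := hch.resolve_left hf w hw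
        obtain ⟨s, hs, rfl⟩ := hcl 1 (by omega) w hw
        rw [(h.mem s hs).2] at h3
        have : s ≠ 1 := by
          rintro rfl
          exact hG.irrefl _ (hX 1 hs) hw
        have hs2 : s ≤ 2 := by omega
        interval_cases s
        · exact .inl rfl
        · omega
        · exact .inr rfl
      · rintro (rfl | rfl)
        · exact hadj' 0 (by omega)
        · exact h.adj 1 (by omega)
    have h2 := hG.card _ (hX 1 (by omega))
    rw [(hdom _ (hdX 1 (by omega))).2.1, h1, Finset.card_pair] at h2
    · exact h2.symm
    · intro h3
      have := hinj _ (by omega) _ (by omega) h3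
      omega
  have hd : ∀ t < k, deg off (X t) = 2 := fun t ht => (hdom _ (hdX t ht)).2.1.trans hD2
  have hlast : Nbr off nbr (X (k - 1)) (X 0) := h.cyc.resolve_left (by omega)
  have ne : ∀ s < k, ∀ t < k, s ≠ t → X s ≠ X t := fun s hs t ht hst h => hst (hinj s hs t ht h)
  -- Each vertex has degree two, so two distinct neighbours on the cycle are all of its neighbours.
  -- The three uses are the first vertex, an inner vertex and the last vertex.
  have two : ∀ t < k, ∀ a < k, ∀ b < k, a ≠ b → Nbr off nbr (X t) (X a) → Nbr off nbr (X t) (X b) →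
      (∀ s < k, (s = a ∨ s = b ↔
        (s = t + 1 ∨ s + 1 = t ∨ t = 0 ∧ s + 1 = k ∨ t + 1 = k ∧ s = 0))) →
      ∀ w, Nbr off nbr (X t) w ↔ ∃ s < k, w = X s ∧
        (s = t + 1 ∨ s + 1 = t ∨ t = 0 ∧ s + 1 = k ∨ t + 1 = k ∧ s = 0) := by
    intro t ht a ha b hb hab hta htb hs w
    rw [hG.nbr_iff_of_deg_eq_two (hX t ht) (hd t ht) hta htb (ne a ha b hb hab)]
    constructor
    · rintro (rfl | rfl)
      · exact ⟨a, ha, rfl, (hs a ha).1 (.inl rfl)⟩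
      · exact ⟨b, hb, rfl, (hs b hb).1 (.inr rfl)⟩
    · rintro ⟨s, hs', rfl, h⟩
      rcases (hs s hs').2 h with rfl | rfl
      · exact .inl rfl
      · exact .inr rfl
  have hnb : ∀ t < k, ∀ w, Nbr off nbr (X t) w ↔ ∃ s < k, w = X s ∧
      (s = t + 1 ∨ s + 1 = t ∨ t = 0 ∧ s + 1 = k ∨ t + 1 = k ∧ s = 0) := by
    intro t ht
    rcases Nat.eq_zero_or_pos t with rfl | ht0
    · exact two 0 ht 1 (by omega) (k - 1) (by omega) (by omega) (h.adj 0 (by omega))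
        (hG.symm _ (hX _ (by omega)) _ hlast) (by omega)
    · obtain ⟨t, rfl⟩ : ∃ s, t = s + 1 := ⟨t - 1, by omega⟩
      by_cases htk : t + 2 < k
      · exact two _ ht t (by omega) (t + 2) htk (by omega) (hadj' t ht) (h.adj _ htk) (by omega)
      · obtain rfl : k = t + 2 := by omega
        exact two _ ht t (by omega) 0 (by omega) (by omega) (hadj' t ht) hlast (by omega)
  rcases Nat.mod_two_eq_zero_or_one k with he | ho
  · exact .inr ⟨hk3, he, hnb⟩
  · exact .inl (all (hE.cycle k X hk3 ho (fun t ht => ⟨hX t ht, (hdom _ (hdX t ht)).2.1⟩) hinj hnb))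

/-- The vertices that are listed in the second list, but not in the first one. -/
theorem Listing.card_le {n m m' : ℕ} {X p X' p' : ℕ → ℕ} (h : Listing (· < n) m X p)
    (h' : Listing (· < n) m' X' p') (hX : ∀ t < m, X' t = X t) {S : Finset ℕ}
    (hS : ∀ u ∈ S, u < n ∧ p u = 0 ∧ p' u ≠ 0) : S.card ≤ m' - m := by
  have : S ⊆ (Finset.Ico m m').image X' := by
    intro u hu
    obtain ⟨h1, h2, h3⟩ := hS u hu
    obtain ⟨t, ht, rfl⟩ := h'.exists_of_ne h1 h3
    refine Finset.mem_image_of_mem _ (Finset.mem_Ico.2 ⟨?_, ht⟩)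
    by_contra hcon
    push Not at hcon
    rw [hX t hcon, (h.mem t hcon).2] at h2
    omega
  simpa using (Finset.card_le_card this).trans Finset.card_image_le

/-! ### Colouring one regular component -/

namespace RAM

/-- Find a path of the form `Lasso` that starts at the vertex in register `6`. -/
def buildPath : Program :=
  findFork ;; Instr.copy 11 9 ;; Instr.const 7 0 ;;
    .branch (.eq 9 2) (Instr.succ 9 6) (Instr.store 6 7 6 ;; Instr.succ 7 7 ;; Instr.store 7 6 7 ;;
      Instr.store 6 7 10 ;; Instr.succ 7 7 ;; Instr.store 7 10 7) ;; walk ;; firstReturn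

theorem WP.buildPath {n D v : ℕ} {off nbr : ℕ → ℕ} {dom : ℕ → Prop} {σ : Memory}
    {Q : ℕ → Memory → Prop}
    (hG : AdjLists n off nbr) (hσ : Base n D off nbr σ) (hD : ∀ v < n, deg off v ≤ D)
    (hdom : ∀ v, dom v → v < n ∧ ∀ w, Nbr off nbr v w → dom w)
    (h6 : σ.reg 6 = v) (hv : dom v) (hp : ∀ u, dom u → σ.arr 7 u = 0)
    (hQ : ∀ l τ k j, Same [3, 7, 8, 9, 10, 11, 20, 21, 22, 23, 24, 30, 31, 32, 33] [3, 6, 7] σ τ →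
      Base n D off nbr τ → τ.reg 7 = k → τ.reg 8 = j →
      Lasso off nbr dom v k j (τ.arr 6) (τ.arr 7) (τ.reg 11) →
      l ≤ 22 * (D + 1) * (D + 1) + 10 * (D + 1) * k + 7 * (D + 1) + 12 → Q l τ) :
    WP buildPath σ Q := by
  have hvn := (hdom v hv).1
  set S := [3, 7, 8, 9, 10, 11, 20, 21, 22, 23, 24, 30, 31, 32, 33]
  refine .seq (.findFork hG hσ hD h6 hvn fun l₁ τ hl₁ s1 hB1 hF => ?_)
  have S1 : Same S [3, 6, 7] σ τ := s1.mono (by decide) (by decide)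
  have e6 : τ.reg 6 = v := (S1.reg 6 (by decide)).trans h6
  have hp1 : ∀ u, dom u → τ.arr 7 u = 0 := by
    rw [s1.arr 7 (by decide)]
    exact hp
  -- The common end of both branches: the walk starts with `x = v` on the empty path if there is no
  -- fork, and with `x = y` on the path of the first two vertices of the fork otherwise.
  have finish : ∀ (υ : Memory) (l : ℕ) (k x : ℕ), Same S [3, 6, 7] σ υ → Base n D off nbr υ →
      υ.reg 7 = k → υ.reg 9 = x + 1 → IsPath off nbr dom k (υ.arr 6) (υ.arr 7) → dom x →
      υ.arr 7 x = 0 → (0 < k → Nbr off nbr (υ.arr 6 (k - 1)) x) →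
      (∀ (X : ℕ → ℕ) (m : ℕ), k < m → (∀ t < k, X t = υ.arr 6 t) → X k = x → X 0 = v ∧
        (υ.reg 11 = 0 ∧
          (∀ w, Nbr off nbr v w → ∀ u, Nbr off nbr w u → u = v ∨ Nbr off nbr v u) ∨
        υ.reg 11 ≠ 0 ∧ 3 ≤ m ∧ ¬ Nbr off nbr (X 0) (X 2))) →
      l ≤ 22 * (D + 1) * (D + 1) + 10 → WP (RAM.walk ;; RAM.firstReturn) υ fun l' υ => Q (l + l') υ := by
    intro υ l k x s2 hB2 e7 e9 hP hx hpx hkx hX hl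
    refine .seq (.walk hG hB2 hD hdom e7 e9 hP hx hpx hkx ?_)
    intro l₂ ω m s3 f7 hkm hP' hX' hk' hlast hl₂
    have hB3 := hB2.same s3 (by decide) (by decide)
    have hm := (hP'.mem (m - 1) (by omega)).1
    refine .firstReturn hG hB3 hD f7 (by omega) rfl (hdom _ hm).1 hlast ?_
    intro l₃ ψ j s4 f8 hj hmin hat hl₃
    have hB4 := hB3.same s4 (by decide) (by decide)
    obtain ⟨hX0, hfork⟩ := hX _ m hkm hX' hk'
    have g6 : ψ.arr 6 = ω.arr 6 := s4.arr 6 (by decide)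
    have g7 : ψ.arr 7 = ω.arr 7 := s4.arr 7 (by decide)
    have g11 : ψ.reg 11 = υ.reg 11 := (s4.reg 11 (by decide)).trans (s3.reg 11 (by decide))
    refine hQ _ _ m j ((s2.trans s3 (by decide) (by decide)).trans s4 (by decide) (by decide)) hB4
      ((s4.reg 7 (by decide)).trans f7) f8 ?_ ?_
    · rw [g6, g7, g11]
      refine ⟨hP', hj, hX0, ?_, ?_, hfork⟩
      · intro w hw
        have h1 := hP'.ex w ((hdom _ hm).2 w hw) (hlast w hw)
        have h2 := hmin w hw
        refine ⟨ω.arr 7 w - 1, by omega, ?_, h1.2⟩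
        -- Such a neighbour is not the last vertex itself, since there are no loops.
        by_contra hcon
        have h3 : ω.arr 7 w - 1 = m - 1 := by omega
        rw [← h1.2, h3] at hw
        exact hG.irrefl _ (hdom _ hm).1 hw
      · rcases hat with h | ⟨w, hw, h⟩
        · exact .inl h
        · have h1 := hP'.ex w ((hdom _ hm).2 w hw) (hlast w hw)
          rw [h, Nat.add_sub_cancel] at h1
          exact .inr (h1.2 ▸ hw)
    · have : 10 * (D + 1) * (m - k) ≤ 10 * (D + 1) * m := Nat.mul_le_mul_left _ (by omega)
      omega
  refine .instr_seq (.instr_seq (.seq (.branch (fun hb => .instr ?_) (fun hb => .instr_seq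
    (.instr_seq (.instr_seq (.instr_seq (.instr_seq (.instr ?_)))))))))
  · have hb0 : τ.reg 9 = 0 := by
      simpa [Test.Holds, Instr.effect, hB1.zero] using hb
    refine (finish _ (l₁ + 4) 0 v (((S1.setReg (by decide) _).setReg (by decide) _).setReg
      (by decide) _)
      (hB1.same ((((Same.refl [7, 9, 11] [] _).setReg (by decide) _).setReg (by decide) _).setReg
        (by decide) _) (by decide) (by decide))
      (by simp [Instr.effect]) (by simp [Instr.effect, e6])
      ⟨⟨by simp, fun u hu h => absurd (hp1 u hu) (by simpa [Instr.effect] using h)⟩, by simp⟩ hv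
      (by simpa [Instr.effect] using hp1 v hv) (by simp) ?_ (by omega)).mono ?_
    · intro X m _ _ hX
      refine ⟨hX, .inl ⟨by simp [Instr.effect, hb0], ?_⟩⟩
      rcases hF with ⟨-, h⟩ | ⟨y, h, -⟩
      · exact fun w hw u hu => h w u ⟨hw, hu⟩
      · omega
    · intro k ω h
      convert h using 1
      omega
  · have hb0 : τ.reg 9 ≠ 0 := by
      simpa [Test.Holds, Instr.effect, hB1.zero] using hb
    obtain ⟨y, f9, f1, f2, f3, f4⟩ := hF.resolve_left fun h => hb0 h.1
    set x := τ.reg 10 with hxdef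
    have hvx : x ≠ v := fun h => hG.irrefl v hvn (h ▸ f1)
    have hxd := (hdom v hv).2 x f1
    have hyd := (hdom x hxd).2 y f2
    have hyx : y ≠ x := fun h => f4 (h ▸ f1)
    have hP0 : IsPath off nbr dom 0 (τ.arr 6) (τ.arr 7) :=
      ⟨⟨by simp, fun u hu h => absurd (hp1 u hu) h⟩, by simp⟩
    have hP1 := hP0.push hv (hp1 v hv) (by simp)
    have hP2 := hP1.push hxd (by rw [Function.update_of_ne hvx]; exact hp1 x hxd) (by simpa using f1)
    refine (finish _ (l₁ + 9) 2 y
      (((((((((S1.setReg (by decide) _).setReg (by decide) _).setArr (by decide) _ _).setReg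
        (by decide) _).setArr (by decide) _ _).setArr (by decide) _ _).setReg (by decide) _).setArr
        (by decide) _ _))
      (hB1.same (rs := [7, 11]) (as := [6, 7])
        ((((((((Same.refl _ _ _).setReg (by decide) _).setReg (by decide) _).setArr
        (by decide) _ _).setReg (by decide) _).setArr (by decide) _ _).setArr (by decide) _ _).setReg
        (by decide) _ |>.setArr (by decide) _ _) (by decide) (by decide))
      (by simp [Instr.effect]) (by simp [Instr.effect, f9])
      (by simpa [Instr.effect, e6, ← hxdef] using hP2) hyd
      ?_ (by simpa [Instr.effect, ← hxdef] using f2) ?_ (by omega)).mono ?_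
    · simp [Instr.effect, e6, ← hxdef, hyx, f3, hp1 y hyd]
    · intro X m hm hX hX2
      have hX0 : X 0 = v := by
        rw [hX 0 (by omega)]
        simp [Instr.effect, e6]
      refine ⟨hX0, .inr ⟨by simp [Instr.effect, f9], hm, ?_⟩⟩
      rw [hX0, hX2]
      exact f4
    · intro k ω h
      convert h using 1
      omega

/-- The loop invariant of the main loop: the vertices with a positive entry in array `4` are
coloured; they form a union of components that contains all vertices of degree less than `D`. -/
structure Stage (n D : ℕ) (off nbr : ℕ → ℕ) (Exc : ℕ → Prop) (σ : Memory) : Prop where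
  base : Base n D off nbr σ
  listing : Listing (· < n) (σ.reg 5) (σ.arr 5) (σ.arr 4)
  eq : σ.reg 4 = σ.reg 5
  closed : ∀ t < σ.reg 5, ∀ w, Nbr off nbr (σ.arr 5 t) w → σ.arr 4 w ≠ 0
  good : GoodColouring n D off nbr Exc (σ.arr 2)
  col_iff : ∀ v < n, σ.arr 2 v ≠ 0 ↔ σ.arr 4 v ≠ 0
  regular : ∀ v < n, σ.arr 4 v = 0 → deg off v = D
  pos : ∀ v < n, σ.arr 4 v = 0 → σ.arr 7 v = 0

/-- Put the cycle in the queue, search the component, and colour it, except for the cycle, towards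
the cycle. -/
def colourOutside : Program :=
  seed ;; search ;; Instr.copy 13 5 ;; colourDown 5

/-- The cycle occupies the queue positions from `m` to `m + (k - j) - 1` and serves as the root set
of the search. Colouring backwards stops just before it, so that every vertex outside the cycle
still has its parent uncoloured when it is treated. -/
theorem WP.colourOutside {n D m j k : ℕ} {off nbr X : ℕ → ℕ} {Exc : ℕ → Prop} {σ : Memory}
    {Q : ℕ → Memory → Prop}
    (hG : AdjLists n off nbr) (hσ : Base n D off nbr σ) (hD : ∀ v < n, deg off v ≤ D)
    (h4 : σ.reg 4 = m) (h5 : σ.reg 5 = m) (h7 : σ.reg 7 = k) (h8 : σ.reg 8 = j) (hjk : j < k)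
    (h6 : σ.arr 6 = X) (hX : ∀ t < k, X t < n ∧ σ.arr 4 (X t) = 0)
    (hinj : ∀ s < k, ∀ t < k, X s = X t → s = t)
    (hL : Listing (· < n) m (σ.arr 5) (σ.arr 4))
    (hcl : ∀ t < m, ∀ w, Nbr off nbr (σ.arr 5 t) w → σ.arr 4 w ≠ 0)
    (hgood : GoodColouring n D off nbr Exc (σ.arr 2))
    (hcol : ∀ v < n, σ.arr 2 v ≠ 0 ↔ σ.arr 4 v ≠ 0)
    (hQ : ∀ l τ m', Same [3, 4, 5, 13, 14, 20, 21, 22, 23, 24, 25] [2, 3, 4, 5] σ τ →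
      Base n D off nbr τ → τ.reg 4 = m' → τ.reg 5 = m' →
      Listing (· < n) m' (τ.arr 5) (τ.arr 4) → (∀ t < m, τ.arr 5 t = σ.arr 5 t) →
      m + (k - j) ≤ m' →
      (∀ t < m', ∀ w, Nbr off nbr (τ.arr 5 t) w → τ.arr 4 w ≠ 0) →
      (∀ t, j ≤ t → t < k → τ.arr 4 (X t) ≠ 0) →
      GoodColouring n D off nbr Exc (τ.arr 2) →
      (∀ u < n, τ.arr 2 u ≠ 0 ↔ τ.arr 4 u ≠ 0 ∧ ∀ t, j ≤ t → t < k → X t ≠ u) →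
      l ≤ 40 * (D + 1) * (m' - m) → Q l τ) :
    WP colourOutside σ Q := by
  set S := [3, 4, 5, 13, 14, 20, 21, 22, 23, 24, 25]
  refine .seq (.seed h5 h7 h8 hjk.le h6 hX hinj hL ?_)
  intro l₁ τ s1 e5 e14 hL1 hQ1 hX1 hl₁
  set m₁ := m + (k - j) with hm₁
  have hB1 := hσ.same s1 (by decide) (by decide)
  refine .seq (.search (a := m) hG hB1 ((s1.reg 4 (by decide)).trans h4) e5 (by omega) hL1 ?_ ?_)
  · intro t ht w hw
    rw [hQ1 t ht] at hw
    have hwn := hG.lt _ (hL.mem t ht).1 w hw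
    obtain ⟨s, hs, rfl⟩ := hL.exists_of_ne hwn (hcl t ht w hw)
    rw [← hQ1 s hs, (hL1.mem s (by omega)).2]
    omega
  intro l₂ υ s2 hm' e45 hL2 hcl2 hQ2 hpar hl₂
  set m' := υ.reg 5 with hm'def
  have hB2 := hB1.same s2 (by decide) (by decide)
  have hQ3 : ∀ t < m, υ.arr 5 t = σ.arr 5 t := fun t ht => (hQ2 t (by omega)).trans (hQ1 t ht)
  have hX3 : ∀ t, j ≤ t → t < k → υ.arr 5 (m + (t - j)) = X t := fun t ht ht' =>
    (hQ2 _ (by omega)).trans (hX1 t ht ht')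
  have e2 : υ.arr 2 = σ.arr 2 := (s2.arr 2 (by decide)).trans (s1.arr 2 (by decide))
  have hY : ∀ t < m', υ.arr 5 t < n := fun t ht => (hL2.mem t ht).1
  have hinj2 : ∀ s < m', ∀ t < m', υ.arr 5 s = υ.arr 5 t → s = t := fun s hs t ht => hL2.inj hs ht
  have hnew : ∀ t, m ≤ t → t < m' → σ.arr 4 (υ.arr 5 t) = 0 := by
    intro t ht ht'
    by_contra h
    obtain ⟨s, hs, h'⟩ := hL.exists_of_ne (hY t ht') h
    rw [← hQ3 s hs] at h'
    have := hL2.inj (by omega) ht' h'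
    omega
  have hnew' : ∀ t, m ≤ t → t < m' → σ.arr 2 (υ.arr 5 t) = 0 := by
    intro t ht ht'
    by_contra h
    exact (hcol _ (hY t ht')).1 h (hnew t ht ht')
  refine .instr_seq ?_
  refine .colourDown (n := n) (D := D) (off := off) (nbr := nbr) (X := υ.arr 5) (a := m₁) (b := m')
    hG (hB2.same ((Same.refl [13] [] _).setReg (by decide) _) (by decide) (by decide))
    (by simp [Instr.effect, hm'def])
    (by simpa [Instr.effect] using (s2.reg 14 (by decide)).trans e14) hm' (by simp [Instr.effect])
    (by decide) (fun t _ ht => hY t ht)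
    (fun t col' => GoodColouring n D off nbr Exc col' ∧
      Recoloured (υ.arr 5) (fun s => t ≤ s ∧ s < m') (σ.arr 2) col') ?_ ?_ ?_
  · simp only [Instr.effect, Memory.setReg_arr, e2]
    exact ⟨hgood, .refl (by omega) _⟩
  · rintro t col' c ht ht' ⟨a1, a2⟩ hf
    have hYt := hY t ht'
    refine ⟨a1.firstFit hG hYt (hD _ hYt) hf (.inr (.inr (.inl ?_))),
      a2.update (by have := hf.pos; omega) (by omega)⟩
    obtain ⟨s, hs, hadj⟩ := hpar t ht ht'
    refine ⟨_, hadj, ?_⟩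
    rw [a2.eq_of_not hinj2 (by omega) (by omega) (by omega)]
    -- The parent belongs to the new part of the queue: the old part is closed under adjacency and
    -- would otherwise contain the vertex itself.
    refine hnew' s ?_ (by omega)
    by_contra hsm
    have := hcl s (by omega) (υ.arr 5 t) (by
      rw [← hQ3 s (by omega)]
      exact hG.symm _ hYt _ hadj)
    exact this (hnew t (by omega) ht')
  intro l₃ ω hl₃ s3 hB3 ⟨g, r⟩
  have f4 : ω.arr 4 = υ.arr 4 := s3.arr 4 (by decide)
  have f5 : ω.arr 5 = υ.arr 5 := s3.arr 5 (by decide)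
  have f5' : ω.reg 5 = m' := s3.reg 5 (by decide)
  refine hQ _ _ m' (((((s1.mono (by decide) (by decide)).trans s2 (by decide) (by decide)).setReg
    (by decide) _).trans s3 (by decide) (by decide))) hB3
    ((s3.reg 4 (by decide)).trans (by simpa [Instr.effect] using e45)) f5'
    (by rwa [f4, f5]) (by rwa [f5]) hm' (by rwa [f4, f5]) ?_ g ?_ ?_
  · intro t ht ht'
    rw [f4, ← hX3 t ht ht', (hL2.mem _ (by omega)).2]
    omega
  · intro u hu
    rw [f4]
    constructor
    · intro h
      by_cases hA : ∃ s, (m₁ ≤ s ∧ s < m') ∧ υ.arr 5 s = u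
      · obtain ⟨s, hs, rfl⟩ := hA
        refine ⟨by rw [(hL2.mem s hs.2).2]; omega, fun t ht ht' h' => ?_⟩
        rw [← hX3 t ht ht'] at h'
        have := hL2.inj (by omega) hs.2 h'
        omega
      · push Not at hA
        rw [r.2 u hA, hcol u hu] at h
        obtain ⟨s, hs, rfl⟩ := hL.exists_of_ne hu h
        rw [← hQ3 s hs]
        refine ⟨by rw [(hL2.mem s (by omega)).2]; omega, fun t ht ht' h' => ?_⟩
        rw [← hX3 t ht ht'] at h'
        have := hL2.inj (by omega) (by omega) h'
        omega
    · rintro ⟨h, h'⟩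
      obtain ⟨s, hs, rfl⟩ := hL2.exists_of_ne hu h
      by_cases h1 : m₁ ≤ s
      · exact r.1 s ⟨h1, hs⟩
      by_cases h2 : m ≤ s
      · refine absurd ?_ (h' (s - m + j) (by omega) (by omega))
        rw [← hX3 _ (by omega) (by omega)]
        congr 1
        omega
      · rw [r.eq_of_not hinj2 (by omega) hs (by omega), hcol _ hu, hQ3 s (by omega),
          (hL.mem s (by omega)).2]
        omega
  · have b1 : cost off (υ.arr 5) m m' ≤ (D + 1) * (m' - m) :=
      cost_le fun t _ ht => hD _ (hY t ht)
    have b2 : cost off (υ.arr 5) m₁ m' ≤ (D + 1) * (m' - m₁) :=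
      cost_le fun t _ ht => hD _ (hY t ht)
    have b3 : (D + 1) * (m' - m₁) ≤ (D + 1) * (m' - m) := Nat.mul_le_mul_left _ (by omega)
    have b4 : m' - m ≤ (D + 1) * (m' - m) := Nat.le_mul_of_pos_left _ (by omega)
    have b5 : 40 * (D + 1) * (m' - m) = 40 * ((D + 1) * (m' - m)) := by ring
    omega

/-- Colour the cycle. -/
def finish : Program :=
  scan ;; .branch (.ne 12 2) finishCycle
    (findChord ;; .branch (.ne 12 2) finishChord finishPlain)

/-- If no vertex of the cycle has a coloured neighbour, then the cycle is closed under adjacency,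
because everything else in its component has been coloured. The lasso is then a Hamiltonian cycle of
the component, or a single vertex. -/
theorem WP.finish {n D v j k : ℕ} {off nbr : ℕ → ℕ} {dom Exc : ℕ → Prop} {σ : Memory}
    {Q : ℕ → Memory → Prop}
    (hG : AdjLists n off nbr) (hσ : Base n D off nbr σ) (hD : ∀ v < n, deg off v ≤ D)
    (hE : ExcSpec n D off nbr Exc)
    (hdom : ∀ v, dom v → v < n ∧ deg off v = D ∧ ∀ w, Nbr off nbr v w → dom w)
    (h7 : σ.reg 7 = k) (h8 : σ.reg 8 = j)
    (hX : Lasso off nbr dom v k j (σ.arr 6) (σ.arr 7) (σ.reg 11))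
    (hcl : ∀ u < n, σ.arr 4 u ≠ 0 → ∀ w, Nbr off nbr u w → σ.arr 4 w ≠ 0)
    (hvis : ∀ t, j ≤ t → t < k → σ.arr 4 (σ.arr 6 t) ≠ 0)
    (hgood : GoodColouring n D off nbr Exc (σ.arr 2))
    (hcol : ∀ u < n, σ.arr 2 u ≠ 0 ↔ σ.arr 4 u ≠ 0 ∧ ∀ t, j ≤ t → t < k → σ.arr 6 t ≠ u)
    (hQ : ∀ l τ, Same [3, 10, 12, 13, 14, 20, 21, 22, 23, 24, 25] [2, 3] σ τ →
      Base n D off nbr τ → GoodColouring n D off nbr Exc (τ.arr 2) →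
      (∀ u < n, τ.arr 2 u ≠ 0 ↔ σ.arr 4 u ≠ 0) → l ≤ 60 * (D + 1) * (k - j) → Q l τ) :
    WP finish σ Q := by
  set X := σ.arr 6
  have hjk := hX.lt
  have hdX : ∀ t < k, dom (X t) := fun t ht => (hX.mem t ht).1
  have hXn : ∀ t < k, X t < n := fun t ht => (hdom _ (hdX t ht)).1
  have hinj : ∀ s < k, ∀ t < k, X s = X t → s = t := fun s hs t ht => hX.inj hs ht
  have hC : ∀ t, j ≤ t → t < k → σ.arr 2 (X t) = 0 := by
    intro t ht ht'
    by_contra h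
    exact ((hcol _ (hXn t ht')).1 h).2 t ht ht' rfl
  have post : ∀ col', Recoloured X (fun s => j ≤ s ∧ s < k) (σ.arr 2) col' →
      ∀ u < n, col' u ≠ 0 ↔ σ.arr 4 u ≠ 0 := by
    intro col' r u hu
    by_cases hA : ∃ s, (j ≤ s ∧ s < k) ∧ X s = u
    · obtain ⟨s, hs, rfl⟩ := hA
      exact iff_of_true (r.1 s hs) (hvis s hs.1 hs.2)
    · push Not at hA
      rw [r.2 u hA, hcol u hu]
      exact and_iff_left fun t ht ht' => hA t ⟨ht, ht'⟩
  have hb4 : D + 1 ≤ (D + 1) * (k - j) := Nat.le_mul_of_pos_right _ (by omega)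
  have hb5 : ∀ a : ℕ, a * (D + 1) * (k - j) = a * ((D + 1) * (k - j)) := fun a => mul_assoc _ _ _
  have hb6 : 60 * (D + 1) * (k - j) = 60 * ((D + 1) * (k - j)) := hb5 60
  have hb7 : 12 * (D + 1) * (k - j) = 12 * ((D + 1) * (k - j)) := hb5 12
  have hb8 : 7 * (D + 1) * (k - j) = 7 * ((D + 1) * (k - j)) := hb5 7
  refine .seq (.scan (X := X) hG hσ hD h7 h8 hjk.le rfl rfl hXn ?_)
  intro l₁ τ s1 hS hl₁
  have hB1 := hσ.same s1 (by decide) (by decide)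
  have e2 : τ.arr 2 = σ.arr 2 := s1.arr 2 (by decide)
  have e6 : τ.arr 6 = X := s1.arr 6 (by decide)
  have e7 : τ.reg 7 = k := (s1.reg 7 (by decide)).trans h7
  have e8 : τ.reg 8 = j := (s1.reg 8 (by decide)).trans h8
  have e7' : τ.arr 7 = σ.arr 7 := s1.arr 7 (by decide)
  have e11 : τ.reg 11 = σ.reg 11 := s1.reg 11 (by decide)
  have S1 : Same [3, 10, 12, 13, 14, 20, 21, 22, 23, 24, 25] [2, 3] σ τ :=
    s1.mono (by decide) (by decide)
  refine .branch (fun hb => ?_) (fun hb => ?_)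
  · simp only [Test.Holds, hB1.zero] at hb
    obtain ⟨i, f1, f2, f3, f4, f5, f6⟩ := hS.resolve_left fun h => hb h.1
    -- The last vertex has all its neighbours on the cycle, and these are uncoloured.
    have hik : i + 1 < k := by
      by_contra h
      obtain rfl : i = k - 1 := by omega
      obtain ⟨s, hs, hs', h⟩ := hX.last _ f4
      rw [← h] at f5
      exact f5 (hC s hs (by omega))
    refine .finishCycle (X := X) hG hB1 hD hE e7 e8 f1 rfl e6 e2 hXn hinj hX.adj
      (hX.cyc.resolve_left (by omega)) f2 hik hgood hC f4 f5
      (fun w hw => f6 (i + 1) w (by omega) ⟨by omega, hik, hw⟩) ?_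
    intro l₂ υ s2 hB2 g r hl₂
    exact hQ _ _ (S1.trans s2 (by decide) (by decide)) hB2 g (post _ r) (by omega)
  · simp only [Test.Holds, hB1.zero, ne_eq, not_not] at hb
    have hS : ∀ t, j ≤ t → t < k → ∀ w, Nbr off nbr (X t) w → σ.arr 2 w = 0 := by
      rcases hS with h | ⟨i, h, -⟩
      · exact fun t h1 h2 w hw => h.2 t w ⟨h1, h2, hw⟩
      · omega
    have hcl' : ∀ t, j ≤ t → t < k → ∀ w, Nbr off nbr (X t) w → ∃ s, j ≤ s ∧ s < k ∧ X s = w := by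
      intro t ht ht' w hw
      by_contra hcon
      push Not at hcon
      have hwn := hG.lt _ (hXn t ht') w hw
      exact (hcol w hwn).2 ⟨hcl _ (hXn t ht') (hvis t ht ht') w hw, hcon⟩ (hS t ht ht' w hw)
    -- Otherwise `X (j - 1)` would be a neighbour of `X j` outside the cycle.
    obtain rfl : j = 0 := by
      by_contra hj
      obtain ⟨i, rfl⟩ : ∃ i, j = i + 1 := ⟨j - 1, by omega⟩
      obtain ⟨s, hs, hs', h⟩ := hcl' (i + 1) le_rfl hjk (X i)
        (hG.symm _ (hXn i (by omega)) _ (hX.adj i hjk))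
      have := hinj _ hs' _ (by omega) h
      omega
    simp only [Nat.sub_zero] at hb4 hb6 hb7 hb8 hl₁ hQ
    have hC0 : ∀ t < k, σ.arr 2 (X t) = 0 := fun t ht => hC t (by omega) ht
    have post0 : ∀ col', Recoloured X (fun s => s < k) (σ.arr 2) col' →
        ∀ u < n, col' u ≠ 0 ↔ σ.arr 4 u ≠ 0 := fun col' r => post col' (r.congr (by omega))
    refine .seq (.findChord (u := X 1) hG hB1 hD (fun h => ⟨by rw [e6], hXn 1 ?_⟩) ?_)
    · rcases hX.fork with h' | h'
      · exact absurd h'.1 (e11 ▸ h)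
      · omega
    intro l₂ υ s2 hchord hl₂
    have hB2 := hB1.same s2 (by decide) (by decide)
    have S2 := S1.trans s2 (by decide) (by decide)
    refine .branch (fun hb' => ?_) (fun hb' => ?_)
    · simp only [Test.Holds, hB2.zero] at hb'
      obtain ⟨h1, h2, w, h3, h4⟩ := hchord.resolve_left fun h => hb' h.1
      obtain ⟨hk3, h02⟩ := (hX.fork.resolve_left fun h => h1 (e11.trans h.1)).2
      obtain ⟨b, -, hb1, rfl⟩ := hcl' 1 (by omega) (by omega) w h3
      rw [e7', (hX.mem b hb1).2] at h4
      refine .finishChord (X := X) (b := b) hG hB2 hD ((s2.reg 7 (by decide)).trans e7) h4.symm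
        ((s2.arr 6 (by decide)).trans e6) ((s2.arr 2 (by decide)).trans e2) hXn hinj hX.adj hgood
        hC0 (fun t ht => hS t (by omega) ht) h02 (by omega) hb1 h3 ?_
      intro l₃ ω s3 hB3 g r hl₃
      exact hQ _ _ (S2.trans s3 (by decide) (by decide)) hB3 g (post0 _ r) (by omega)
    · simp only [Test.Holds, hB2.zero, ne_eq, not_not] at hb'
      refine .finishPlain (X := X) hG hB2 hD ((s2.reg 7 (by decide)).trans e7)
        ((s2.arr 6 (by decide)).trans e6) ((s2.arr 2 (by decide)).trans e2) hXn hinj hgood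
        hC0 (hX.exc_or_even hG hE hdom ?_ ?_) ?_
      · intro t ht w hw
        obtain ⟨s, -, hs, h⟩ := hcl' t (by omega) ht w hw
        exact ⟨s, hs, h⟩
      · rcases hchord with h | h
        · rw [e11, e7'] at h
          exact h.2
        · omega
      intro l₃ ω s3 hB3 g r hl₃
      exact hQ _ _ (S2.trans s3 (by decide) (by decide)) hB3 g (post0 _ r) (by omega)

/-- Colour the component of the vertex in register `6`, which is regular of degree `D`. -/
def component : Program :=
  buildPath ;; colourOutside ;; finish

/-- The time is charged to the vertices that are new in the queue. They number at least `D + 1`,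
which pays for the search for a fork, and at least `k`, which pays for the path. -/
theorem WP.component {n D v : ℕ} {off nbr : ℕ → ℕ} {Exc : ℕ → Prop} {σ : Memory}
    {Q : ℕ → Memory → Prop}
    (hG : AdjLists n off nbr) (hD : ∀ v < n, deg off v ≤ D) (hE : ExcSpec n D off nbr Exc)
    (hσ : Stage n D off nbr Exc σ) (h6 : σ.reg 6 = v) (hv : v < n) (hv0 : σ.arr 4 v = 0)
    (hQ : ∀ l τ, Stage n D off nbr Exc τ → τ.reg 6 = v → (∀ u < n, σ.arr 4 u ≠ 0 → τ.arr 4 u ≠ 0) →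
      τ.arr 4 v ≠ 0 → σ.reg 5 ≤ τ.reg 5 → l ≤ 160 * (D + 1) * (τ.reg 5 - σ.reg 5) → Q l τ) :
    WP component σ Q := by
  set dom : ℕ → Prop := fun u => u < n ∧ σ.arr 4 u = 0
  have hcl : ∀ u < n, σ.arr 4 u ≠ 0 → ∀ w, Nbr off nbr u w → σ.arr 4 w ≠ 0 := by
    intro u hu hu' w hw
    obtain ⟨t, ht, rfl⟩ := hσ.listing.exists_of_ne hu hu'
    exact hσ.closed t ht w hw
  have hdom : ∀ u, dom u → u < n ∧ deg off u = D ∧ ∀ w, Nbr off nbr u w → dom w := by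
    rintro u ⟨hu, hu0⟩
    refine ⟨hu, hσ.regular u hu hu0, fun w hw => ⟨hG.lt u hu w hw, ?_⟩⟩
    by_contra h
    exact hcl w (hG.lt u hu w hw) h u (hG.symm u hu w hw) hu0
  refine .seq (.buildPath (dom := dom) hG hσ.base hD
    (fun u hu => ⟨(hdom u hu).1, (hdom u hu).2.2⟩) h6 ⟨hv, hv0⟩ (fun u hu => hσ.pos u hu.1 hu.2) ?_)
  intro l₁ τ k j s1 hB1 e7 e8 hX hl₁
  have hjk := hX.lt
  have hdX : ∀ t < k, dom (τ.arr 6 t) := fun t ht => (hX.mem t ht).1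
  have a2 : τ.arr 2 = σ.arr 2 := s1.arr 2 (by decide)
  have a4 : τ.arr 4 = σ.arr 4 := s1.arr 4 (by decide)
  have a5 : τ.arr 5 = σ.arr 5 := s1.arr 5 (by decide)
  have r5 : τ.reg 5 = σ.reg 5 := s1.reg 5 (by decide)
  refine .seq (.colourOutside (X := τ.arr 6) (m := σ.reg 5) (Exc := Exc) hG hB1 hD
    ((s1.reg 4 (by decide)).trans hσ.eq) r5 e7 e8 hjk rfl
    (by rw [a4]; exact hdX) (fun s hs t ht => hX.inj hs ht) (by rw [a4, a5]; exact hσ.listing)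
    (by rw [a4, a5]; exact hσ.closed) (by rw [a2]; exact hσ.good)
    (by rw [a2, a4]; exact hσ.col_iff) ?_)
  intro l₂ υ m' s2 hB2 f4 f5 hL2 hQ2 hm' hcl2 hvis hgood hcol hl₂
  have b6 : υ.arr 6 = τ.arr 6 := s2.arr 6 (by decide)
  have b7 : υ.arr 7 = τ.arr 7 := s2.arr 7 (by decide)
  rw [a5] at hQ2
  have hcl3 : ∀ u < n, υ.arr 4 u ≠ 0 → ∀ w, Nbr off nbr u w → υ.arr 4 w ≠ 0 := by
    intro u hu hu' w hw
    obtain ⟨t, ht, rfl⟩ := hL2.exists_of_ne hu hu'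
    exact hcl2 t ht w hw
  have hmono : ∀ u < n, σ.arr 4 u ≠ 0 → υ.arr 4 u ≠ 0 := by
    intro u hu hu'
    obtain ⟨t, ht, rfl⟩ := hσ.listing.exists_of_ne hu hu'
    rw [← hQ2 t ht, (hL2.mem t (by omega)).2]
    omega
  -- The search starts on the cycle; going back along the path, it also reaches the positions before
  -- `j`. Therefore the positions left in array `7` belong to visited vertices only, and the array
  -- stays clean for later components.
  have hvisX : ∀ s t, t < k → t + s + 1 = k → υ.arr 4 (τ.arr 6 t) ≠ 0 := by
    intro s
    induction s with
    | zero => exact fun t ht h => hvis t (by omega) ht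
    | succ s ih =>
      intro t ht h
      exact hcl3 _ (hdX (t + 1) (by omega)).1 (ih (t + 1) (by omega) (by omega)) _
        (hG.symm _ (hdX t ht).1 _ (hX.adj t (by omega)))
  replace hvisX : ∀ t < k, υ.arr 4 (τ.arr 6 t) ≠ 0 := fun t ht =>
    hvisX (k - 1 - t) t ht (by omega)
  have hv' : υ.arr 4 v ≠ 0 := by
    have := hvisX 0 (by omega)
    rwa [hX.start] at this
  refine .finish (dom := dom) (Exc := Exc) (v := v) hG hB2 hD hE hdom
    ((s2.reg 7 (by decide)).trans e7) ((s2.reg 8 (by decide)).trans e8)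
    (by rw [b6, b7, s2.reg 11 (by decide)]; exact hX) hcl3 (by rw [b6]; exact hvis) hgood
    (by rw [b6]; exact hcol) ?_
  intro l₃ ω s3 hB3 hgood3 hcol3 hl₃
  have c4 : ω.arr 4 = υ.arr 4 := s3.arr 4 (by decide)
  have c5 : ω.arr 5 = υ.arr 5 := s3.arr 5 (by decide)
  have c7 : ω.arr 7 = τ.arr 7 := (s3.arr 7 (by decide)).trans b7
  have c5' : ω.reg 5 = m' := (s3.reg 5 (by decide)).trans f5
  refine hQ _ _ ⟨hB3, by rwa [c4, c5, c5'], ?_, by rwa [c4, c5, c5'], hgood3, by rwa [c4], ?_, ?_⟩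
    ?_ (by rwa [c4]) (by rwa [c4]) (by omega) ?_
  · rw [c5', s3.reg 4 (by decide), f4]
  · intro u hu hu0
    rw [c4] at hu0
    refine hσ.regular u hu ?_
    by_contra h
    exact hmono u hu h hu0
  · intro u hu hu0
    rw [c4] at hu0
    rw [c7]
    by_contra h
    obtain ⟨t, ht, rfl⟩ := hX.exists_of_ne
      ⟨hu, by_contra fun h => hmono u hu h hu0⟩ h
    exact hvisX t ht hu0
  · rw [s3.reg 6 (by decide), s2.reg 6 (by decide), s1.reg 6 (by decide), h6]
  -- The new entries include `v` and its `D` neighbours.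
  · have n1 : D + 1 ≤ m' - σ.reg 5 := by
      have h1 := hσ.listing.card_le hL2 hQ2 (S := insert v (nbrs off nbr v)) (by
        intro u hu
        rcases Finset.mem_insert.1 hu with rfl | hu
        · exact ⟨hv, hv0, hv'⟩
        · have h := (hdom v ⟨hv, hv0⟩).2.2 u (mem_nbrs.1 hu)
          exact ⟨h.1, h.2, hcl3 v hv hv' u (mem_nbrs.1 hu)⟩)
      rwa [Finset.card_insert_of_notMem (fun h => hG.irrefl v hv (mem_nbrs.1 h)), hG.card v hv,
        hσ.regular v hv hv0] at h1
    have n2 : k ≤ m' - σ.reg 5 := by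
      have h1 := hσ.listing.card_le hL2 hQ2 (S := (Finset.range k).image (τ.arr 6)) (by
        intro u hu
        obtain ⟨t, ht, rfl⟩ := Finset.mem_image.1 hu
        have ht := Finset.mem_range.1 ht
        exact ⟨(hdX t ht).1, (hdX t ht).2, hvisX t ht⟩)
      rwa [Finset.card_image_of_injOn, Finset.card_range] at h1
      intro s hs t ht h
      exact hX.inj (by simpa using hs) (by simpa using ht) h
    rw [c5']
    set N := m' - σ.reg 5
    have p1 : (D + 1) * (D + 1) ≤ (D + 1) * N := Nat.mul_le_mul_left _ n1
    have p2 : (D + 1) * k ≤ (D + 1) * N := Nat.mul_le_mul_left _ n2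
    have p3 : (D + 1) * (k - j) ≤ (D + 1) * N := Nat.mul_le_mul_left _ (by omega)
    have p4 : D + 1 ≤ (D + 1) * N := Nat.le_mul_of_pos_right _ (by omega)
    rw [mul_assoc] at hl₁ hl₂ hl₃ ⊢
    rw [mul_assoc 10] at hl₁
    omega

end RAM

/-! ### The complete algorithm -/

namespace RAM

/-- Compute the maximum degree in register `1`. -/
def findMaxDegree : Program :=
  .loop (.lt 6 0) (Instr.load 24 0 6 ;; Instr.succ 6 6 ;; Instr.load 25 0 6 ;; Instr.sub 24 25 24 ;;
    .branch (.lt 1 24) (Instr.copy 1 24) skip)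

theorem WP.findMaxDegree {n D : ℕ} {off : ℕ → ℕ} {σ : Memory} {Q : ℕ → Memory → Prop}
    (hD : ∀ v < n, deg off v ≤ D) (hD' : D = 0 ∨ ∃ v < n, deg off v = D)
    (h0 : σ.reg 0 = n) (h1 : σ.reg 1 = 0) (h6 : σ.reg 6 = 0) (ha : σ.arr 0 = off)
    (hQ : ∀ l τ, Same [1, 6, 24, 25] [] σ τ → τ.reg 1 = D → l ≤ 7 * n + 1 → Q l τ) :
    WP findMaxDegree σ Q := by
  refine .loop (fun t τ => ∃ i, τ.reg 6 = i ∧ i ≤ n ∧ Same [1, 6, 24, 25] [] σ τ ∧ τ.reg 1 ≤ D ∧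
    (∀ v < i, deg off v ≤ τ.reg 1) ∧ t ≤ 7 * i) (fun τ => n - τ.reg 6) ?_ ?_ ?_
  · exact ⟨0, h6, by omega, .refl _ _ _, by omega, by simp, by simp⟩
  · rintro t τ ⟨i, c1, c2, c3, c4, c5, c6⟩ hb
    have e0 : τ.reg 0 = n := (c3.reg 0 (by decide)).trans h0
    have ea : τ.arr 0 = off := (c3.arr 0 (by decide)).trans ha
    simp only [Test.Holds, c1, e0] at hb
    have hdi := hD i hb
    have hlt : ∀ r, deg off i ≤ r → τ.reg 1 ≤ r → ∀ v < i + 1, deg off v ≤ r := by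
      intro r h1 h2 v hv
      rcases Nat.lt_succ_iff_lt_or_eq.1 hv with h | rfl
      · exact (c5 v h).trans h2
      · exact h1
    have s := (((c3.setReg (r := 24) (by decide) (off i)).setReg (r := 6) (by decide) (i + 1)).setReg
      (r := 25) (by decide) (off (i + 1))).setReg (r := 24) (by decide) (off (i + 1) - off i)
    refine .instr_seq (.instr_seq (.instr_seq (.instr_seq (.branch (fun hb' => .instr ?_)
      (fun hb' => .skip ?_)))))
    · simp only [Instr.effect, Memory.setReg_reg, Memory.setReg_arr, Nat.reduceEqDiff, if_true,
        if_false, c1, ea, Test.Holds, OfNat.one_ne_ofNat] at hb' ⊢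
      refine ⟨⟨i + 1, rfl, hb, s.setReg (by decide) _, hdi, hlt _ le_rfl hb'.le, by omega⟩, ?_⟩
      omega
    · simp only [Instr.effect, Memory.setReg_reg, Memory.setReg_arr, Nat.reduceEqDiff, if_true,
        if_false, c1, ea, Test.Holds, OfNat.one_ne_ofNat] at hb' ⊢
      rw [← deg] at hb'
      refine ⟨⟨i + 1, rfl, hb, s, c4, hlt _ (by omega) le_rfl, by omega⟩, ?_⟩
      omega
  · rintro t τ ⟨i, c1, c2, c3, c4, c5, c6⟩ hb
    have e0 : τ.reg 0 = n := (c3.reg 0 (by decide)).trans h0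
    simp only [Test.Holds, c1, e0] at hb
    refine hQ _ _ c3 ?_ (by omega)
    rcases hD' with h | ⟨v, hv, h⟩
    · omega
    · have := c5 v (by omega)
      omega

/-- Put the vertices of degree less than register `1` in the queue. -/
def seedLow : Program :=
  Instr.const 6 0 ;; .loop (.lt 6 0) (Instr.load 24 0 6 ;; Instr.succ 26 6 ;; Instr.load 25 0 26 ;;
    Instr.sub 24 25 24 ;; .branch (.lt 24 1)
      (Instr.store 5 5 6 ;; Instr.succ 5 5 ;; Instr.store 4 6 5) skip ;; Instr.copy 6 26)

theorem WP.seedLow {n D : ℕ} {off nbr : ℕ → ℕ} {σ : Memory} {Q : ℕ → Memory → Prop}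
    (hσ : Base n D off nbr σ) (hD : ∀ v < n, deg off v ≤ D) (h5 : σ.reg 5 = 0)
    (h4 : ∀ v, σ.arr 4 v = 0)
    (hQ : ∀ l τ, Same [5, 6, 24, 25, 26] [4, 5] σ τ →
      Listing (· < n) (τ.reg 5) (τ.arr 5) (τ.arr 4) →
      (∀ t < τ.reg 5, deg off (τ.arr 5 t) < D) → (∀ v < n, τ.arr 4 v = 0 → deg off v = D) →
      l ≤ 10 * n + 2 → Q l τ) : WP seedLow σ Q := by
  refine .instr_seq (.loop (fun t τ => ∃ i, τ.reg 6 = i ∧ i ≤ n ∧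
    Same [5, 6, 24, 25, 26] [4, 5] σ τ ∧ Listing (· < n) (τ.reg 5) (τ.arr 5) (τ.arr 4) ∧
    (∀ t < τ.reg 5, deg off (τ.arr 5 t) < D) ∧ (∀ v < i, τ.arr 4 v = 0 → deg off v = D) ∧
    (∀ v, i ≤ v → τ.arr 4 v = 0) ∧ t ≤ 10 * i) (fun τ => n - τ.reg 6) ?_ ?_ ?_)
  · refine ⟨0, by simp [Instr.effect], by omega, (Same.refl _ _ _).setReg (by decide) _, ⟨?_, ?_⟩,
      ?_, by simp, ?_, by simp⟩
    · simp [Instr.effect, h5]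
    · intro v _ h
      exact absurd (h4 v) h
    · simp [Instr.effect, h5]
    · exact fun v _ => h4 v
  · rintro t τ ⟨i, c1, c2, c3, c4, c5, c6, c7, c8⟩ hb
    have hB := hσ.same c3 (by decide) (by decide)
    simp only [Test.Holds, c1, hB.n] at hb
    have hdi := hD i hb
    have s := (((c3.setReg (r := 24) (by decide) (off i)).setReg (r := 26) (by decide) (i + 1)).setReg
      (r := 25) (by decide) (off (i + 1))).setReg (r := 24) (by decide) (off (i + 1) - off i)
    refine .instr_seq (.instr_seq (.instr_seq (.instr_seq (.seq (.branch (fun hb' => .instr_seq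
      (.instr_seq (.instr (.instr ?_)))) (fun hb' => .skip (.instr ?_)))))))
    · simp only [Instr.effect, Memory.setReg_reg, Memory.setReg_arr, Nat.reduceEqDiff, if_true,
        if_false, c1, hB.off, hB.D, Test.Holds, Memory.setArr_arr, Memory.setArr_reg,
        OfNat.one_ne_ofNat] at hb' ⊢
      rw [← deg] at hb'
      refine ⟨⟨i + 1, rfl, hb, (((s.setArr (by decide) _ _).setReg (by decide) _).setArr
        (by decide) _ _).setReg (by decide) _, c4.push hb (c7 i le_rfl), ?_, ?_, ?_, by omega⟩,
        by omega⟩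
      · intro t ht
        rw [Function.update_apply]
        split_ifs
        · exact hb'
        · exact c5 t (by omega)
      · intro v hv h
        rw [Function.update_apply] at h
        split_ifs at h with hvi
        · exact c6 v (by omega) h
      · intro v hv
        rw [Function.update_of_ne (by omega)]
        exact c7 v (by omega)
    · simp only [Instr.effect, Memory.setReg_reg, Memory.setReg_arr, Nat.reduceEqDiff, if_true,
        if_false, c1, hB.off, hB.D, Test.Holds, OfNat.one_ne_ofNat] at hb' ⊢
      rw [← deg] at hb'
      refine ⟨⟨i + 1, rfl, hb, s.setReg (by decide) _, c4, c5, ?_, fun v hv => c7 v (by omega),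
        by omega⟩, by omega⟩
      intro v hv h
      rcases Nat.lt_succ_iff_lt_or_eq.1 hv with h' | rfl
      · exact c6 v h' h
      · omega
  · rintro t τ ⟨i, c1, c2, c3, c4, c5, c6, c7, c8⟩ hb
    have hB := hσ.same c3 (by decide) (by decide)
    simp only [Test.Holds, c1, hB.n] at hb
    obtain rfl : i = n := by omega
    exact hQ _ _ c3 c4 c5 c6 (by omega)

/-- Colour the components with a vertex of degree less than register `1`. -/
def irregularComponents : Program :=
  seedLow ;; search ;; Instr.copy 13 5 ;; Instr.const 14 0 ;; colourDown 5

/-- Backwards along the queue, a vertex from the initial segment has slack by its degree, and any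
other by its uncoloured parent. All vertices of degree below `D` are roots, so every vertex not
reached has degree `D`. The factor `28` is `16` for the search plus `12` for the colouring. -/
theorem WP.irregularComponents {n D : ℕ} {off nbr : ℕ → ℕ} {Exc : ℕ → Prop} {σ : Memory}
    {Q : ℕ → Memory → Prop} (hG : AdjLists n off nbr) (hσ : Base n D off nbr σ)
    (hD : ∀ v < n, deg off v ≤ D) (hr4 : σ.reg 4 = 0) (hr5 : σ.reg 5 = 0)
    (h2 : ∀ v, σ.arr 2 v = 0) (h4 : ∀ v, σ.arr 4 v = 0) (h7 : ∀ v, σ.arr 7 v = 0)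
    (hQ : ∀ l τ, Stage n D off nbr Exc τ →
      l ≤ 10 * n + 28 * cost off (τ.arr 5) 0 (τ.reg 5) + 6 → Q l τ) :
    WP irregularComponents σ Q := by
  refine .seq (.seedLow hσ hD hr5 h4 ?_)
  intro l₁ τ s1 hL1 hlow hreg hl₁
  have hB1 := hσ.same s1 (by decide) (by decide)
  refine .seq (.search (a := 0) hG hB1 ((s1.reg 4 (by decide)).trans hr4) rfl (by omega) hL1
    (by simp) ?_)
  intro l₂ υ s2 hm e45 hL2 hcl hQ2 hpar hl₂
  have hB2 := hB1.same s2 (by decide) (by decide)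
  set m := υ.reg 5 with hmdef
  set X := υ.arr 5 with hXdef
  have hX : ∀ t < m, X t < n := fun t ht => (hL2.mem t ht).1
  have hinj : ∀ s < m, ∀ t < m, X s = X t → s = t := fun s hs t ht => hL2.inj hs ht
  have e2 : υ.arr 2 = σ.arr 2 := (s2.arr 2 (by decide)).trans (s1.arr 2 (by decide))
  have e7 : υ.arr 7 = σ.arr 7 := (s2.arr 7 (by decide)).trans (s1.arr 7 (by decide))
  refine .instr_seq (.instr_seq ?_)
  refine .colourDown (n := n) (D := D) (off := off) (nbr := nbr) (X := X) (a := 0) (b := m)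
    hG (hB2.same (((Same.refl [13, 14] [] _).setReg (by decide) _).setReg (by decide) _)
      (by decide) (by decide)) (by simp [Instr.effect, hmdef])
    (by simp [Instr.effect]) (by omega) (by simp [Instr.effect, hXdef])
    (by decide) (fun t _ ht => hX t ht)
    (fun t col' => GoodColouring n D off nbr Exc col' ∧
      Recoloured X (fun s => t ≤ s ∧ s < m) (σ.arr 2) col') ?_ ?_ ?_
  · simp only [Instr.effect, Memory.setReg_arr, e2]
    exact ⟨⟨by simp [h2], by simp [h2], by simp [h2]⟩, .refl (by omega) _⟩
  · rintro t col' c ht ht' ⟨a1, a2⟩ hf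
    have hXt := hX t ht'
    refine ⟨a1.firstFit hG hXt (hD _ hXt) hf (.inr ?_),
      a2.update (by have := hf.pos; omega) (by omega)⟩
    by_cases htm : t < τ.reg 5
    · refine .inl ?_
      rw [hQ2 t htm]
      exact hlow t htm
    · obtain ⟨s, hs, hadj⟩ := hpar t (by omega) ht'
      refine .inr (.inl ⟨_, hadj, ?_⟩)
      rw [a2.eq_of_not hinj (by omega) (by omega) (by omega), h2]
  intro l₃ ω hl₃ s3 hB3 ⟨g, r⟩
  have f4 : ω.arr 4 = υ.arr 4 := s3.arr 4 (by decide)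
  have f5 : ω.arr 5 = X := s3.arr 5 (by decide)
  have f7 : ω.arr 7 = σ.arr 7 := (s3.arr 7 (by decide)).trans e7
  have f5' : ω.reg 5 = m := s3.reg 5 (by decide)
  have f4' : ω.reg 4 = m := (s3.reg 4 (by decide)).trans (by simpa [Instr.effect] using e45)
  refine hQ _ _ ⟨hB3, by rwa [f4, f5, f5'], f4'.trans f5'.symm, by rwa [f4, f5, f5'], g, ?_, ?_, ?_⟩
    ?_
  · intro u hu
    rw [f4]
    constructor
    · intro h
      by_contra h'
      refine h ((r.2 u fun s hs hsu => ?_).trans (h2 u))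
      rw [← hsu, (hL2.mem s hs.2).2] at h'
      omega
    · intro h
      obtain ⟨s, hs, rfl⟩ := hL2.exists_of_ne hu h
      exact r.1 s ⟨by omega, hs⟩
  · intro u hu h
    rw [f4] at h
    refine hreg u hu ?_
    by_contra h'
    obtain ⟨s, hs, rfl⟩ := hL1.exists_of_ne hu h'
    rw [← hQ2 s hs, (hL2.mem s (by omega)).2] at h
    omega
  · intro u _ _
    rw [f7, h7]
  · rw [f5, f5']
    omega

/-- Colour the components that are still uncoloured. -/
def regularComponents : Program :=
  Instr.const 6 0 ;; .loop (.lt 6 0) (Instr.load 24 4 6 ;; .branch (.eq 24 2) component skip ;;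
    Instr.succ 6 6)

/-- The elapsed time is bounded by means of the growth of the queue, so the costs of the components
add up to at most `D + 1` times the number of vertices left by the first phase. -/
theorem WP.regularComponents {n D : ℕ} {off nbr : ℕ → ℕ} {Exc : ℕ → Prop} {σ : Memory}
    {Q : ℕ → Memory → Prop} (hG : AdjLists n off nbr) (hD : ∀ v < n, deg off v ≤ D)
    (hE : ExcSpec n D off nbr Exc) (hσ : Stage n D off nbr Exc σ)
    (hQ : ∀ l τ, GoodColouring n D off nbr Exc (τ.arr 2) → (∀ v < n, τ.arr 2 v ≠ 0) →
      l ≤ 5 * n + 160 * ((D + 1) * (n - σ.reg 5)) + 2 → Q l τ) :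
    WP regularComponents σ Q := by
  have stage_of_same : ∀ {rs : List ℕ} {τ υ : Memory}, Stage n D off nbr Exc τ → Same rs [] τ υ →
      (0 ∉ rs ∧ 1 ∉ rs ∧ 2 ∉ rs ∧ 3 ∉ rs) → 4 ∉ rs → 5 ∉ rs → Stage n D off nbr Exc υ := by
    intro rs τ υ h s hr h4 h5
    have a := fun A => s.arr A (by simp)
    exact ⟨h.base.same s hr (by decide), by rw [a, a, s.reg 5 h5]; exact h.listing,
      by rw [s.reg 4 h4, s.reg 5 h5]; exact h.eq, by rw [a, a, s.reg 5 h5]; exact h.closed,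
      by rw [a]; exact h.good, by rw [a, a]; exact h.col_iff, by rw [a]; exact h.regular,
      by rw [a, a]; exact h.pos⟩
  refine .instr_seq (.loop (fun t τ => ∃ i, τ.reg 6 = i ∧ i ≤ n ∧ Stage n D off nbr Exc τ ∧
    (∀ v < i, τ.arr 4 v ≠ 0) ∧ σ.reg 5 ≤ τ.reg 5 ∧
    t ≤ 5 * i + 160 * ((D + 1) * (τ.reg 5 - σ.reg 5))) (fun τ => n - τ.reg 6) ?_ ?_ ?_)
  · exact ⟨0, by simp [Instr.effect], by omega, stage_of_same hσ
      ((Same.refl [6] [] _).setReg (by decide) _) (by decide) (by decide) (by decide),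
      by simp, by simp [Instr.effect], by simp⟩
  · rintro t τ ⟨i, c1, c2, c3, c4, c5, c6⟩ hb
    simp only [Test.Holds, c1, c3.base.n] at hb
    have s24 : ∀ x, Same [24] [] τ (τ.setReg 24 x) := fun x => (Same.refl [24] [] _).setReg
      (by decide) _
    refine .instr_seq (.seq (.branch (fun hb' => ?_) (fun hb' => .skip (.instr ?_))))
    · simp only [Instr.effect, Memory.setReg_reg, Nat.reduceEqDiff, if_true,
        if_false, c1, c3.base.zero, Test.Holds] at hb' ⊢
      refine .component hG hD hE (stage_of_same c3 (s24 _) (by decide) (by decide) (by decide))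
        (by simpa using c1) hb hb' ?_
      intro l υ hS h6 hmono hi hle hl
      simp only [Memory.setReg_arr, Memory.setReg_reg, Nat.reduceEqDiff, if_false] at hmono hle hl
      refine .instr ⟨⟨i + 1, by simp [Instr.effect, h6], hb, stage_of_same hS
        ((Same.refl [6] [] _).setReg (by decide) _) (by decide) (by decide) (by decide), ?_, ?_, ?_⟩,
        ?_⟩
      · intro v hv
        rcases Nat.lt_succ_iff_lt_or_eq.1 hv with h' | rfl
        · exact hmono v (by omega) (c4 v h')
        · exact hi
      · simp [Instr.effect]
        omega
      · simp only [Instr.effect, Memory.setReg_reg, Nat.reduceEqDiff, if_false]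
        rw [show υ.reg 5 - σ.reg 5 = (τ.reg 5 - σ.reg 5) + (υ.reg 5 - τ.reg 5) by omega,
          mul_add (D + 1)]
        rw [mul_assoc] at hl
        omega
      · simp [Instr.effect, h6]
        omega
    · simp only [Instr.effect, Memory.setReg_reg, Nat.reduceEqDiff, if_true,
        if_false, c1, c3.base.zero, Test.Holds] at hb' ⊢
      refine ⟨⟨i + 1, rfl, hb, stage_of_same c3 ((s24 _).mono (rs' := [6, 24]) (by decide)
        (by decide) |>.setReg (by decide) _) (by decide) (by decide) (by decide), ?_, c5, ?_⟩,
        by omega⟩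
      · intro v hv
        rcases Nat.lt_succ_iff_lt_or_eq.1 hv with h' | rfl
        · exact c4 v h'
        · exact hb'
      · omega
  · rintro t τ ⟨i, c1, c2, c3, c4, c5, c6⟩ hb
    simp only [Test.Holds, c1, c3.base.n] at hb
    obtain rfl : i = n := by omega
    refine hQ _ _ c3.good (fun v hv => (c3.col_iff v hv).2 (c4 v hv)) ?_
    have : (D + 1) * (τ.reg 5 - σ.reg 5) ≤ (D + 1) * (i - σ.reg 5) := by
      have := c3.listing.le fun _ => id
      exact Nat.mul_le_mul_left _ (by omega)
    omega

/-- The linear-time colouring algorithm. -/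
def brooks : Program :=
  findMaxDegree ;; irregularComponents ;; regularComponents

theorem WP.brooks {n D : ℕ} {off nbr : ℕ → ℕ} {Exc : ℕ → Prop} (hG : AdjLists n off nbr)
    (hD : ∀ v < n, deg off v ≤ D) (hD' : D = 0 ∨ ∃ v < n, deg off v = D)
    (hE : ExcSpec n D off nbr Exc) :
    WP brooks (inputMemory n off nbr) fun k τ => k ≤ 200 * (n + off n + 1) ∧
      GoodColouring n D off nbr Exc (τ.arr 2) ∧ ∀ v < n, τ.arr 2 v ≠ 0 := by
  refine .seq (.findMaxDegree (off := off) hD hD' (by simp [inputMemory]) (by simp [inputMemory])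
    (by simp [inputMemory]) (by simp [inputMemory]) ?_)
  intro l₁ σ s h1 hl₁
  have r := fun r hr => s.reg r hr
  have a := fun A => s.arr A (by simp)
  refine .seq (.irregularComponents (D := D) (Exc := Exc) hG ⟨?_, ?_, ?_, h1, ?_, ?_⟩ hD
    ?_ ?_ ?_ ?_ ?_ ?_)
  · simp [a, inputMemory]
  · simp [a, inputMemory]
  · simp [r, inputMemory]
  · simp [r, inputMemory]
  · simp [a, inputMemory]
  · simp [r, inputMemory]
  · simp [r, inputMemory]
  · simp [a, inputMemory]
  · simp [a, inputMemory]
  · simp [a, inputMemory]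
  intro l₂ τ hS hl₂
  refine .regularComponents hG hD hE hS ?_
  intro l₃ υ hg hc hl₃
  refine ⟨?_, hg, hc⟩
  -- The cost of the first phase and `(D + 1) * (n - m)` for the second are together at most `off n
  -- + n`; the larger factor `160` and the terms linear in `n` fit into `200`.
  have := hS.listing.cost_add_le hG hS.regular
  omega

end RAM

/-! ## Exceptional components -/

open Classical in
/-- The component `c` has the same maximum degree as `G` and is a complete graph or an odd cycle. -/
def IsExceptional {V : Type*} [Fintype V] (G : SimpleGraph V) (c : G.ConnectedComponent) : Prop :=
  c.toSimpleGraph.maxDegree = G.maxDegree ∧ IsCompleteOrOddCycle c.toSimpleGraph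

/-- A component contains all neighbours of its vertices, so degrees do not change on passing to it.
-/
theorem SimpleGraph.ConnectedComponent.maxDegree_toSimpleGraph {V : Type*} [Fintype V]
    {G : SimpleGraph V} [DecidableRel G.Adj] (c : G.ConnectedComponent) [Fintype c]
    [DecidableRel c.toSimpleGraph.Adj] {D : ℕ} (h : ∀ x ∈ c, G.degree x = D) :
    c.toSimpleGraph.maxDegree = D := by
  have hdeg : ∀ x : c, c.toSimpleGraph.degree x = D := by
    intro x
    rw [← h x.1 x.2, ← SimpleGraph.card_neighborFinset_eq_degree,
      ← SimpleGraph.card_neighborFinset_eq_degree,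
      ← Finset.card_map (Function.Embedding.subtype _)]
    congr 1
    ext y
    simp only [Finset.mem_map, SimpleGraph.mem_neighborFinset, Function.Embedding.subtype_apply,
      Subtype.exists]
    constructor
    · rintro ⟨z, hz, hxz, rfl⟩
      exact (c.toSimpleGraph_adj x.2 hz).1 hxz
    · intro hxy
      have hy : y ∈ c := c.mem_supp_of_adj_mem_supp x.2 hxy
      exact ⟨y, hy, (c.toSimpleGraph_adj x.2 hy).2 hxy, rfl⟩
  have : Nonempty c := c.connected_toSimpleGraph.nonempty
  obtain ⟨x, hx⟩ := c.toSimpleGraph.exists_maximal_degree_vertex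
  rw [hx, hdeg]

theorem SimpleGraph.Reachable.mem_of_closed {V : Type*} {G : SimpleGraph V} {S : Set V}
    (hS : ∀ x ∈ S, ∀ y, G.Adj x y → y ∈ S) {u v : V} (h : G.Reachable u v) (hu : u ∈ S) :
    v ∈ S := by
  obtain ⟨p⟩ := h
  induction p with
  | nil => exact hu
  | cons h _ ih => exact ih (hS _ hu _ h)

theorem IsExceptional.isCompleteOrOddCycle {V : Type*} [Fintype V] {G : SimpleGraph V}
    {c : G.ConnectedComponent} (h : IsExceptional G c) (hG : G.Connected) :
    IsCompleteOrOddCycle G := by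
  have hc : ∀ x, x ∈ c := by
    intro x
    obtain ⟨y, hy⟩ := c.connected_toSimpleGraph.nonempty
    exact (c.mem_supp_iff x).2 (((SimpleGraph.ConnectedComponent.eq.2
      (hG.preconnected x y)).trans ((c.mem_supp_iff y).1 hy)))
  rcases h.2 with h | ⟨k, hk, ⟨e⟩⟩
  · refine .inl ?_
    ext x y
    rw [← c.toSimpleGraph_adj (hc x) (hc y), h]
    simp
  · let e' : G ≃g c.toSimpleGraph :=
      { toFun := fun x => ⟨x, hc x⟩
        invFun := fun x => x.1
        left_inv := fun _ => rfl
        right_inv := fun _ => rfl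
        map_rel_iff' := c.toSimpleGraph_adj _ _ }
    exact .inr ⟨k, hk, ⟨e'.trans e⟩⟩

/-- The closed neighbourhood of `v` is closed under adjacency, hence it is the whole component and
has `Δ + 1` vertices. Since each of them has degree `Δ`, each is adjacent to all the others. -/
theorem SimpleGraph.ConnectedComponent.isExceptional_of_complete {V : Type*} [Fintype V]
    {G : SimpleGraph V} [DecidableRel G.Adj] {v : V} (hv : G.degree v = G.maxDegree)
    (hw : ∀ w, G.Adj v w → G.degree w = G.maxDegree)
    (hu : ∀ w, G.Adj v w → ∀ u, G.Adj w u → u = v ∨ G.Adj v u) :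
    IsExceptional G (G.connectedComponentMk v) := by
  classical
  set c := G.connectedComponentMk v
  have hmem : ∀ x ∈ c, x = v ∨ G.Adj v x := by
    intro x hx
    have hx : G.Reachable v x := (SimpleGraph.ConnectedComponent.eq.1 hx).symm
    refine hx.mem_of_closed (S := {x | x = v ∨ G.Adj v x}) ?_ (.inl rfl)
    rintro x (rfl | hx) y hxy
    · exact .inr hxy
    · exact hu x hx y hxy
  have hdeg : ∀ x ∈ c, G.degree x = G.maxDegree := by
    intro x hx
    rcases hmem x hx with rfl | hx
    · exact hv
    · exact hw x hx
  refine ⟨?_, .inl ?_⟩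
  · convert c.maxDegree_toSimpleGraph hdeg
  · ext ⟨x, hx⟩ ⟨y, hy⟩
    rw [c.toSimpleGraph_adj hx hy, SimpleGraph.top_adj, ne_eq, Subtype.mk.injEq]
    refine ⟨fun h => h.ne, fun hxy => ?_⟩
    have hins : ∀ z ∈ c, z ∈ insert v (G.neighborFinset v) := by
      intro z hz
      simpa using hmem z hz
    have hsub : G.neighborFinset x ⊆ (insert v (G.neighborFinset v)).erase x := by
      intro z hz
      rw [SimpleGraph.mem_neighborFinset] at hz
      exact Finset.mem_erase.2 ⟨hz.ne', hins z (c.mem_supp_of_adj_mem_supp hx hz)⟩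
    -- Both sets have `Δ` elements.
    have heq := Finset.eq_of_subset_of_card_le hsub (by
      rw [Finset.card_erase_of_mem (hins x hx), Finset.card_insert_of_notMem (by simp),
        SimpleGraph.card_neighborFinset_eq_degree, SimpleGraph.card_neighborFinset_eq_degree, hv,
        hdeg x hx]
      omega)
    rw [← SimpleGraph.mem_neighborFinset, heq]
    exact Finset.mem_erase.2 ⟨Ne.symm hxy, hins y hy⟩

/-- The image of `X` is closed under adjacency and connected along the cycle, so it is the
component, and `X` is the inverse of the required isomorphism. -/
theorem SimpleGraph.ConnectedComponent.isExceptional_of_cycle {V : Type*} [Fintype V]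
    {G : SimpleGraph V} [DecidableRel G.Adj] {k : ℕ} (hk3 : 3 ≤ k) (hk : k % 2 = 1)
    {X : Fin k → V} (hX : Function.Injective X) (hdeg : ∀ t, G.degree (X t) = G.maxDegree)
    (hadj : ∀ t w, G.Adj (X t) w ↔ ∃ s : Fin k, w = X s ∧ (s.1 = t + 1 ∨ s.1 + 1 = t ∨
      t.1 = 0 ∧ s.1 + 1 = k ∨ t.1 + 1 = k ∧ s.1 = 0)) :
    IsExceptional G (G.connectedComponentMk (X ⟨0, by omega⟩)) := by
  classical
  set c := G.connectedComponentMk (X ⟨0, by omega⟩)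
  have hmem : ∀ x ∈ c, ∃ t, X t = x := by
    intro x hx
    have hx : G.Reachable (X ⟨0, by omega⟩) x := (SimpleGraph.ConnectedComponent.eq.1 hx).symm
    refine hx.mem_of_closed (S := {x | ∃ t, X t = x}) ?_ ⟨_, rfl⟩
    rintro _ ⟨t, rfl⟩ y hy
    obtain ⟨s, rfl, -⟩ := (hadj t y).1 hy
    exact ⟨s, rfl⟩
  have hmem' : ∀ t (ht : t < k), X ⟨t, ht⟩ ∈ c := by
    intro t
    induction t with
    | zero => exact fun _ => rfl
    | succ t ih =>
      intro ht
      exact c.mem_supp_of_adj_mem_supp (ih (by omega))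
        ((hadj _ _).2 ⟨⟨t + 1, ht⟩, rfl, .inl rfl⟩)
  refine ⟨?_, .inr ?_⟩
  · convert c.maxDegree_toSimpleGraph (D := G.maxDegree) ?_
    intro x hx
    obtain ⟨t, rfl⟩ := hmem x hx
    exact hdeg t
  · obtain ⟨q, rfl⟩ : ∃ q, k = 2 * q + 1 := ⟨k / 2, by omega⟩
    refine ⟨q, by omega, ⟨SimpleGraph.Iso.symm ⟨Equiv.ofBijective
      (fun t => (⟨X t, hmem' t.1 t.2⟩ : c)) ⟨fun s t hst => hX (Subtype.mk.inj hst), ?_⟩, ?_⟩⟩⟩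
    · rintro ⟨x, hx⟩
      obtain ⟨t, rfl⟩ := hmem x hx
      exact ⟨t, rfl⟩
    · intro a b
      change c.toSimpleGraph.Adj ⟨X a, _⟩ ⟨X b, _⟩ ↔ _
      rw [c.toSimpleGraph_adj, hadj, SimpleGraph.cycleGraph_adj']
      have key : (∃ s, X b = X s ∧ (s.1 = a.1 + 1 ∨ s.1 + 1 = a.1 ∨
          a.1 = 0 ∧ s.1 + 1 = 2 * q + 1 ∨ a.1 + 1 = 2 * q + 1 ∧ s.1 = 0)) ↔
          (b.1 = a.1 + 1 ∨ b.1 + 1 = a.1 ∨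
          a.1 = 0 ∧ b.1 + 1 = 2 * q + 1 ∨ a.1 + 1 = 2 * q + 1 ∧ b.1 = 0) := by
        constructor
        · rintro ⟨s, h, h'⟩
          rwa [hX h]
        · exact fun h => ⟨b, rfl, h⟩
      rw [key]
      have ha := a.2
      have hb := b.2
      -- Adjacency in `cycleGraph` is expressed by differences in `Fin`, which wrap around; fixing
      -- the order of `a` and `b` turns them into differences of natural numbers.
      rcases lt_trichotomy a b with h | h | h
      · rw [Fin.coe_sub_iff_lt.2 h, Fin.coe_sub_iff_le.2 h.le]
        have := Fin.lt_def.1 h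
        omega
      · subst h
        rw [Fin.coe_sub_iff_le.2 le_rfl]
        omega
      · rw [Fin.coe_sub_iff_lt.2 h, Fin.coe_sub_iff_le.2 h.le]
        have := Fin.lt_def.1 h
        omega

/-! ## Transfer to graphs on `Fin n` -/

namespace IsAdjacencyLists

variable {n : ℕ} {G : SimpleGraph (Fin n)} [DecidableRel G.Adj] {off nbr : ℕ → ℕ}

theorem nbr_iff (h : IsAdjacencyLists G off nbr) (v w : Fin n) :
    Nbr off nbr v w ↔ G.Adj v w :=
  (h.adj_iff v w).symm

theorem deg_eq (h : IsAdjacencyLists G off nbr) (v : Fin n) : deg off v = G.degree v := by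
  rw [deg, h.off_succ]
  omega

theorem off_le (h : IsAdjacencyLists G off nbr) : ∀ k v, v + k = n → off v ≤ off n := by
  intro k
  induction k with
  | zero =>
    rintro v rfl
    exact le_rfl
  | succ k ih =>
    intro v hv
    have h1 := ih (v + 1) (by omega)
    have h2 := h.off_succ ⟨v, by omega⟩
    simp only at h2
    omega

theorem nbr_lt' (h : IsAdjacencyLists G off nbr) {v w : ℕ} (hv : v < n)
    (hw : Nbr off nbr v w) : w < n := by
  obtain ⟨i, -, hi, rfl⟩ := hw
  have := h.off_le (n - (v + 1)) (v + 1) (by omega)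
  exact h.nbr_lt i (by omega)

theorem adjLists (h : IsAdjacencyLists G off nbr) : AdjLists n off nbr where
  le v hv := by
    have := h.off_succ ⟨v, hv⟩
    simp only at this
    omega
  lt v hv w hw := h.nbr_lt' hv hw
  symm v hv w hw := by
    have hwn := h.nbr_lt' hv hw
    exact (h.nbr_iff ⟨w, hwn⟩ ⟨v, hv⟩).2 ((h.nbr_iff ⟨v, hv⟩ ⟨w, hwn⟩).1 hw).symm
  irrefl v hv hvv := ((h.nbr_iff ⟨v, hv⟩ ⟨v, hv⟩).1 hvv).ne rfl
  card v hv := by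
    have h1 : nbrs off nbr v = (G.neighborFinset ⟨v, hv⟩).map Fin.valEmbedding := by
      ext w
      simp only [mem_nbrs, Finset.mem_map, SimpleGraph.mem_neighborFinset, Fin.valEmbedding_apply]
      constructor
      · intro hw
        have hwn := h.nbr_lt' hv hw
        exact ⟨⟨w, hwn⟩, (h.nbr_iff ⟨v, hv⟩ ⟨w, hwn⟩).1 hw, rfl⟩
      · rintro ⟨w, hw, rfl⟩
        exact (h.nbr_iff ⟨v, hv⟩ w).2 hw
    rw [h1, Finset.card_map, SimpleGraph.card_neighborFinset_eq_degree]
    exact (h.deg_eq ⟨v, hv⟩).symm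

/-- The lists have total length equal to the sum of the degrees; this converts the running time into
one in terms of edges. -/
theorem off_eq (h : IsAdjacencyLists G off nbr) : off n = 2 * G.edgeFinset.card := by
  have h1 := h.adjLists.sum_deg
  rw [h.off_zero, Finset.sum_add_distrib, Finset.sum_range] at h1
  simp only [h.deg_eq, G.sum_degrees_eq_twice_card_edges, Finset.sum_const, Finset.card_range,
    smul_eq_mul, mul_one] at h1
  omega

theorem deg_le (h : IsAdjacencyLists G off nbr) (v : ℕ) (hv : v < n) :
    deg off v ≤ G.maxDegree :=
  (h.deg_eq ⟨v, hv⟩).trans_le (G.degree_le_maxDegree _)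

theorem maxDegree_eq_or (h : IsAdjacencyLists G off nbr) :
    G.maxDegree = 0 ∨ ∃ v < n, deg off v = G.maxDegree := by
  rcases Nat.eq_zero_or_pos n with rfl | hn
  · exact .inl G.maxDegree_of_subsingleton
  · have : Nonempty (Fin n) := ⟨⟨0, hn⟩⟩
    obtain ⟨v, hv⟩ := G.exists_maximal_degree_vertex
    exact .inr ⟨v, v.2, (h.deg_eq v).trans hv.symm⟩

/-- The algorithm never decides exceptionality; only its analysis uses it, through the three
properties verified here. -/
theorem excSpec (h : IsAdjacencyLists G off nbr) :
    ExcSpec n G.maxDegree off nbr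
      fun v => ∃ hv : v < n, IsExceptional G (G.connectedComponentMk ⟨v, hv⟩) where
  closed v hv w hw := by
    rintro ⟨_, hE⟩
    have hwn := h.nbr_lt' hv hw
    refine ⟨hwn, ?_⟩
    rwa [← SimpleGraph.ConnectedComponent.connectedComponentMk_eq_of_adj
      ((h.nbr_iff ⟨v, hv⟩ ⟨w, hwn⟩).1 hw)]
  complete v hv hd hd' hc := by
    refine ⟨hv, SimpleGraph.ConnectedComponent.isExceptional_of_complete ?_ ?_ ?_⟩
    · exact (h.deg_eq ⟨v, hv⟩).symm.trans hd
    · intro w hw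
      exact (h.deg_eq w).symm.trans (hd' w ((h.nbr_iff ⟨v, hv⟩ w).2 hw))
    · intro w hw u hu
      rcases hc w ((h.nbr_iff ⟨v, hv⟩ w).2 hw) u ((h.nbr_iff w u).2 hu) with h' | h'
      · exact .inl (Fin.ext h')
      · exact .inr ((h.nbr_iff ⟨v, hv⟩ u).1 h')
  cycle k X hk3 hk hX hinj hadj := by
    have key := SimpleGraph.ConnectedComponent.isExceptional_of_cycle (G := G) hk3 hk
      (X := fun t => ⟨X t, (hX t t.2).1⟩)
      (fun s t hst => Fin.ext (hinj s s.2 t t.2 (congrArg Fin.val hst)))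
      (fun t => (h.deg_eq ⟨X t, (hX t t.2).1⟩).symm.trans (hX t t.2).2) fun t w => by
        rw [← h.nbr_iff, hadj t t.2]
        constructor
        · rintro ⟨s, hs, hw, h'⟩
          exact ⟨⟨s, hs⟩, Fin.ext hw, h'⟩
        · rintro ⟨s, rfl, h'⟩
          exact ⟨s, s.2, rfl, h'⟩
    exact ⟨(hX 0 (by omega)).1, key⟩

end IsAdjacencyLists

/-! ### Counting colours and conclusion -/

theorem numColours_le {V : Type*} [Fintype V] {f : V → ℕ} {D : ℕ} (h1 : ∀ v, 1 ≤ f v)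
    (h2 : ∀ v, f v ≤ D) : numColours f ≤ D := by
  have : Finset.univ.image f ⊆ Finset.Icc 1 D := by
    intro c hc
    obtain ⟨v, -, rfl⟩ := Finset.mem_image.1 hc
    exact Finset.mem_Icc.2 ⟨h1 v, h2 v⟩
  simpa [numColours] using Finset.card_le_card this

theorem mainTheorem1 :
    ∃ (P : RAM.Program) (C : ℕ), ∀ (n : ℕ) (G : SimpleGraph (Fin n)) [DecidableRel G.Adj]
      (off nbr : ℕ → ℕ), IsAdjacencyLists G off nbr →
        ∃ (k : ℕ) (τ : RAM.Memory),
          RAM.Runs P (inputMemory n off nbr) k τ ∧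
          k ≤ C * (n + G.edgeFinset.card + 1) ∧
          IsVertexColouring G (outputColour n τ) ∧
          numColours (outputColour n τ) ≤ G.maxDegree + 1 ∧
          (G.Connected ∨ ¬ HasExceptionalComponent G →
            IsBrooksColouring G (outputColour n τ)) := by
  -- The bound `200 * (n + off n + 1)` with `off n = 2 * |E|` leads to the constant `400`.
  refine ⟨RAM.brooks, 400, fun n G _ off nbr h => ?_⟩
  obtain ⟨k, τ, hrun, hk, hgood, hcol⟩ :=
    RAM.WP.brooks h.adjLists h.deg_le h.maxDegree_eq_or h.excSpec
  have hpos : ∀ v, 1 ≤ outputColour n τ v := fun v => Nat.one_le_iff_ne_zero.2 (hcol v v.2)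
  have hprop : IsVertexColouring G (outputColour n τ) :=
    ⟨hpos, fun v w hvw => hgood.proper v v.2 w ((h.nbr_iff v w).2 hvw) (hcol v v.2)⟩
  have hnum : numColours (outputColour n τ) ≤ G.maxDegree + 1 :=
    numColours_le hpos fun v => hgood.le_succ v v.2
  refine ⟨k, τ, hrun, ?_, hprop, hnum, fun hcase => ⟨hprop, ?_⟩⟩
  · rw [h.off_eq] at hk
    omega
  -- With an exceptional component `G` is connected by assumption, so it is itself complete or an
  -- odd cycle, and `Δ + 1` colours are allowed. Otherwise no vertex is exempt from the bound `Δ`.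
  · by_cases hE : HasExceptionalComponent G
    · obtain ⟨c, hc⟩ := hE
      have hconn := hcase.resolve_right fun h => h ⟨c, hc⟩
      exact .inr ⟨IsExceptional.isCompleteOrOddCycle hc hconn, hnum⟩
    · refine .inl (numColours_le hpos fun v => hgood.le v v.2 ?_)
      rintro ⟨hv, hc⟩
      exact hE ⟨_, hc⟩
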